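/- **Theorem B (error estimates for the Lagrangian solution to the transport equation).** *Setting.* Let $T>0$, $1<p<\infty$, and let $b\in L^1((0,T);W^{1,p}(\mathbb{R}^d;\mathbb{R}^d))\cap L^\infty((0,T)\times\mathbb{R}^d)$ be a divergence-free velocity field. A *regular Lagrangian flow* of $b$ on $[0,T]$ is a map $X$ such that for a.e. $x$ one has $X(t,x)=x+\int_0^t b(\tau,X(\tau,x))\,d\tau$ for all $t\in[0,T]$, and such that, for some $L>0$ independent of $t$, $\mathcal L^d(X(t,\cdot)^{-1}(A))\le L\,\mathcal L^d(A)$ for all open $A\subset\mathbb{R}^d$. The *Lagrangian solution* of $\partial_t u+b\cdot\nabla u=0$, $u|_{t=0}=u_0$, is $u^L(t,\cdot)=u_0(X^{-1}(t,\cdot))$, with $X$ the regular Lagrangian flow of $b$ and $X^{-1}(t,\cdot)$ its a.e. inverse. For $t\in[0,T]$ let $\bar b_t(s,x)=-b(t-s,x)$ for $s\le t$ and $\bar b_t(s,x)=0$ for $s>t$, and let $Y(t,\cdot,\cdot)$ be the backward regular Lagrangian flow, i.e. the regular Lagrangian flow of $\bar b_t$ on $[0,t]$. For every $t\in[0,T]$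 let $\{\bar b^\varepsilon_t\}_{0<\varepsilon\le 1}$ be an approximating sequence of $\bar b_t$ on $(0,T)$, with constants $\bar C_0,\bar C_1,\bar C_2,\bar C_3,\alpha,\beta>0$ that do not depend on $t$: $$\|\bar b_t^\varepsilon-\bar b_t\|_{L^1_sL^1_x}\le\bar C_0\varepsilon^\alpha,\quad \|\nabla \bar b_t^\varepsilon\|_{L^\infty_{s,x}}\le\bar C_1\varepsilon^{-\beta},\quad \|\operatorname{div}\bar b_t^\varepsilon\|_{L^\infty_{s,x}}\le\bar C_2,\quad \|\bar b_t^\varepsilon\|_{L^\infty_{s,x}}\le\bar C_3$$ (where $\bar b^\varepsilon_t(s,\cdot)$ is the continuous representative). Let $\theta\in[0,1]$. For $N\ge1$ put $h=T/N$, $t_i=ih$, $\varepsilon=h^{1/(2\beta)}$, $Y_0(t,x)=x$, and let $Y_{i+1}=Y_{i+1}(t,x)$ ($0\le i<N$) solve $$\frac{Y_{i+1}-Y_i}{h}=(1-\theta)\frac1h\int_{t_i}^{t_{i+1}}\bar b_t^\varepsilon(\tau,Y_i)\,d\tau+\theta\,\frac1h\int_{t_i}^{t_{i+1}}\bar b_t^\varepsilon(\tau,Y_{i+1})\,d\tau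 .$$ Let $\tilde Y^{N,\theta,\varepsilon}(t,s,x)=Y_i+\frac{s-t_i}{h}(Y_{i+1}-Y_i)$ for $s\in[t_i,t_{i+1}]$ be the piecewise linear interpolation. For $u_0\in L^1(\mathbb{R}^d)$ define the numerical solution $u^h(t,\cdot)=u_0(\tilde Y^{N,\theta,\varepsilon}(t,t,\cdot))$. *Claim.* There are constants $C>0$ and $h_0\in(0,1)$, depending only on $d$, $p$, $T$, (upper bounds for) $\|b\|_{L^\infty_{t,x}}$ and $\|\nabla b\|_{L^1_tL^p_x}$, and $\bar C_1,\bar C_2$, such that the following holds for every $u_0\in L^1(\mathbb{R}^d)$. For every $t\in[0,T]$, $u^L(t,\cdot)\in L^1(\mathbb{R}^d)$ and $u^L(t,\cdot)=u_0(Y(t,t,\cdot))$ a.e. For every $N\ge 1$ with $h=T/N\le h_0$ and every $t\in[0,T]$, $u^h(t,\cdot)\in L^1(\mathbb{R}^d)$, and for every $u_0^\delta\in C_c^\infty(\mathbb{R}^d)$, $$\sup_{t\in[0,T]}\|u^h(t,\cdot)-u^L(t,\cdot)\|_{L^1}\le C\left(\|u_0^\delta-u_0\|_{L^1}+\frac{C_\delta}{|\log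 h|}\right),$$ where $C_\delta$ depends only on $u_0^\delta$, on the quantities on which $C$ depends, and on $\bar C_0,\bar C_3,\alpha,\beta$ (in particular neither on $h$, nor on $\theta$, nor on $u_0$). Consequently $\sup_{t\in[0,T]}\|u^h(t,\cdot)-u^L(t,\cdot)\|_{L^1}\to0$ as $h\to0$. -/

import Mathlib

open MeasureTheory Filter Topology
open scoped ENNReal NNReal ContDiff Interval

noncomputable section

/-- The Euclidean space `ℝ^d`. -/
abbrev Sp (d : ℕ) : Type := EuclideanSpace ℝ (Fin d)

/-- Lebesgue measure on the time interval `(0,T)`. -/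
def timeMeasure (T : ℝ) : Measure ℝ := volume.restrict (Set.Ioo 0 T)

/-- `Df` is the weak (distributional) gradient of `f : ℝ^d → ℝ^d`: for every test function `φ`
and every direction `v`, `∫ (∂_v φ) f = - ∫ φ (Df v)`. -/
def HasWeakGradient {d : ℕ} (f : Sp d → Sp d) (Df : Sp d → (Sp d →L[ℝ] Sp d)) : Prop :=
  ∀ φ : Sp d → ℝ, ContDiff ℝ ∞ φ → HasCompactSupport φ → ∀ v : Sp d,
    ∫ x, (fderiv ℝ φ x v) • f x = - ∫ x, φ x • Df x v

/-- `b ∈ L¹((0,T); W^{1,p}(ℝ^d))`, with weak spatial gradient `Db`. -/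
structure MemL1W1p {d : ℕ} (T : ℝ) (p : ℝ≥0∞) (b : ℝ → Sp d → Sp d)
    (Db : ℝ → Sp d → (Sp d →L[ℝ] Sp d)) : Prop where
  meas : AEStronglyMeasurable (Function.uncurry b) ((timeMeasure T).prod volume)
  meas_grad : AEStronglyMeasurable (Function.uncurry Db) ((timeMeasure T).prod volume)
  memLp : ∀ᵐ t ∂timeMeasure T, MemLp (b t) p volume
  memLp_grad : ∀ᵐ t ∂timeMeasure T, MemLp (Db t) p volume
  weakGrad : ∀ᵐ t ∂timeMeasure T, HasWeakGradient (b t) (Db t)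
  norm_lt_top : ∫⁻ t, eLpNorm (b t) p volume ∂timeMeasure T < ⊤
  norm_grad_lt_top : ∫⁻ t, eLpNorm (Db t) p volume ∂timeMeasure T < ⊤

/-- The divergence belonging to a gradient: its trace. -/
def traceDiv {d : ℕ} (A : Sp d →L[ℝ] Sp d) : ℝ :=
  LinearMap.trace ℝ (Sp d) (A : Sp d →ₗ[ℝ] Sp d)

/-- `X` is a regular Lagrangian flow of `b` on `[0,T]`: for a.e. `x` the curve `t ↦ X t x` is an
absolutely continuous solution of `X' = b(t, X)`, `X(0) = x` (in integral form), and `X t` compresses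
Lebesgue measure at most by a factor `L` that does not depend on `t`. -/
structure IsRegularLagrangianFlow {d : ℕ} (T : ℝ) (b : ℝ → Sp d → Sp d)
    (X : ℝ → Sp d → Sp d) : Prop where
  meas : ∀ t ∈ Set.Icc 0 T, AEMeasurable (X t) volume
  ode : ∀ᵐ x : Sp d, IntervalIntegrable (fun τ => b τ (X τ x)) volume 0 T ∧
    ∀ t ∈ Set.Icc 0 T, X t x = x + ∫ τ in (0 : ℝ)..t, b τ (X τ x)
  compress : ∃ L : ℝ≥0, ∀ t ∈ Set.Icc 0 T, ∀ A : Set (Sp d), IsOpen A →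
    volume (X t ⁻¹' A) ≤ L * volume A

/-- `u` is the Lagrangian solution `u(t,·) = u₀ ∘ X(t,·)⁻¹`, where `X` is a regular Lagrangian
flow of `b`. As `X(t,·)` is defined up to null sets, its inverse `Z(t,·)` is an a.e. inverse on
both sides. -/
def IsLagrangianSolution {d : ℕ} (T : ℝ) (b : ℝ → Sp d → Sp d) (u₀ : Sp d → ℝ)
    (u : ℝ → Sp d → ℝ) : Prop :=
  ∃ X Z : ℝ → Sp d → Sp d, IsRegularLagrangianFlow T b X ∧
    ∀ t ∈ Set.Icc 0 T,
      (∀ᵐ x : Sp d, Z t (X t x) = x) ∧ (∀ᵐ x : Sp d, X t (Z t x) = x) ∧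
      (∀ᵐ x : Sp d, u t x = u₀ (Z t x))

/-- The backward field `b̄_t(s,x) = -b(t-s,x)` for `s ≤ t`, and `0` for `s > t`. -/
def backwardField {d : ℕ} (b : ℝ → Sp d → Sp d) (t s : ℝ) (x : Sp d) : Sp d :=
  if s ≤ t then -b (t - s) x else 0

/-- `bε` (first argument: the parameter `ε`) is an approximating sequence of `b` on `(0,T)` with
constants `C₀, …, C₃` and exponents `α, β`. The bound `‖∇bε‖_{L^∞} ≤ C₁ ε^{-β}` is expressed on the
continuous representative in space, as a Lipschitz bound; the divergence is the trace of the
derivative, which exists a.e. -/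
structure IsApproximatingSequence {d : ℕ} (T : ℝ) (b : ℝ → Sp d → Sp d)
    (bε : ℝ → ℝ → Sp d → Sp d) (C₀ C₁ C₂ C₃ α β : ℝ) : Prop where
  meas : ∀ ε ∈ Set.Ioc (0 : ℝ) 1,
    AEStronglyMeasurable (Function.uncurry (bε ε)) ((timeMeasure T).prod volume)
  approx : ∀ ε ∈ Set.Ioc (0 : ℝ) 1,
    ∫⁻ s, (∫⁻ x : Sp d, ‖bε ε s x - b s x‖ₑ) ∂timeMeasure T ≤ ENNReal.ofReal (C₀ * ε ^ α)
  grad : ∀ ε ∈ Set.Ioc (0 : ℝ) 1, ∀ᵐ s ∂timeMeasure T,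
    LipschitzWith (Real.toNNReal (C₁ / ε ^ β)) (bε ε s)
  div : ∀ ε ∈ Set.Ioc (0 : ℝ) 1, ∀ᵐ s ∂timeMeasure T, ∀ᵐ x : Sp d,
    |traceDiv (fderiv ℝ (bε ε s) x)| ≤ C₂
  bound : ∀ ε ∈ Set.Ioc (0 : ℝ) 1, ∀ᵐ s ∂timeMeasure T, ∀ x : Sp d, ‖bε ε s x‖ ≤ C₃

/-- `Y 0, …, Y N` is produced by the `θ`-method with time step `h = T/N` and nodes `t_i = i h`
applied to the field `B`. -/
def IsThetaScheme {d : ℕ} (T : ℝ) (N : ℕ) (θ : ℝ) (B : ℝ → Sp d → Sp d)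
    (Y : ℕ → Sp d → Sp d) : Prop :=
  (∀ x, Y 0 x = x) ∧
  ∀ i < N, ∀ x,
    (T / N)⁻¹ • (Y (i + 1) x - Y i x) =
      (1 - θ) • (⨍ τ in (i * (T / N))..((i + 1) * (T / N)), B τ (Y i x)) +
      θ • (⨍ τ in (i * (T / N))..((i + 1) * (T / N)), B τ (Y (i + 1) x))

/-- The piecewise linear interpolation in time of `Y 0, …, Y N` at the nodes `t_i = i T/N`: for
`s ∈ [t_i, t_{i+1}]`, `i < N`, it is `Y i + ((s - t_i)/h) (Y (i+1) - Y i)`. -/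
def thetaInterp {d : ℕ} (T : ℝ) (N : ℕ) (Y : ℕ → Sp d → Sp d) (s : ℝ) (x : Sp d) : Sp d :=
  let h : ℝ := T / N
  let i : ℕ := min ⌊s / h⌋₊ (N - 1)
  Y i x + ((s - i * h) / h) • (Y (i + 1) x - Y i x)

/-- The numerical solution `u^h(t,·) = u₀(Ỹ(t,t,·))`; here `Y t` is the discrete backward flow that
belongs to the final time `t`. -/
def numericalSolution {d : ℕ} (T : ℝ) (N : ℕ) (Y : ℝ → ℕ → Sp d → Sp d) (u₀ : Sp d → ℝ)
    (t : ℝ) (x : Sp d) : ℝ :=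
  u₀ (thetaInterp T N (Y t) t x)

end

/-! Both solutions are the datum composed with a map: `u^L(t) = u₀ ∘ Y(t,t,·)` and `u^h(t) = u₀ ∘
Ỹ(t,t,·)`. If both maps compress Lebesgue measure at most by a factor `L`, then replacing `u₀` by a
smooth `v` costs `2L‖v - u₀‖`. What remains is `v ∘ Ỹ - v ∘ Y`: the Lipschitz constant of `v`
controls it where the maps are close, and `sup |v|` times the measure of the bad set controls the
rest. So two facts are needed: a uniform `L`, and a bad set of measure `O(1/|log h|)`.

The bad set is treated in the manner of Crippa and De Lellis. For the error `D` between scheme and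
flow, the integral of `log (1 + |D|/δ)` over a set of finite measure is bounded by (truncation error
+ distance of the fields)/δ plus the integral of difference quotients of the Sobolev field along the
two trajectories. The Lusin–Lipschitz inequality bounds these quotients by the maximal function of
the gradient, which lies in `L^p` because `p > 1` (`HasWeakGradient.ae_enorm_sub_le`,
`exists_log_estimate`). With `δ = h^γ` and small `γ` the whole bound stays finite as `h → 0`, while
the logarithm is at least `(γ/2)|log h|` where `|D| ≥ h^(γ/2)`; Chebyshev's inequality concludes
(`exists_measure_deviation_le`).

The uniform `L` comes from the scheme. The choice of `ε` makes the Lipschitz constant `ℓ` of the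
regularised field `C₁ h^(-1/2)`, so one step is a perturbation of the identity whose Jacobian is `1
+ O(h)`: the first-order term is a bounded divergence, and the quadratic one is `O(h²ℓ²) = O(h)`.
Composing `N = T/h` steps gives a bound that depends on `d, T, C₁, C₂` only
(`exists_thetaScheme_compression`). The exact flow is a limit in measure of such iterates, hence
inherits this constant whatever its own was (`IsRegularLagrangianFlow.compresses_of_thetaScheme`).

Finally `u^L = u₀ ∘ Y` rests on `X(t, Y(t,·)) = id` a.e.; this is the same logarithmic estimate
without error terms, with `δ → 0` (`IsRegularLagrangianFlow.ae_comp_backward_eq`). -/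

noncomputable section

/-! ### The maximal function: weak and strong type. -/

/-- The (centered) Hardy–Littlewood maximal function. -/
def hlMax {d : ℕ} (f : Sp d → ℝ≥0∞) (x : Sp d) : ℝ≥0∞ :=
  ⨆ (r : ℝ) (_ : 0 < r), (∫⁻ y in Metric.ball x r, f y) / volume (Metric.ball x r)

theorem volume_ball_scale {d : ℕ} (x y : Sp d) {r s : ℝ} (hs : 0 < s) :
    volume (Metric.ball x (s * r)) = ENNReal.ofReal (s ^ d) * volume (Metric.ball y r) := by
  have := Measure.addHaar_ball_mul_of_pos (volume : Measure (Sp d)) x hs r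
  rw [this, finrank_euclideanSpace_fin, Measure.addHaar_ball_center volume y]

theorem volume_ball_pos' {d : ℕ} (x : Sp d) {r : ℝ} (hr : 0 < r) :
    volume (Metric.ball x r) ≠ 0 := (Metric.measure_ball_pos volume x hr).ne'

theorem volume_ball_ne_top {d : ℕ} (x : Sp d) (r : ℝ) :
    volume (Metric.ball x r) ≠ ⊤ := measure_ball_lt_top.ne

theorem setLIntegral_ball_le_hlMax {d : ℕ} (f : Sp d → ℝ≥0∞) (x : Sp d) {r : ℝ} (hr : 0 < r) :
    ∫⁻ y in Metric.ball x r, f y ≤ volume (Metric.ball x r) * hlMax f x := by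
  have h : (∫⁻ y in Metric.ball x r, f y) / volume (Metric.ball x r) ≤ hlMax f x :=
    le_iSup₂_of_le r hr le_rfl
  rw [mul_comm]
  exact (ENNReal.div_le_iff (volume_ball_pos' x hr) (volume_ball_ne_top x r)).1 h

/-- An open ball is the increasing union of slightly smaller concentric balls, and each of these
lies in the ball of radius `r` about every nearby centre. -/
theorem lowerSemicontinuous_setLIntegral_ball {d : ℕ} (f : Sp d → ℝ≥0∞) (r : ℝ) :
    LowerSemicontinuous fun x : Sp d => ∫⁻ y in Metric.ball x r, f y := by
  intro x a ha
  have hmono : Monotone fun n : ℕ => Metric.ball x (r - 1 / ((n : ℝ) + 1)) := by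
    intro m n hmn
    apply Metric.ball_subset_ball
    have : 1 / ((n : ℝ) + 1) ≤ 1 / ((m : ℝ) + 1) := by gcongr
    linarith
  have hU : Metric.ball x r = ⋃ n : ℕ, Metric.ball x (r - 1 / ((n : ℝ) + 1)) := by
    ext z
    simp only [Metric.mem_ball, Set.mem_iUnion]
    constructor
    · intro hz
      obtain ⟨n, hn⟩ := exists_nat_one_div_lt (sub_pos.2 hz)
      exact ⟨n, by linarith⟩
    · rintro ⟨n, hn⟩
      have : 0 < 1 / ((n : ℝ) + 1) := by positivity
      linarith
  have key : ∃ n : ℕ, a < ∫⁻ y in Metric.ball x (r - 1 / ((n : ℝ) + 1)), f y := by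
    simp only at ha
    rw [hU, setLIntegral_iUnion_of_directed _ hmono.directed_le] at ha
    exact lt_iSup_iff.1 ha
  obtain ⟨n, hn⟩ := key
  have hpos : 0 < 1 / ((n : ℝ) + 1) := by positivity
  filter_upwards [Metric.ball_mem_nhds x hpos] with z hz
  refine hn.trans_le (lintegral_mono_set (Metric.ball_subset_ball' ?_))
  rw [Metric.mem_ball, dist_comm] at hz
  linarith

theorem measurable_hlMax {d : ℕ} (f : Sp d → ℝ≥0∞) : Measurable (hlMax f) := by
  have h : LowerSemicontinuous (hlMax f) := by
    unfold hlMax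
    refine lowerSemicontinuous_iSup fun r => lowerSemicontinuous_iSup fun hr => ?_
    have h1 : ∀ x : Sp d, (∫⁻ y in Metric.ball x r, f y) / volume (Metric.ball x r) =
        (volume (Metric.ball (0 : Sp d) r))⁻¹ * ∫⁻ y in Metric.ball x r, f y := fun x => by
      rw [ENNReal.div_eq_inv_mul, Measure.addHaar_ball_center]
    simp_rw [h1]
    intro x a ha
    have h0 : (volume (Metric.ball (0 : Sp d) r))⁻¹ ≠ 0 :=
      ENNReal.inv_ne_zero.2 (volume_ball_ne_top _ _)
    have ht : (volume (Metric.ball (0 : Sp d) r))⁻¹ ≠ ⊤ :=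
      ENNReal.inv_ne_top.2 (volume_ball_pos' _ hr)
    have ha' : a / (volume (Metric.ball (0 : Sp d) r))⁻¹ < ∫⁻ y in Metric.ball x r, f y := by
      rw [ENNReal.div_lt_iff (Or.inl h0) (Or.inl ht), mul_comm]; exact ha
    filter_upwards [lowerSemicontinuous_setLIntegral_ball f r x _ ha'] with z hz
    rwa [gt_iff_lt, ENNReal.div_lt_iff (Or.inl h0) (Or.inl ht), mul_comm] at hz
  exact h.measurable

/-- The weak-type `(1,1)` estimate for the maximal function. -/
theorem hlMax_weak_type {d : ℕ} (f : Sp d → ℝ≥0∞) (a : ℝ≥0∞) :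
    a * volume {x : Sp d | a < hlMax f x} ≤ 5 ^ d * ∫⁻ y, f y := by
  -- Vitali's covering lemma needs bounded radii; the bound `n` is removed at the end by monotone
  -- convergence.
  set A : ℕ → Set (Sp d) := fun n =>
    {x | ∃ r : ℝ, 0 < r ∧ r ≤ n ∧ a * volume (Metric.ball x r) < ∫⁻ y in Metric.ball x r, f y}
    with hA
  have hAmono : Monotone A := by
    rintro m n hmn x ⟨r, h1, h2, h3⟩
    exact ⟨r, h1, h2.trans (by exact_mod_cast hmn), h3⟩
  have hU : {x : Sp d | a < hlMax f x} = ⋃ n, A n := by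
    ext x
    simp only [hlMax, Set.mem_ofPred_eq, lt_iSup_iff, Set.mem_iUnion, hA]
    constructor
    · rintro ⟨r, hr, h⟩
      refine ⟨⌈r⌉₊, r, hr, Nat.le_ceil r, ?_⟩
      rwa [ENNReal.lt_div_iff_mul_lt (Or.inl (volume_ball_pos' x hr))
        (Or.inl (volume_ball_ne_top x r))] at h
    · rintro ⟨n, r, hr, -, h⟩
      refine ⟨r, hr, ?_⟩
      rwa [ENNReal.lt_div_iff_mul_lt (Or.inl (volume_ball_pos' x hr))
        (Or.inl (volume_ball_ne_top x r))]
  have hmain : ∀ n, a * volume (A n) ≤ 5 ^ d * ∫⁻ y, f y := by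
    intro n
    set t : Set (Sp d × ℝ) := {q | 0 < q.2 ∧ q.2 ≤ n ∧
      a * volume (Metric.ball q.1 q.2) < ∫⁻ y in Metric.ball q.1 q.2, f y} with ht
    obtain ⟨u, hut, hdisj, hcov⟩ := Vitali.exists_disjoint_subfamily_covering_enlargement_ball t
      Prod.fst Prod.snd n (fun q hq => hq.2.1) 5 (by norm_num)
    have hc : u.Countable := by
      refine hdisj.countable_of_isOpen (fun q _ => Metric.isOpen_ball) fun q hq => ?_
      exact ⟨q.1, Metric.mem_ball_self (hut hq).1⟩
    have hsub : A n ⊆ ⋃ q ∈ u, Metric.ball q.1 (5 * q.2) := by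
      rintro x ⟨r, h1, h2, h3⟩
      obtain ⟨q, hq, hs⟩ := hcov (x, r) ⟨h1, h2, h3⟩
      exact Set.mem_biUnion hq (hs (Metric.mem_ball_self h1))
    calc a * volume (A n) ≤ a * ∑' q : u, volume (Metric.ball q.1.1 (5 * q.1.2)) := by
          gcongr
          exact (measure_mono hsub).trans (measure_biUnion_le _ hc _)
      _ = ∑' q : u, a * volume (Metric.ball q.1.1 (5 * q.1.2)) := ENNReal.tsum_mul_left.symm
      _ ≤ ∑' q : u, 5 ^ d * ∫⁻ y in Metric.ball q.1.1 q.1.2, f y := by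
          refine ENNReal.tsum_le_tsum fun q => ?_
          rw [volume_ball_scale _ q.1.1 (by norm_num : (0:ℝ) < 5),
            ENNReal.ofReal_pow (by norm_num), mul_left_comm]
          have h5 : ENNReal.ofReal 5 = 5 := by simp
          rw [h5]
          gcongr
          exact (hut q.2).2.2.le
      _ = 5 ^ d * ∑' q : u, ∫⁻ y in Metric.ball q.1.1 q.1.2, f y := ENNReal.tsum_mul_left
      _ = 5 ^ d * ∫⁻ y in ⋃ q ∈ u, Metric.ball q.1 q.2, f y := by
          rw [lintegral_biUnion hc (fun q _ => measurableSet_ball) hdisj]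
      _ ≤ _ := by gcongr; exact Measure.restrict_le_self
  rw [hU, hAmono.measure_iUnion, ENNReal.mul_iSup]
  exact iSup_le hmain

/-- The layer-cake formula, written pointwise so that Tonelli turns distributional bounds into `L^p`
bounds. -/
theorem lintegral_rpow_layer (q : ℝ) (hq : 0 < q) (a : ℝ≥0∞) :
    ∫⁻ t in Set.Ioi (0 : ℝ), (if ENNReal.ofReal t < a then ENNReal.ofReal (t ^ (q - 1)) else 0) =
      a ^ q / ENNReal.ofReal q := by
  have fin : ∀ c : ℝ, 0 ≤ c → ∫⁻ t in Set.Ioo (0 : ℝ) c, ENNReal.ofReal (t ^ (q - 1)) =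
      (ENNReal.ofReal c) ^ q / ENNReal.ofReal q := by
    intro c hc
    have hi : IntegrableOn (fun t : ℝ => t ^ (q - 1)) (Set.Ioo 0 c) := by
      rw [← intervalIntegrable_iff_integrableOn_Ioo_of_le hc]
      exact intervalIntegral.intervalIntegrable_rpow' (by linarith)
    rw [← ofReal_integral_eq_lintegral_ofReal hi]
    · rw [← integral_Ioc_eq_integral_Ioo, ← intervalIntegral.integral_of_le hc,
        integral_rpow (Or.inl (by linarith)), sub_add_cancel, Real.zero_rpow hq.ne', sub_zero,
        ENNReal.ofReal_div_of_pos hq, ENNReal.ofReal_rpow_of_nonneg hc hq.le]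
    · exact (ae_restrict_iff' measurableSet_Ioo).2 (.of_forall fun t ht =>
        Real.rpow_nonneg ht.1.le _)
  rcases eq_or_ne a ⊤ with rfl | ha
  · rw [ENNReal.top_rpow_of_pos hq, ENNReal.top_div_of_ne_top ENNReal.ofReal_ne_top, eq_top_iff]
    refine ENNReal.le_of_forall_nnreal_lt fun r _ => ?_
    -- The upper limit `c = (rq)^(1/q)` solves `c^q / q = r`.
    have h := fin ((r * q.toNNReal : ℝ≥0) ^ (q⁻¹) : ℝ) (by positivity)
    have : (r : ℝ≥0∞) = (ENNReal.ofReal ((r * q.toNNReal : ℝ≥0) ^ (q⁻¹) : ℝ)) ^ q /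
        ENNReal.ofReal q := by
      rw [ENNReal.ofReal_rpow_of_nonneg (by positivity) hq.le, ← Real.rpow_mul (by positivity),
        inv_mul_cancel₀ hq.ne', Real.rpow_one, ENNReal.ofReal_coe_nnreal, ENNReal.coe_mul,
        ENNReal.ofReal, ENNReal.mul_div_cancel_right]
      · simpa using hq
      · simp
    rw [this, ← h]
    simp only [ENNReal.ofReal_lt_top, if_true]
    exact lintegral_mono_set Set.Ioo_subset_Ioi_self
  · lift a to ℝ≥0 using ha
    have h := fin a a.2
    rw [ENNReal.ofReal_coe_nnreal] at h
    rw [← h, ← lintegral_indicator measurableSet_Ioi, ← lintegral_indicator measurableSet_Ioo]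
    congr 1 with t
    by_cases ht : 0 < t
    · by_cases hta : t < a
      · have : ENNReal.ofReal t < a := by
          rw [← ENNReal.ofReal_coe_nnreal]; exact (ENNReal.ofReal_lt_ofReal_iff (ht.trans hta)).2 hta
        simp [Set.indicator, ht, hta, this]
      · have : ¬ ENNReal.ofReal t < a := by
          rw [not_lt, ← ENNReal.ofReal_coe_nnreal]
          exact ENNReal.ofReal_le_ofReal (not_lt.1 hta)
        simp [Set.indicator, ht, hta, this]
    · simp [Set.indicator, ht]

/-- The part of `f` below the height `c` adds at most `c` to every average, so only the large part
has to enter the weak-type bound. -/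
theorem hlMax_le_add {d : ℕ} (f : Sp d → ℝ≥0∞) (c : ℝ≥0∞) (x : Sp d) :
    hlMax f x ≤ hlMax ({y | c < f y}.indicator f) x + c := by
  refine iSup₂_le fun r hr => ?_
  have h1 : ∫⁻ y in Metric.ball x r, f y ≤
      (∫⁻ y in Metric.ball x r, {y | c < f y}.indicator f y) + c * volume (Metric.ball x r) := by
    rw [← setLIntegral_const, ← lintegral_add_right _ measurable_const]
    refine lintegral_mono fun y => ?_
    by_cases hy : c < f y
    · simp [Set.indicator, hy]
    · simp [Set.indicator, hy, not_lt.1 hy]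
  calc _ ≤ _ := ENNReal.div_le_div_right h1 _
    _ = (∫⁻ y in Metric.ball x r, {y | c < f y}.indicator f y) / volume (Metric.ball x r) + c := by
      rw [ENNReal.add_div, ENNReal.mul_div_cancel_right (volume_ball_pos' x hr)
        (volume_ball_ne_top x r)]
    _ ≤ _ := by gcongr; exact le_iSup₂_of_le r hr le_rfl

/-- The strong-type `(p,p)` estimate for the maximal function, `1 < p < ∞`. -/
theorem exists_hlMax_strong_type (d : ℕ) (p : ℝ) (hp : 1 < p) :
    ∃ C : ℝ≥0, ∀ f : Sp d → ℝ≥0∞, Measurable f →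
      ∫⁻ x, hlMax f x ^ p ≤ C * ∫⁻ x, f x ^ p := by
  -- Marcinkiewicz interpolation: `p` is the layer-cake factor, `5^d · 2` comes from the weak type
  -- at height `t/2`, and the last factor from integrating `t^(p-2)` up to `2 f x`.
  refine ⟨(ENNReal.ofReal p * (5 ^ d * 2 * (2 ^ (p - 1) / ENNReal.ofReal (p - 1)))).toNNReal,
    fun f hf => ?_⟩
  have hp0 : 0 < p := by linarith
  have hp1 : 0 < p - 1 := by linarith
  have hC : ENNReal.ofReal p * (5 ^ d * 2 * (2 ^ (p - 1) / ENNReal.ofReal (p - 1))) ≠ ⊤ := by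
    have : (2 : ℝ≥0∞) ^ (p - 1) / ENNReal.ofReal (p - 1) ≠ ⊤ :=
      ENNReal.div_ne_top (by simp) (by simpa using hp1)
    have h5 : (5 : ℝ≥0∞) ^ d * 2 ≠ ⊤ := by finiteness
    exact ENNReal.mul_ne_top (by simp) (ENNReal.mul_ne_top h5 this)
  rw [ENNReal.coe_toNNReal hC]
  have hpz : ENNReal.ofReal p ≠ 0 := by simpa using hp0
  have lay : ∀ g : Sp d → ℝ≥0∞, ∀ q : ℝ, 0 < q → ∀ x, g x ^ q = ENNReal.ofReal q *
      ∫⁻ t in Set.Ioi (0 : ℝ),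
        (if ENNReal.ofReal t < g x then ENNReal.ofReal (t ^ (q - 1)) else 0) := by
    intro g q hq x
    rw [lintegral_rpow_layer q hq, ENNReal.mul_div_cancel (by simpa using hq) (by simp)]
  have meas : ∀ g : Sp d → ℝ≥0∞, Measurable g → ∀ q : ℝ, Measurable (fun z : Sp d × ℝ =>
      if ENNReal.ofReal z.2 < g z.1 then ENNReal.ofReal (z.2 ^ (q - 1)) else 0) := by
    intro g hg q
    refine Measurable.ite ?_ (by fun_prop) measurable_const
    exact measurableSet_lt (by fun_prop) (by fun_prop)
  have step : ∀ t : ℝ, 0 < t → volume {x : Sp d | ENNReal.ofReal t < hlMax f x} *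
      ENNReal.ofReal (t ^ (p - 1)) ≤
      5 ^ d * 2 * ∫⁻ x, f x * (if ENNReal.ofReal t < 2 * f x then
        ENNReal.ofReal (t ^ (p - 1 - 1)) else 0) := by
    intro t ht
    set c := ENNReal.ofReal (t / 2) with hc
    have hcc : c + c = ENNReal.ofReal t := by
      rw [hc, ← ENNReal.ofReal_add (by positivity) (by positivity)]; ring_nf
    have hc0 : c ≠ 0 := by simpa [hc] using ht
    have hsub : {x : Sp d | ENNReal.ofReal t < hlMax f x} ⊆
        {x | c < hlMax ({y | c < f y}.indicator f) x} := by
      intro x hx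
      simp only [Set.mem_ofPred_eq] at hx ⊢
      by_contra hcon
      have := (hlMax_le_add f c x).trans (add_le_add_left (not_lt.1 hcon) c)
      rw [hcc] at this
      exact absurd hx (not_lt.2 this)
    have hw := hlMax_weak_type ({y | c < f y}.indicator f) c
    -- One factor `t = 2c` is split off to pay for the weak-type inequality at height `c`.
    have e1 : ENNReal.ofReal (t ^ (p - 1)) = 2 * c * ENNReal.ofReal (t ^ (p - 1 - 1)) := by
      rw [two_mul, hcc, ← ENNReal.ofReal_mul ht.le, Real.rpow_sub_one ht.ne' (p - 1)]
      congr 1; field_simp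
    have e2 : ∫⁻ x, f x * (if ENNReal.ofReal t < 2 * f x then
        ENNReal.ofReal (t ^ (p - 1 - 1)) else 0) =
        ENNReal.ofReal (t ^ (p - 1 - 1)) * ∫⁻ y, {y | c < f y}.indicator f y := by
      rw [← lintegral_const_mul _ (hf.indicator (measurableSet_lt measurable_const hf))]
      congr 1 with x
      have : ENNReal.ofReal t < 2 * f x ↔ c < f x := by
        rw [← hcc, ← two_mul, ENNReal.mul_lt_mul_iff_right (by simp) (by simp)]
      by_cases h : c < f x
      · rw [if_pos (this.2 h), Set.indicator_of_mem (by exact h), mul_comm]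
      · simp [this, Set.indicator, h]
    rw [e2, e1]
    calc _ ≤ volume {x | c < hlMax ({y | c < f y}.indicator f) x} *
          (2 * c * ENNReal.ofReal (t ^ (p - 1 - 1))) := by gcongr
      _ = 2 * ENNReal.ofReal (t ^ (p - 1 - 1)) *
          (c * volume {x | c < hlMax ({y | c < f y}.indicator f) x}) := by ring
      _ ≤ 2 * ENNReal.ofReal (t ^ (p - 1 - 1)) *
          (5 ^ d * ∫⁻ y, {y | c < f y}.indicator f y) := by gcongr
      _ = _ := by ring
  calc ∫⁻ x, hlMax f x ^ p
      = ENNReal.ofReal p * ∫⁻ x, ∫⁻ t in Set.Ioi (0 : ℝ),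
        (if ENNReal.ofReal t < hlMax f x then ENNReal.ofReal (t ^ (p - 1)) else 0) := by
        rw [← lintegral_const_mul' _ _ (by simp)]
        exact lintegral_congr fun x => lay _ p hp0 x
    _ = ENNReal.ofReal p * ∫⁻ t in Set.Ioi (0 : ℝ), ∫⁻ x : Sp d,
        (if ENNReal.ofReal t < hlMax f x then ENNReal.ofReal (t ^ (p - 1)) else 0) := by
        rw [lintegral_lintegral_swap]
        exact (meas _ (measurable_hlMax f) p).aemeasurable
    _ ≤ ENNReal.ofReal p * ∫⁻ t in Set.Ioi (0 : ℝ), 5 ^ d * 2 * ∫⁻ x,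
        f x * (if ENNReal.ofReal t < 2 * f x then
        ENNReal.ofReal (t ^ (p - 1 - 1)) else 0) := by
        gcongr ENNReal.ofReal p * ?_
        refine setLIntegral_mono' measurableSet_Ioi fun t ht => ?_
        refine le_trans (le_of_eq ?_) (step t ht)
        have hms : MeasurableSet {x : Sp d | ENNReal.ofReal t < hlMax f x} :=
          measurableSet_lt measurable_const (measurable_hlMax f)
        rw [mul_comm, ← lintegral_indicator_const hms]
        exact lintegral_congr fun x => by simp [Set.indicator]
    _ = ENNReal.ofReal p * (5 ^ d * 2 * ∫⁻ x, f x * ((2 * f x) ^ (p - 1) /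
          ENNReal.ofReal (p - 1))) := by
        rw [lintegral_const_mul' _ _ (by finiteness), lintegral_lintegral_swap]
        · congr 2
          refine lintegral_congr fun x => ?_
          rw [← lintegral_rpow_layer (p - 1) hp1, lintegral_const_mul]
          exact (meas (fun x => 2 * f x) (by fun_prop) (p - 1)).comp measurable_prodMk_left
        · refine Measurable.aemeasurable ?_
          have := (meas (fun x => 2 * f x) (by fun_prop) (p - 1)).comp measurable_swap
          exact (hf.comp measurable_snd).mul this
    _ = _ := by
        rw [mul_assoc (ENNReal.ofReal p), mul_assoc (5 ^ d * 2), ← lintegral_const_mul' _ (fun x => f x ^ p)]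
        · congr 2
          refine lintegral_congr fun x => ?_
          rw [ENNReal.mul_rpow_of_nonneg _ _ hp1.le]
          have : f x ^ p = f x * f x ^ (p - 1) := by
            have h := ENNReal.rpow_add_of_nonneg (x := f x) 1 (p - 1) (by norm_num) hp1.le
            rw [ENNReal.rpow_one] at h
            rw [← h]; congr 1; ring
          rw [this]
          simp only [div_eq_mul_inv]
          ring
        · exact ENNReal.div_ne_top (by simp) (by simpa using hp1)

/-! ### The Lusin–Lipschitz inequality. -/

theorem setLIntegral_ball_homothety {d : ℕ} (h : Sp d → ℝ≥0∞) (hh : Measurable h) (x : Sp d)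
    (r : ℝ) {s : ℝ} (hs : 0 < s) :
    ENNReal.ofReal (s ^ d) * ∫⁻ z in Metric.ball x r, h (x + s • (z - x)) =
      ∫⁻ z in Metric.ball x (s * r), h z := by
  set H : Sp d → ℝ≥0∞ := (Metric.ball x (s * r)).indicator h with hH
  have hHm : Measurable H := hh.indicator measurableSet_ball
  have e1 : ∫⁻ z in Metric.ball x r, h (x + s • (z - x)) = ∫⁻ z, H (x + s • (z - x)) := by
    rw [← lintegral_indicator measurableSet_ball]
    refine lintegral_congr fun z => ?_
    have : x + s • (z - x) ∈ Metric.ball x (s * r) ↔ z ∈ Metric.ball x r := by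
      simp only [Metric.mem_ball, dist_eq_norm, add_sub_cancel_left, norm_smul, Real.norm_eq_abs,
        abs_of_pos hs]
      exact mul_lt_mul_iff_right₀ hs
    by_cases hz : z ∈ Metric.ball x r
    · rw [Set.indicator_of_mem hz, hH, Set.indicator_of_mem (this.2 hz)]
    · rw [Set.indicator_of_notMem hz, hH, Set.indicator_of_notMem (fun h => hz (this.1 h))]
  have e2 : ∫⁻ z, H (x + s • (z - x)) = ∫⁻ w, H (x + s • w) := by
    simpa [sub_eq_add_neg] using lintegral_add_right_eq_self (fun w => H (x + s • w)) (-x)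
  have e3 : ∫⁻ w, H (x + s • w) = ENNReal.ofReal |(s ^ d)⁻¹| * ∫⁻ w, H w := by
    have hm : Measurable fun u : Sp d => H (x + u) := hHm.comp (measurable_const_add x)
    have := lintegral_map (μ := (volume : Measure (Sp d))) hm (measurable_const_smul s)
    rw [Measure.map_addHaar_smul _ hs.ne', lintegral_smul_measure, finrank_euclideanSpace_fin,
      lintegral_add_left_eq_self] at this
    rw [← this, smul_eq_mul]
  have hpos : 0 < s ^ d := by positivity
  rw [e1, e2, e3, ← mul_assoc, ← ENNReal.ofReal_mul hpos.le, abs_of_pos (inv_pos.2 hpos),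
    mul_inv_cancel₀ hpos.ne', ENNReal.ofReal_one, one_mul, hH,
    lintegral_indicator measurableSet_ball]

/-- The dilation turns the average over `B(x,r)` into the average over `B(x,sr)`, and the maximal
function bounds averages at all scales; hence the bound is uniform in `s`. -/
theorem setLIntegral_ball_comp_le_hlMax {d : ℕ} (h : Sp d → ℝ≥0∞) (hh : Measurable h) (x : Sp d)
    {r s : ℝ} (hr : 0 < r) (hs : 0 < s) :
    ∫⁻ z in Metric.ball x r, h (x + s • (z - x)) ≤ volume (Metric.ball x r) * hlMax h x := by
  have h1 := setLIntegral_ball_homothety h hh x r hs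
  have h2 := setLIntegral_ball_le_hlMax h x (mul_pos hs hr)
  rw [← h1, volume_ball_scale x x hs, mul_assoc] at h2
  have hpos : ENNReal.ofReal (s ^ d) ≠ 0 := by simpa using pow_pos hs d
  exact (ENNReal.mul_le_mul_iff_right hpos ENNReal.ofReal_ne_top).1 h2

theorem enorm_sub_le_lintegral_fderiv {d : ℕ} {g : Sp d → Sp d} (hg : ContDiff ℝ 1 g)
    (x z : Sp d) : ‖g z - g x‖ₑ ≤
      ‖z - x‖ₑ * ∫⁻ s in Set.Ioc (0 : ℝ) 1, ‖fderiv ℝ g (x + s • (z - x))‖ₑ := by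
  have hline : ∀ s : ℝ, HasDerivAt (fun s : ℝ => g (x + s • (z - x)))
      (fderiv ℝ g (x + s • (z - x)) (z - x)) s := by
    intro s
    have h1 : HasDerivAt (fun s : ℝ => x + s • (z - x)) (z - x) s := by
      simpa using ((hasDerivAt_id s).smul_const (z - x)).const_add x
    exact ((hg.differentiable one_ne_zero _).hasFDerivAt).comp_hasDerivAt s h1
  have hc : Continuous fun s : ℝ => fderiv ℝ g (x + s • (z - x)) (z - x) :=
    ((hg.continuous_fderiv one_ne_zero).comp (by fun_prop)).clm_apply continuous_const
  have h2 := intervalIntegral.integral_eq_sub_of_hasDerivAt (a := 0) (b := 1)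
    (fun s _ => hline s) (hc.intervalIntegrable _ _)
  simp only [one_smul, add_sub_cancel, zero_smul, add_zero] at h2
  rw [← h2, intervalIntegral.integral_of_le zero_le_one]
  refine (enorm_integral_le_lintegral_enorm _).trans ?_
  rw [← lintegral_const_mul' _ _ (by simp)]
  refine lintegral_mono fun s => ?_
  rw [mul_comm]
  exact ContinuousLinearMap.le_opENorm _ _

/-- Integrate the mean value formula along the segments from `x` over the ball and exchange the
integrals; at a fixed fraction `s` the gradient is then averaged over the shrunken ball `B(x,sr)`.
-/
theorem setLIntegral_enorm_sub_le_hlMax {d : ℕ} {g : Sp d → Sp d} (hg : ContDiff ℝ 1 g)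
    (x : Sp d) {r : ℝ} (hr : 0 < r) :
    ∫⁻ z in Metric.ball x r, ‖g z - g x‖ₑ ≤
      ENNReal.ofReal r * (volume (Metric.ball x r) * hlMax (fun y => ‖fderiv ℝ g y‖ₑ) x) := by
  have hc : Continuous fun y => ‖fderiv ℝ g y‖ₑ := (hg.continuous_fderiv one_ne_zero).enorm
  calc ∫⁻ z in Metric.ball x r, ‖g z - g x‖ₑ
      ≤ ∫⁻ z in Metric.ball x r, ENNReal.ofReal r *
          ∫⁻ s in Set.Ioc (0 : ℝ) 1, ‖fderiv ℝ g (x + s • (z - x))‖ₑ := by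
        refine setLIntegral_mono' measurableSet_ball fun z hz => ?_
        refine (enorm_sub_le_lintegral_fderiv hg x z).trans ?_
        gcongr
        rw [← ofReal_norm]
        exact ENNReal.ofReal_le_ofReal (by simpa [dist_eq_norm] using (Metric.mem_ball.1 hz).le)
    _ = ENNReal.ofReal r * ∫⁻ s in Set.Ioc (0 : ℝ) 1,
          ∫⁻ z in Metric.ball x r, ‖fderiv ℝ g (x + s • (z - x))‖ₑ := by
        rw [lintegral_const_mul' _ _ (by simp), lintegral_lintegral_swap]
        refine Continuous.aemeasurable ?_
        exact hc.comp (by fun_prop)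
    _ ≤ ENNReal.ofReal r * ∫⁻ _s in Set.Ioc (0 : ℝ) 1,
          volume (Metric.ball x r) * hlMax (fun y => ‖fderiv ℝ g y‖ₑ) x := by
        gcongr ENNReal.ofReal r * ?_
        refine setLIntegral_mono' measurableSet_Ioc fun s hs => ?_
        exact setLIntegral_ball_comp_le_hlMax _ hc.measurable x hr hs.1
    _ = _ := by simp

/-- The Lusin–Lipschitz inequality for `C¹` maps. -/
theorem enorm_sub_le_hlMax_of_contDiff {d : ℕ} {g : Sp d → Sp d} (hg : ContDiff ℝ 1 g)
    (x y : Sp d) : ‖g x - g y‖ₑ ≤ 2 ^ d * ‖x - y‖ₑ *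
      (hlMax (fun z => ‖fderiv ℝ g z‖ₑ) x + hlMax (fun z => ‖fderiv ℝ g z‖ₑ) y) := by
  rcases eq_or_ne x y with rfl | hxy
  · simp
  set r := ‖x - y‖ with hr
  have hr0 : 0 < r := norm_pos_iff.2 (sub_ne_zero.2 hxy)
  -- The ball of radius `r/2` about the midpoint lies in both `B(x,r)` and `B(y,r)`; averaging over
  -- it compares `g x` and `g y` with common values `g z`, and the ratio of volumes is `2^d`.
  set m : Sp d := midpoint ℝ x y with hm
  have hmx : dist m x = r / 2 := by
    rw [hm, dist_midpoint_left, dist_eq_norm]; norm_num; ring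
  have hmy : dist m y = r / 2 := by
    rw [hm, dist_midpoint_right, dist_eq_norm]; norm_num; ring
  have sx : Metric.ball m (r / 2) ⊆ Metric.ball x r := Metric.ball_subset_ball' (by linarith)
  have sy : Metric.ball m (r / 2) ⊆ Metric.ball y r := Metric.ball_subset_ball' (by linarith)
  have hgc := hg.continuous
  have vol : ∀ w : Sp d, volume (Metric.ball w r) = 2 ^ d * volume (Metric.ball m (r / 2)) := by
    intro w
    have := volume_ball_scale w m (r := r / 2) (s := 2) (by norm_num)
    rw [mul_div_cancel₀ _ (by norm_num : (2 : ℝ) ≠ 0), ENNReal.ofReal_pow (by norm_num)] at this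
    simpa using this
  have main : volume (Metric.ball m (r / 2)) * ‖g x - g y‖ₑ ≤
      volume (Metric.ball m (r / 2)) * (2 ^ d * ‖x - y‖ₑ *
      (hlMax (fun z => ‖fderiv ℝ g z‖ₑ) x + hlMax (fun z => ‖fderiv ℝ g z‖ₑ) y)) := by
    calc volume (Metric.ball m (r / 2)) * ‖g x - g y‖ₑ
        = ∫⁻ _z in Metric.ball m (r / 2), ‖g x - g y‖ₑ := by rw [setLIntegral_const, mul_comm]
      _ ≤ ∫⁻ z in Metric.ball m (r / 2), (‖g z - g x‖ₑ + ‖g z - g y‖ₑ) := by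
          refine lintegral_mono fun z => ?_
          rw [← enorm_neg (g z - g x), neg_sub]
          calc ‖g x - g y‖ₑ = ‖(g x - g z) + (g z - g y)‖ₑ := by congr 1; abel
            _ ≤ _ := enorm_add_le _ _
      _ = (∫⁻ z in Metric.ball m (r / 2), ‖g z - g x‖ₑ) +
          ∫⁻ z in Metric.ball m (r / 2), ‖g z - g y‖ₑ :=
          lintegral_add_left (by fun_prop) _
      _ ≤ (∫⁻ z in Metric.ball x r, ‖g z - g x‖ₑ) +
          ∫⁻ z in Metric.ball y r, ‖g z - g y‖ₑ := by
          gcongr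
      _ ≤ _ := add_le_add (setLIntegral_enorm_sub_le_hlMax hg x hr0)
          (setLIntegral_enorm_sub_le_hlMax hg y hr0)
      _ = _ := by
          rw [vol x, vol y, ← ofReal_norm (x - y), ← hr]; ring
  exact (ENNReal.mul_le_mul_iff_right (volume_ball_pos' m (by positivity))
    (volume_ball_ne_top m _)).1 main

/-- By Tonelli the integral of the mollification over `B(x,s)` is `∫ k F`, where `k` vanishes off
`B(x,s+η)`, `k ≤ 1` and `k ≤ 2^d |B_s| / |B_η|`. The first bound serves for `η ≤ s`, the second for
`s ≤ η`. The constant does not depend on the mollification scale, so the scale can tend to `0`. -/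
theorem hlMax_mollification_le {d : ℕ} (φ : ContDiffBump (0 : Sp d)) (hφ : φ.rOut ≤ 2 * φ.rIn)
    (F : Sp d → ℝ≥0∞) (hF : Measurable F) (x : Sp d) :
    hlMax (fun z => ∫⁻ y, ENNReal.ofReal (φ.normed volume (z - y)) * F y) x ≤
      4 ^ d * hlMax F x := by
  set ρ : Sp d → ℝ := φ.normed volume with hρ
  have hρc : Continuous ρ := φ.continuous_normed
  set η := φ.rOut with hη
  have hη0 : 0 < η := φ.rOut_pos
  refine iSup₂_le fun s hs => ?_
  rw [ENNReal.div_le_iff (volume_ball_pos' x hs) (volume_ball_ne_top x s)]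
  set k : Sp d → ℝ≥0∞ := fun y => ∫⁻ z in Metric.ball x s, ENNReal.ofReal (ρ (z - y)) with hk
  have hswap : ∫⁻ z in Metric.ball x s, ∫⁻ y, ENNReal.ofReal (ρ (z - y)) * F y =
      ∫⁻ y, k y * F y := by
    rw [lintegral_lintegral_swap]
    · refine lintegral_congr fun y => ?_
      rw [lintegral_mul_const _ (by fun_prop)]
    · refine Measurable.aemeasurable ?_
      refine Measurable.mul (Measurable.ennreal_ofReal ?_) (hF.comp measurable_snd)
      exact (hρc.comp (continuous_fst.sub continuous_snd)).measurable
  have k_one : ∀ y, k y ≤ 1 := by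
    intro y
    calc k y ≤ ∫⁻ z, ENNReal.ofReal (ρ (z - y)) := setLIntegral_le_lintegral _ _
      _ = ∫⁻ z, ENNReal.ofReal (ρ z) := 
          lintegral_sub_right_eq_self (μ := (volume : Measure (Sp d)))
            (fun z => ENNReal.ofReal (ρ z)) y
      _ = ENNReal.ofReal (∫ z, ρ z) :=
          (ofReal_integral_eq_lintegral_ofReal φ.integrable_normed
            (.of_forall fun z => φ.nonneg_normed z)).symm
      _ = 1 := by rw [φ.integral_normed, ENNReal.ofReal_one]
  have k_zero : ∀ y, s + η ≤ dist y x → k y = 0 := by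
    intro y hy
    refine (setLIntegral_congr_fun measurableSet_ball fun z hz => ?_).trans lintegral_zero
    have : z - y ∉ Function.support ρ := by
      rw [hρ, φ.support_normed_eq, Metric.mem_ball, dist_zero_right, ← dist_eq_norm, not_lt]
      have h1 := dist_triangle y z x
      rw [dist_comm y z] at h1
      have h2 := Metric.mem_ball.1 hz
      linarith
    simp [Function.notMem_support.1 this]
  have k_small : ∀ y, k y * volume (Metric.ball x η) ≤ 2 ^ d * volume (Metric.ball x s) := by
    intro y
    have hb : ∀ z, ENNReal.ofReal (ρ z) ≤ 2 ^ d / volume (Metric.ball x η) := by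
      intro z
      have h1 := φ.normed_le_div_measure_closedBall_rOut volume 2 hφ z
      have hvol : volume (Metric.ball x η) ≤ volume (Metric.closedBall (0 : Sp d) η) := by
        rw [Measure.addHaar_ball_center volume x]
        exact measure_mono Metric.ball_subset_closedBall
      have hcl : volume (Metric.closedBall (0 : Sp d) η) ≠ ⊤ := measure_closedBall_lt_top.ne
      have hcl0 : volume (Metric.closedBall (0 : Sp d) η) ≠ 0 :=
        (Metric.measure_closedBall_pos volume _ hη0).ne'
      refine (ENNReal.ofReal_le_ofReal h1).trans ?_
      rw [finrank_euclideanSpace_fin, ← hη, Measure.real, ENNReal.ofReal_div_of_pos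
        (ENNReal.toReal_pos hcl0 hcl), ENNReal.ofReal_toReal hcl, ENNReal.ofReal_pow (by norm_num),
        ENNReal.ofReal_ofNat]
      gcongr
    calc k y * volume (Metric.ball x η)
        ≤ (∫⁻ _z in Metric.ball x s, 2 ^ d / volume (Metric.ball x η)) *
          volume (Metric.ball x η) := by
          gcongr
          exact lintegral_mono fun z => hb _
      _ = _ := by
          rw [setLIntegral_const, mul_right_comm, ENNReal.div_mul_cancel (volume_ball_pos' x hη0)
            (volume_ball_ne_top x η)]
  have hbound : ∀ R : ℝ, 0 < R → (s + η ≤ R) → ∀ c : ℝ≥0∞, (∀ y, k y ≤ c) →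
      ∫⁻ y, k y * F y ≤ c * (volume (Metric.ball x R) * hlMax F x) := by
    intro R hR hsR c hc
    calc ∫⁻ y, k y * F y ≤ ∫⁻ y, (Metric.ball x R).indicator (fun y => c * F y) y := by
          refine lintegral_mono fun y => ?_
          by_cases hy : y ∈ Metric.ball x R
          · rw [Set.indicator_of_mem hy]
            gcongr
            exact hc y
          · rw [Metric.mem_ball, not_lt] at hy
            simp [k_zero y (hsR.trans hy)]
      _ = c * ∫⁻ y in Metric.ball x R, F y := by
          rw [lintegral_indicator measurableSet_ball, lintegral_const_mul _ hF]
      _ ≤ _ := by gcongr; exact setLIntegral_ball_le_hlMax F x hR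
  have two : ∀ r : ℝ, volume (Metric.ball x (2 * r)) = 2 ^ d * volume (Metric.ball x r) := by
    intro r
    rw [volume_ball_scale x x (by norm_num : (0 : ℝ) < 2), ENNReal.ofReal_pow (by norm_num)]
    simp
  have h24 : (2 : ℝ≥0∞) ^ d * 2 ^ d = 4 ^ d := by rw [← mul_pow]; norm_num
  rw [hswap]
  rcases le_total η s with h | h
  · refine (hbound (2 * s) (by positivity) (by linarith) 1 k_one).trans ?_
    rw [two, one_mul, mul_right_comm]
    gcongr
    norm_num
  · refine (hbound (2 * η) (by positivity) (by linarith)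
      (2 ^ d * volume (Metric.ball x s) / volume (Metric.ball x η)) fun y => ?_).trans ?_
    · rw [ENNReal.le_div_iff_mul_le (Or.inl (volume_ball_pos' x hη0))
        (Or.inl (volume_ball_ne_top x η))]
      exact k_small y
    · rw [two, ← h24]
      refine le_of_eq ?_
      have e := ENNReal.div_mul_cancel (b := 2 ^ d * volume (Metric.ball x s))
        (volume_ball_pos' x hη0) (volume_ball_ne_top x η)
      calc _ = (2 ^ d * volume (Metric.ball x s) / volume (Metric.ball x η) *
            volume (Metric.ball x η)) * 2 ^ d * hlMax F x := by ring
        _ = _ := by rw [e]; ring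

theorem hlMax_mono {d : ℕ} {f g : Sp d → ℝ≥0∞} (h : ∀ x, f x ≤ g x) (x : Sp d) :
    hlMax f x ≤ hlMax g x :=
  iSup₂_mono fun _ _ => ENNReal.div_le_div_right (lintegral_mono h) _

theorem hlMax_congr_ae {d : ℕ} {f g : Sp d → ℝ≥0∞} (h : f =ᵐ[volume] g) : hlMax f = hlMax g := by
  funext x
  unfold hlMax
  congr 1 with r
  congr 1 with hr
  rw [lintegral_congr_ae (ae_restrict_of_ae h)]

/-- The derivative falls on the kernel, and `y ↦ ρ (z - y)` is an admissible test function for the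
weak gradient; so the derivative of the mollification is the mollification of `Df`. -/
theorem enorm_fderiv_mollification_le {d : ℕ} (φ : ContDiffBump (0 : Sp d)) {f : Sp d → Sp d}
    {Df : Sp d → (Sp d →L[ℝ] Sp d)} (hf : LocallyIntegrable f) (hDf : LocallyIntegrable Df)
    (h : HasWeakGradient f Df) (z : Sp d) :
    ‖fderiv ℝ (convolution (φ.normed volume) f (ContinuousLinearMap.lsmul ℝ ℝ) volume) z‖ₑ ≤
      ∫⁻ y, ENNReal.ofReal (φ.normed volume (z - y)) * ‖Df y‖ₑ := by
  set ρ : Sp d → ℝ := φ.normed volume with hρ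
  have hρs : HasCompactSupport ρ := φ.hasCompactSupport_normed
  have hρd : ContDiff ℝ ∞ ρ := φ.contDiff_normed
  set ψ : Sp d → ℝ := fun y => ρ (z - y) with hψ
  have hψd : ContDiff ℝ ∞ ψ := hρd.comp (contDiff_const.sub contDiff_id)
  have hψs : HasCompactSupport ψ := hρs.comp_homeomorph (Homeomorph.subLeft z)
  have hint : Integrable fun y => ψ y • Df y :=
    hDf.integrable_smul_left_of_hasCompactSupport hψd.continuous hψs
  have hd := hρs.hasFDerivAt_convolution_left (ContinuousLinearMap.lsmul ℝ ℝ)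
    (hρd.of_le (by exact_mod_cast le_top)) hf z
  have key : fderiv ℝ (convolution ρ f (ContinuousLinearMap.lsmul ℝ ℝ) volume) z =
      ∫ y, ψ y • Df y := by
    ext1 v
    rw [hd.fderiv, ContinuousLinearMap.integral_apply hint, convolution_eq_swap]
    have hint2 : Integrable fun t => (ContinuousLinearMap.precompL (Sp d)
        (ContinuousLinearMap.lsmul ℝ ℝ : ℝ →L[ℝ] Sp d →L[ℝ] Sp d) (fderiv ℝ ρ (z - t))) (f t) := by
      have h1 := (hρs.fderiv (𝕜 := ℝ)).convolutionExists_left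
        (ContinuousLinearMap.precompL (Sp d)
          (ContinuousLinearMap.lsmul ℝ ℝ : ℝ →L[ℝ] Sp d →L[ℝ] Sp d))
        (hρd.continuous_fderiv (by simp)) hf z
      exact h1.integrable_swap
    rw [ContinuousLinearMap.integral_apply hint2]
    have hw := h ψ hψd hψs v
    have hfd : ∀ y, fderiv ℝ ψ y v = - (fderiv ℝ ρ (z - y) v) := by
      intro y
      have h1 : HasFDerivAt ψ ((fderiv ℝ ρ (z - y)).comp
          (-ContinuousLinearMap.id ℝ (Sp d))) y := by
        have h2 : HasFDerivAt ρ (fderiv ℝ ρ (z - y)) (z - y) :=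
          ((hρd.differentiable (by simp)) (z - y)).hasFDerivAt
        have h3 : HasFDerivAt (fun y : Sp d => z - y) (-ContinuousLinearMap.id ℝ (Sp d)) y :=
          (hasFDerivAt_id (𝕜 := ℝ) y).const_sub z
        exact h2.comp y h3
      rw [h1.fderiv]
      simp
    simp only [hfd, neg_smul, integral_neg, neg_inj] at hw
    simp only [ContinuousLinearMap.precompL_apply, ContinuousLinearMap.lsmul_apply,
      smul_apply]
    exact hw
  rw [key]
  refine (enorm_integral_le_lintegral_enorm _).trans (le_of_eq ?_)
  refine lintegral_congr fun y => ?_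
  rw [enorm_smul, Real.enorm_eq_ofReal (φ.nonneg_normed _)]

/-- The Lusin–Lipschitz inequality for maps with a locally integrable weak gradient: outside a null
set, difference quotients are bounded by the maximal function of the gradient. -/
theorem HasWeakGradient.ae_enorm_sub_le {d : ℕ} {f : Sp d → Sp d}
    {Df : Sp d → (Sp d →L[ℝ] Sp d)} (hf : LocallyIntegrable f) (hDf : LocallyIntegrable Df)
    (h : HasWeakGradient f Df) :
    ∃ s : Set (Sp d), (∀ᵐ x, x ∈ s) ∧ ∀ x ∈ s, ∀ y ∈ s, ‖f x - f y‖ₑ ≤ 8 ^ d * ‖x - y‖ₑ *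
      (hlMax (fun z => ‖Df z‖ₑ) x + hlMax (fun z => ‖Df z‖ₑ) y) := by
  set φ : ℕ → ContDiffBump (0 : Sp d) := fun n =>
    ⟨1 / ((n : ℝ) + 1) / 2, 1 / ((n : ℝ) + 1), by positivity, half_lt_self (by positivity)⟩ with hφ
  have hlim : Tendsto (fun n => (φ n).rOut) atTop (𝓝 0) := tendsto_one_div_add_atTop_nhds_zero_nat
  have h2 : ∀ n, (φ n).rOut ≤ 2 * (φ n).rIn := fun n => by
    simp only [hφ]; linarith
  have hae := ContDiffBump.ae_convolution_tendsto_right_of_locallyIntegrable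
    (μ := (volume : Measure (Sp d))) hlim (K := 2) (.of_forall h2) hf
  -- The good set consists of the points where the mollifications converge to `f`. There the `C¹`
  -- inequality passes to the limit, with `8^d = 2^d · 4^d` from the `C¹` case and from mollifying
  -- the gradient.
  refine ⟨{x | Tendsto (fun n => convolution ((φ n).normed volume) f
    (ContinuousLinearMap.lsmul ℝ ℝ) volume x) atTop (𝓝 (f x))}, hae, fun x hx y hy => ?_⟩
  have hm : AEStronglyMeasurable Df volume := hDf.aestronglyMeasurable
  set F : Sp d → ℝ≥0∞ := fun z => ‖hm.mk Df z‖ₑ with hF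
  have hFm : Measurable F := hm.stronglyMeasurable_mk.enorm
  have hFe : (fun z => ‖Df z‖ₑ) =ᵐ[volume] F := by
    filter_upwards [hm.ae_eq_mk] with z hz
    simp only [hF]
    rw [← hz]
  rw [hlMax_congr_ae hFe]
  have hn : ∀ n, ‖convolution ((φ n).normed volume) f (ContinuousLinearMap.lsmul ℝ ℝ) volume x -
      convolution ((φ n).normed volume) f (ContinuousLinearMap.lsmul ℝ ℝ) volume y‖ₑ ≤
      8 ^ d * ‖x - y‖ₑ * (hlMax F x + hlMax F y) := by
    intro n
    have hc : ContDiff ℝ 1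
        (convolution ((φ n).normed volume) f (ContinuousLinearMap.lsmul ℝ ℝ) volume) :=
      (φ n).hasCompactSupport_normed.contDiff_convolution_left (n := 1) _
        ((φ n).contDiff_normed) hf
    have hmax : ∀ w, hlMax (fun z => ‖fderiv ℝ (convolution ((φ n).normed volume) f
        (ContinuousLinearMap.lsmul ℝ ℝ) volume) z‖ₑ) w ≤ 4 ^ d * hlMax F w := by
      intro w
      refine le_trans (hlMax_mono (fun z => ?_) w) (hlMax_mollification_le (φ n) (h2 n) F hFm w)
      refine (enorm_fderiv_mollification_le (φ n) hf hDf h z).trans (le_of_eq ?_)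
      refine lintegral_congr_ae ?_
      filter_upwards [hFe] with y hy
      rw [hy]
    refine (enorm_sub_le_hlMax_of_contDiff hc x y).trans ?_
    calc _ ≤ 2 ^ d * ‖x - y‖ₑ * (4 ^ d * hlMax F x + 4 ^ d * hlMax F y) := by
          gcongr <;> exact hmax _
      _ = (2 ^ d * 4 ^ d) * ‖x - y‖ₑ * (hlMax F x + hlMax F y) := by ring
      _ = _ := by rw [← mul_pow]; norm_num
  exact le_of_tendsto (Tendsto.sub hx hy).enorm (.of_forall hn)

/-! ### Determinants and maps near the identity. -/

/-- The trace as a continuous linear functional on endomorphisms. -/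
def traceCLM (d : ℕ) : (Sp d →L[ℝ] Sp d) →L[ℝ] ℝ :=
  LinearMap.toContinuousLinearMap
    { toFun := fun A => traceDiv A
      map_add' := fun A B => map_add (LinearMap.trace ℝ (Sp d)) (A : Sp d →ₗ[ℝ] Sp d) (B : Sp d →ₗ[ℝ] Sp d)
      map_smul' := fun c A => map_smul (LinearMap.trace ℝ (Sp d)) c (A : Sp d →ₗ[ℝ] Sp d) }

theorem traceCLM_apply {d : ℕ} (A : Sp d →L[ℝ] Sp d) : traceCLM d A = traceDiv A := rfl

theorem contDiff_det_one_add (d : ℕ) :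
    ContDiff ℝ 2 fun B : Sp d →L[ℝ] Sp d => (1 + B).det := by
  set b := (EuclideanSpace.basisFun (Fin d) ℝ).toBasis
  have h : (fun B : Sp d →L[ℝ] Sp d => (1 + B).det) = fun B =>
      ∑ σ : Equiv.Perm (Fin d), (Equiv.Perm.sign σ : ℤ) • ∏ i,
        LinearMap.toMatrix b b ((1 + B : Sp d →L[ℝ] Sp d) : Sp d →ₗ[ℝ] Sp d) (σ i) i := by
    funext B
    rw [ContinuousLinearMap.det, ← LinearMap.det_toMatrix b, Matrix.det_apply]
    rfl
  rw [h]
  refine ContDiff.sum fun σ _ => ContDiff.const_smul _ (contDiff_prod fun i _ => ?_)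
  simp only [LinearMap.toMatrix_apply, b]
  have : ∀ B : Sp d →L[ℝ] Sp d, ((EuclideanSpace.basisFun (Fin d) ℝ).toBasis.repr
      (((1 + B : Sp d →L[ℝ] Sp d) : Sp d →ₗ[ℝ] Sp d)
        ((EuclideanSpace.basisFun (Fin d) ℝ).toBasis i))) (σ i) =
      EuclideanSpace.proj (𝕜 := ℝ) (σ i) ((1 + B) (EuclideanSpace.basisFun (Fin d) ℝ i)) := by
    intro B; simp
  simp_rw [this]
  exact (EuclideanSpace.proj (𝕜 := ℝ) (σ i)).contDiff.comp
    ((contDiff_const.add contDiff_id).clm_apply contDiff_const)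

/-- On each line `t ↦ t • B` the determinant is `1 + t tr B + t² P(t)` with a polynomial `P`, by
`Matrix.det_one_add_smul`. -/
theorem fderiv_det_one_add_zero (d : ℕ) :
    fderiv ℝ (fun B : Sp d →L[ℝ] Sp d => (1 + B).det) 0 = traceCLM d := by
  ext B
  set b := (EuclideanSpace.basisFun (Fin d) ℝ).toBasis
  have hd := ((contDiff_det_one_add d).differentiable (by norm_num) 0).hasFDerivAt
  have h1 : HasDerivAt (fun t : ℝ => t • B) B 0 := by
    simpa using (hasDerivAt_id (0 : ℝ)).smul_const B
  have h0 : HasFDerivAt (fun B : Sp d →L[ℝ] Sp d => (1 + B).det)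
      (fderiv ℝ (fun B : Sp d →L[ℝ] Sp d => (1 + B).det) 0) ((0 : ℝ) • B) := by
    have e : (0 : ℝ) • B = 0 := zero_smul ℝ B
    rw [e]; exact hd
  have h2 := h0.comp_hasDerivAt (0 : ℝ) h1
  set M := LinearMap.toMatrix b b (B : Sp d →ₗ[ℝ] Sp d) with hM
  have h3 : (fun t : ℝ => (1 + t • B).det) = fun t : ℝ => 1 + M.trace * t +
      (Matrix.det (1 + (Polynomial.X : Polynomial ℝ) • M.map Polynomial.C)).divX.divX.eval t
        * t ^ 2 := by
    funext t
    rw [← Matrix.det_one_add_smul, ContinuousLinearMap.det, ← LinearMap.det_toMatrix b]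
    congr 1
    have : ((1 + t • B : Sp d →L[ℝ] Sp d) : Sp d →ₗ[ℝ] Sp d) =
      LinearMap.id + t • (B : Sp d →ₗ[ℝ] Sp d) := rfl
    rw [this, map_add, map_smul, LinearMap.toMatrix_id]
  set P := (Matrix.det (1 + (Polynomial.X : Polynomial ℝ) • M.map Polynomial.C)).divX.divX
  have h4 : HasDerivAt (fun t : ℝ => (1 + t • B).det) M.trace 0 := by
    rw [h3]
    have e1 : HasDerivAt (fun t : ℝ => 1 + M.trace * t) M.trace 0 := by
      simpa using ((hasDerivAt_id (0 : ℝ)).const_mul M.trace).const_add 1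
    have e2 : HasDerivAt (fun t : ℝ => P.eval t * t ^ 2) 0 0 := by
      exact ((P.hasDerivAt (0 : ℝ)).fun_mul (hasDerivAt_pow 2 (0 : ℝ))).congr_deriv (by simp)
    exact (e1.fun_add e2).congr_deriv (by simp)
  have h5 := h2.unique h4
  rw [h5, hM, traceCLM_apply, traceDiv, LinearMap.trace_eq_matrix_trace ℝ b]

/-- Second-order expansion of the determinant at the identity. -/
theorem exists_abs_det_one_add_sub_le (d : ℕ) :
    ∃ r K : ℝ, 0 < r ∧ 0 ≤ K ∧ ∀ B : Sp d →L[ℝ] Sp d, ‖B‖ ≤ r →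
      |(1 + B).det - 1 - traceDiv B| ≤ K * ‖B‖ ^ 2 := by
  set f := fun B : Sp d →L[ℝ] Sp d => (1 + B).det with hf
  have hc := contDiff_det_one_add d
  have hc1 : ContDiff ℝ 1 (fderiv ℝ f) := hc.fderiv_right (by norm_num)
  obtain ⟨K, t, ht, hK⟩ := (hc1.contDiffAt (x := 0)).exists_lipschitzOnWith
  obtain ⟨r, hr, hrt⟩ := Metric.nhds_basis_closedBall.mem_iff.1 ht
  refine ⟨r, K, hr, K.2, fun B hB => ?_⟩
  -- On the ball of radius `‖B‖` the derivative differs from the trace by at most `K ‖B‖`; the mean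
  -- value inequality there yields the quadratic remainder.
  have hsub : ∀ A ∈ Metric.closedBall (0 : Sp d →L[ℝ] Sp d) ‖B‖, ‖fderiv ℝ f A - traceCLM d‖ ≤
      K * ‖B‖ := by
    intro A hA
    have hA' : ‖A‖ ≤ ‖B‖ := by simpa using hA
    have h1 := hK.dist_le_mul A (hrt (by simpa using hA'.trans hB)) 0
      (hrt (by simpa using hr.le))
    rw [dist_eq_norm, dist_zero_right, fderiv_det_one_add_zero] at h1
    exact h1.trans (by gcongr)
  have := (convex_closedBall (0 : Sp d →L[ℝ] Sp d) ‖B‖).norm_image_sub_le_of_norm_hasFDerivWithin_le'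
    (f := f) (f' := fderiv ℝ f) (φ := traceCLM d) (x := 0) (y := B)
    (fun A _ => ((hc.differentiable (by norm_num)) A).hasFDerivAt.hasFDerivWithinAt) hsub
    (by simp) (by simp)
  have hf0 : f 0 = 1 := by simp [hf, ContinuousLinearMap.det]
  rw [hf0, sub_zero, traceCLM_apply, Real.norm_eq_abs] at this
  calc _ ≤ K * ‖B‖ * ‖B‖ := this
    _ = _ := by ring

section NearIdentity

variable {d : ℕ} {G : Sp d → Sp d} {κ : ℝ≥0}

theorem injective_id_add (hG : LipschitzWith κ G) (hκ : κ < 1) :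
    Function.Injective fun x => x + G x := by
  intro x y hxy
  have h1 : dist x y = dist (G x) (G y) := by
    have h2 : x - y = -(G x - G y) := by
      have : x + G x = y + G y := hxy
      rw [neg_sub, sub_eq_sub_iff_add_eq_add, this, add_comm]
    rw [dist_eq_norm, dist_eq_norm, h2, norm_neg]
  have h3 := hG.dist_le_mul x y
  rw [← h1] at h3
  have h4 : (κ : ℝ) < 1 := by exact_mod_cast hκ
  have h5 : dist x y = 0 := by
    nlinarith [dist_nonneg (x := x) (y := y)]
  exact dist_eq_zero.1 h5

/-- The area formula for the injective map `x ↦ x + G x`, restricted to the set of differentiability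
points, which has full measure by Rademacher's theorem. -/
theorem lintegral_det_preimage_le (hG : LipschitzWith κ G) (hκ : κ < 1) {A : Set (Sp d)}
    (hA : MeasurableSet A) :
    ∫⁻ x in (fun x => x + G x) ⁻¹' A, ENNReal.ofReal |(1 + fderiv ℝ G x).det| ≤ volume A := by
  set R := fun x => x + G x with hR
  set D := {x | DifferentiableAt ℝ G x} with hD
  have hDm : MeasurableSet D := measurableSet_of_differentiableAt ℝ G
  have hRm : Measurable R := (continuous_id.add hG.continuous).measurable
  have hae : ∀ᵐ x, x ∈ D := hG.ae_differentiableAt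
  have hset : (R ⁻¹' A ∩ D : Set (Sp d)) =ᵐ[volume] R ⁻¹' A := by
    filter_upwards [hae] with x hx
    exact propext ⟨fun h => h.1, fun h => ⟨h, hx⟩⟩
  rw [← setLIntegral_congr hset]
  have key := lintegral_abs_det_fderiv_eq_addHaar_image (μ := (volume : Measure (Sp d)))
    (f := R) (f' := fun x => 1 + fderiv ℝ G x) ((hRm hA).inter hDm)
    (fun x hx => ((hasFDerivAt_id x).add
      (hx.2 : DifferentiableAt ℝ G x).hasFDerivAt).hasFDerivWithinAt)
    (injective_id_add hG hκ).injOn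
  rw [key]
  exact measure_mono (by rintro _ ⟨x, hx, rfl⟩; exact hx.1)

theorem volume_preimage_id_add_le (hG : LipschitzWith κ G) (hκ : κ < 1) {m : ℝ} (hm : 0 < m)
    (hdet : ∀ᵐ x, m ≤ |(1 + fderiv ℝ G x).det|) {A : Set (Sp d)} (hA : MeasurableSet A) :
    volume ((fun x => x + G x) ⁻¹' A) ≤ ENNReal.ofReal m⁻¹ * volume A := by
  have h1 : ENNReal.ofReal m * volume ((fun x => x + G x) ⁻¹' A) ≤ volume A := by
    refine le_trans ?_ (lintegral_det_preimage_le hG hκ hA)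
    rw [← setLIntegral_const]
    refine lintegral_mono_ae (ae_restrict_of_ae ?_)
    filter_upwards [hdet] with x hx
    exact ENNReal.ofReal_le_ofReal hx
  rw [ENNReal.ofReal_inv_of_pos hm, mul_comm, ← div_eq_mul_inv]
  rw [ENNReal.le_div_iff_mul_le (Or.inl (by simpa using hm)) (Or.inl (by simp)), mul_comm]
  exact h1

theorem det_one_add_ne_zero {B : Sp d →L[ℝ] Sp d} (hB : ‖B‖ < 1) : (1 + B).det ≠ 0 := by
  have h1 : IsUnit (1 + B) := by
    have := isUnit_one_sub_of_norm_lt_one (x := -B) (by simpa using hB)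
    simpa using this
  have h2 : IsUnit ((1 + B : Sp d →L[ℝ] Sp d) : Sp d →ₗ[ℝ] Sp d) :=
    h1.map (ContinuousLinearMap.toLinearMapRingHom : (Sp d →L[ℝ] Sp d) →+* _)
  exact (h2.map LinearMap.det).ne_zero

/-- The Jacobian never vanishes since `‖fderiv ℝ G x‖ ≤ κ < 1`, so the area formula forces the
preimage of a null set to be null. This allows a.e. properties of a field to be used at the
displaced point of an implicit step. -/
theorem volume_preimage_id_add_eq_zero (hG : LipschitzWith κ G) (hκ : κ < 1) {A : Set (Sp d)}
    (hA : volume A = 0) : volume ((fun x => x + G x) ⁻¹' A) = 0 := by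
  set R := fun x => x + G x with hR
  have hRm : Measurable R := (continuous_id.add hG.continuous).measurable
  have hB : volume (toMeasurable volume A) = 0 := by rwa [measure_toMeasurable]
  refine measure_mono_null (Set.preimage_mono (subset_toMeasurable volume A)) ?_
  have h1 := lintegral_det_preimage_le hG hκ (measurableSet_toMeasurable volume A)
  rw [hB, nonpos_iff_eq_zero, lintegral_eq_zero_iff] at h1
  · have h2 : ∀ᵐ x ∂volume.restrict (R ⁻¹' toMeasurable volume A), False := by
      filter_upwards [h1] with x hx
      have hn : ‖fderiv ℝ G x‖ < 1 :=
        (norm_fderiv_le_of_lipschitz ℝ hG).trans_lt (by exact_mod_cast hκ)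
      have := det_one_add_ne_zero hn
      simp [this] at hx
    have h3 : volume.restrict (R ⁻¹' toMeasurable volume A) = 0 := by
      simpa [ae_iff] using h2
    exact Measure.restrict_eq_zero.1 h3
  · refine Measurable.ennreal_ofReal (Measurable.abs ?_)
    exact ContinuousLinearMap.continuous_det.measurable.comp
      ((measurable_fderiv ℝ G).const_add 1)

end NearIdentity

/-! ### Compression by one step of the scheme. -/

/-- Solvability of one step of the `θ`-method for a Lipschitz field and a small time step. -/
theorem exists_thetaStep {d : ℕ} {F : Sp d → Sp d} {ℓ : ℝ≥0} (hF : LipschitzWith ℓ F)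
    {h θ : ℝ} (hh : 0 < h) (hθ : θ ∈ Set.Icc (0 : ℝ) 1) (hℓ : h * ℓ ≤ 1 / 4) :
    ∃ H : Sp d → Sp d, LipschitzWith (2 * ℓ) H ∧
      (∀ y, H y = (1 - θ) • F y + θ • F (y + h • H y)) ∧
      ∀ y z, z = y + h • ((1 - θ) • F y + θ • F z) → z = y + h • H y := by
  obtain ⟨hθ0, hθ1⟩ := hθ
  -- The implicit equation is a fixed-point problem with ratio `hθℓ ≤ 1/4`; `S y` below is its
  -- solution and `H` the increment divided by `h`.
  have contr : ∀ a : Sp d, ContractingWith (1 / 4) fun z => a + (h * θ) • F z := by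
    intro a
    refine ⟨by rw [← NNReal.coe_lt_coe]; norm_num, LipschitzWith.of_dist_le_mul fun z w => ?_⟩
    rw [dist_add_left, dist_smul₀, Real.norm_eq_abs, abs_of_nonneg (by positivity)]
    have h1 := hF.dist_le_mul z w
    calc h * θ * dist (F z) (F w) ≤ h * 1 * (ℓ * dist z w) := by gcongr
      _ = (h * ℓ) * dist z w := by ring
      _ ≤ _ := by push_cast; gcongr
  set S : Sp d → Sp d := fun y => (contr (y + (h * (1 - θ)) • F y)).fixedPoint with hS
  have hSfix : ∀ y, S y = y + h • ((1 - θ) • F y + θ • F (S y)) := by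
    intro y
    have := (contr (y + (h * (1 - θ)) • F y)).fixedPoint_isFixedPt
    have h2 : y + (h * (1 - θ)) • F y + (h * θ) • F (S y) = S y := this
    conv_lhs => rw [← h2]
    rw [smul_add, smul_smul, smul_smul, add_assoc]
  have hSuniq : ∀ y z, z = y + h • ((1 - θ) • F y + θ • F z) → z = S y := by
    intro y z hz
    refine (contr (y + (h * (1 - θ)) • F y)).fixedPoint_unique ?_
    show y + (h * (1 - θ)) • F y + (h * θ) • F z = z
    conv_rhs => rw [hz]
    rw [smul_add, smul_smul, smul_smul, add_assoc]
  set H : Sp d → Sp d := fun y => (1 - θ) • F y + θ • F (S y) with hH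
  have hSH : ∀ y, S y = y + h • H y := hSfix
  have h1θ : 0 ≤ 1 - θ := by linarith
  have hHd : ∀ y z, dist (H y) (H z) ≤ (1 - θ) * (ℓ * dist y z) + θ * (ℓ * dist (S y) (S z)) := by
    intro y z
    refine (dist_add_add_le _ _ _ _).trans ?_
    rw [dist_smul₀, dist_smul₀, Real.norm_eq_abs, Real.norm_eq_abs, abs_of_nonneg h1θ,
      abs_of_nonneg hθ0]
    gcongr
    · exact hF.dist_le_mul _ _
    · exact hF.dist_le_mul _ _
  have hSd : ∀ y z, dist (S y) (S z) ≤ dist y z + h * dist (H y) (H z) := by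
    intro y z
    rw [hSH y, hSH z]
    refine (dist_add_add_le _ _ _ _).trans ?_
    rw [dist_smul₀, Real.norm_eq_abs, abs_of_pos hh]
  refine ⟨H, LipschitzWith.of_dist_le_mul fun y z => ?_, fun y => by rw [← hSH], fun y z hz => by
    rw [← hSH]; exact hSuniq y z hz⟩
  have a1 := hHd y z
  have a2 := hSd y z
  have hl : (0 : ℝ) ≤ ℓ := ℓ.2
  -- The last term is absorbed on the left, which gives the Lipschitz constant `4ℓ/3 ≤ 2ℓ`.
  have a3 : θ * (ℓ * dist (S y) (S z)) ≤ θ * (ℓ * dist y z) + 1 / 4 * dist (H y) (H z) := by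
    calc θ * (ℓ * dist (S y) (S z)) ≤ θ * (ℓ * (dist y z + h * dist (H y) (H z))) := by gcongr
      _ = θ * (ℓ * dist y z) + θ * ((h * ℓ) * dist (H y) (H z)) := by ring
      _ ≤ θ * (ℓ * dist y z) + 1 * (1 / 4 * dist (H y) (H z)) := by gcongr
      _ = _ := by ring
  push_cast
  nlinarith [dist_nonneg (x := y) (y := z), mul_nonneg hl (dist_nonneg (x := y) (y := z))]

set_option maxHeartbeats 1000000 in
/-- One step of the `θ`-method for a field with Lipschitz constant `C₁ h^{-1/2}` and divergence
bounded by `C₂` compresses Lebesgue measure at most by `exp (Λ h)`. -/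
theorem exists_thetaStep_compression (d : ℕ) (C₁ C₂ : ℝ) (hC₁ : 0 < C₁) (hC₂ : 0 < C₂) :
    ∃ Λ h₀ : ℝ, 0 < Λ ∧ 0 < h₀ ∧ h₀ < 1 ∧ ∀ h, 0 < h → h ≤ h₀ → ∀ θ ∈ Set.Icc (0 : ℝ) 1,
      ∀ F : Sp d → Sp d, LipschitzWith (Real.toNNReal (C₁ / √h)) F →
      (∀ᵐ x, |traceDiv (fderiv ℝ F x)| ≤ C₂) →
      ∃ H : Sp d → Sp d, Continuous H ∧
        (∀ y, H y = (1 - θ) • F y + θ • F (y + h • H y)) ∧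
        (∀ y z, z = y + h • ((1 - θ) • F y + θ • F z) → z = y + h • H y) ∧
        ∀ σ ∈ Set.Icc (0 : ℝ) 1, ∀ A : Set (Sp d), MeasurableSet A →
          volume ((fun y => y + (σ * h) • H y) ⁻¹' A) ≤ ENNReal.ofReal (Real.exp (Λ * h)) *
            volume A := by
  obtain ⟨r, K, hr, hK, hdet⟩ := exists_abs_det_one_add_sub_le d
  set c := ‖traceCLM d‖ with hc
  have hc0 : 0 ≤ c := norm_nonneg (traceCLM d)
  -- `C₂` bounds the divergence of the field, `2cC₁²` the trace of `h A' ∘ DH` that arises when the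
  -- implicit equation is differentiated, and `4KC₁²` the second-order term of the determinant. The
  -- last two use `‖DH‖ ≤ 2ℓ` and `h ℓ² = C₁²`.
  set Λ := C₂ + 2 * c * C₁ ^ 2 + 4 * K * C₁ ^ 2 with hΛ
  have hΛ0 : 0 < Λ := by positivity
  set h₁ := min (1 / 4) (r / 2) / C₁ with hh₁
  have hh₁0 : 0 < h₁ := by positivity
  -- `h ≤ h₁²` gives `hℓ ≤ min (1/4) (r/2)`, as the contraction and the determinant expansion
  -- require; `h ≤ 1/(2Λ)` gives `(1 - Λh)⁻¹ ≤ exp (2Λh)`.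
  refine ⟨2 * Λ, min (1 / 2) (min (h₁ ^ 2) (1 / (2 * Λ))), by positivity, by positivity,
    (min_le_left _ _).trans_lt (by norm_num), ?_⟩
  intro h hh hle θ hθ F hF htr
  have hle1 : h ≤ h₁ ^ 2 := hle.trans ((min_le_right _ _).trans (min_le_left _ _))
  have hle2 : h ≤ 1 / (2 * Λ) := hle.trans ((min_le_right _ _).trans (min_le_right _ _))
  have hs0 : 0 < √h := Real.sqrt_pos.2 hh
  have hsq : √h * √h = h := Real.mul_self_sqrt hh.le
  have hs1 : √h ≤ h₁ := by
    rw [show h₁ = √(h₁ ^ 2) from (Real.sqrt_sq hh₁0.le).symm]; exact Real.sqrt_le_sqrt hle1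
  set ℓ := Real.toNNReal (C₁ / √h) with hℓdef
  have hℓ : (ℓ : ℝ) = C₁ / √h := Real.coe_toNNReal _ (by positivity)
  have hhℓ : h * ℓ = C₁ * √h := by
    rw [hℓ]; field_simp; rw [sq, hsq]
  have hhℓ2 : h * ℓ ^ 2 = C₁ ^ 2 := by
    rw [hℓ, div_pow, Real.sq_sqrt hh.le]; field_simp
  have hmin : h * ℓ ≤ min (1 / 4) (r / 2) := by
    rw [hhℓ]
    calc C₁ * √h ≤ C₁ * h₁ := by gcongr
      _ = _ := by rw [hh₁]; field_simp
  have h14 : h * ℓ ≤ 1 / 4 := hmin.trans (min_le_left _ _)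
  have hr2 : h * ℓ ≤ r / 2 := hmin.trans (min_le_right _ _)
  obtain ⟨H, hHl, hHe, hHu⟩ := exists_thetaStep hF hh hθ h14
  refine ⟨H, hHl.continuous, hHe, hHu, ?_⟩
  have lip : ∀ σ ∈ Set.Icc (0 : ℝ) 1, LipschitzWith (1 / 2) fun y => (σ * h) • H y := by
    intro σ hσ
    refine LipschitzWith.of_dist_le_mul fun y z => ?_
    rw [dist_smul₀, Real.norm_eq_abs, abs_of_nonneg (mul_nonneg hσ.1 hh.le)]
    have h1 := hHl.dist_le_mul y z
    have hσ1 := hσ.2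
    have hσ0 := hσ.1
    calc σ * h * dist (H y) (H z) ≤ 1 * h * ((2 * ℓ : ℝ≥0) * dist y z) := by gcongr
      _ = 2 * (h * ℓ) * dist y z := by push_cast; ring
      _ ≤ 2 * (1 / 4) * dist y z := by gcongr
      _ = _ := by push_cast; ring
  have half : (1 / 2 : ℝ≥0) < 1 := by rw [← NNReal.coe_lt_coe]; norm_num
  have hSnull : ∀ᵐ y, DifferentiableAt ℝ F (y + h • H y) ∧
      |traceDiv (fderiv ℝ F (y + h • H y))| ≤ C₂ := by
    have h1 := lip 1 (by simp)
    simp only [one_mul] at h1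
    have h2 : volume {y | ¬ (DifferentiableAt ℝ F y ∧ |traceDiv (fderiv ℝ F y)| ≤ C₂)} = 0 :=
      ae_iff.1 (hF.ae_differentiableAt.and htr)
    exact volume_preimage_id_add_eq_zero h1 half h2
  have htrH : ∀ᵐ y, |traceDiv (fderiv ℝ H y)| ≤ C₂ + 2 * c * C₁ ^ 2 := by
    filter_upwards [hSnull, hF.ae_differentiableAt, htr, hHl.ae_differentiableAt]
      with y ⟨hd1, ht1⟩ hd2 ht2 hd3
    set A' := fderiv ℝ F (y + h • H y)
    have hcomp : HasFDerivAt (fun y => F (y + h • H y)) (A'.comp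
        (ContinuousLinearMap.id ℝ (Sp d) + h • fderiv ℝ H y)) y :=
      HasFDerivAt.comp y hd1.hasFDerivAt ((hasFDerivAt_id y).add (hd3.hasFDerivAt.const_smul h))
    have hH' : HasFDerivAt H ((1 - θ) • fderiv ℝ F y + θ • (A'.comp
        (ContinuousLinearMap.id ℝ (Sp d) + h • fderiv ℝ H y))) y := by
      have := (hd2.hasFDerivAt.const_smul (1 - θ)).add (hcomp.const_smul θ)
      refine this.congr_of_eventuallyEq (.of_forall fun y => hHe y)
    set DH := fderiv ℝ H y with hDH
    have hexp : traceDiv DH = (1 - θ) * traceDiv (fderiv ℝ F y) + θ * (traceDiv A' +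
        h * traceCLM d (A'.comp DH)) := by
      conv_lhs => rw [hDH, hH'.fderiv]
      rw [← traceCLM_apply, map_add, map_smul, map_smul, ContinuousLinearMap.comp_add, map_add,
        ContinuousLinearMap.comp_id, ContinuousLinearMap.comp_smul, map_smul]
      simp only [traceCLM_apply, smul_eq_mul]
    have hA' : ‖A'‖ ≤ ℓ := norm_fderiv_le_of_lipschitz ℝ hF
    have hDHn : ‖DH‖ ≤ 2 * ℓ := by
      have := norm_fderiv_le_of_lipschitz ℝ hHl (x₀ := y)
      simpa using this
    have hb : |traceCLM d (A'.comp DH)| ≤ c * (ℓ * (2 * ℓ)) := by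
      refine ((traceCLM d).le_opNorm _).trans ?_
      gcongr
      exact (ContinuousLinearMap.opNorm_comp_le _ _).trans (by gcongr)
    have hb2 : h * |traceCLM d (A'.comp DH)| ≤ 2 * c * C₁ ^ 2 := by
      calc h * |traceCLM d (A'.comp DH)| ≤ h * (c * (ℓ * (2 * ℓ))) := by gcongr
        _ = 2 * c * (h * ℓ ^ 2) := by ring
        _ = _ := by rw [hhℓ2]
    obtain ⟨hθ0, hθ1⟩ := hθ
    have h1θ : 0 ≤ 1 - θ := by linarith
    have hcC : 0 ≤ 2 * c * C₁ ^ 2 := by positivity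
    rw [hexp]
    calc |(1 - θ) * traceDiv (fderiv ℝ F y) + θ * (traceDiv A' + h * traceCLM d (A'.comp DH))|
        ≤ (1 - θ) * |traceDiv (fderiv ℝ F y)| + θ * (|traceDiv A'| +
          h * |traceCLM d (A'.comp DH)|) := by
          refine (abs_add_le _ _).trans ?_
          rw [abs_mul, abs_mul, abs_of_nonneg h1θ, abs_of_nonneg hθ0]
          gcongr
          refine (abs_add_le _ _).trans ?_
          rw [abs_mul, abs_of_pos hh]
      _ ≤ (1 - θ) * C₂ + θ * (C₂ + 2 * c * C₁ ^ 2) := by gcongr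
      _ = C₂ + θ * (2 * c * C₁ ^ 2) := by ring
      _ ≤ C₂ + 1 * (2 * c * C₁ ^ 2) := by gcongr
      _ = _ := by ring
  intro σ hσ A hA
  have hσ0 := hσ.1
  have hσ1 := hσ.2
  have hΛh : Λ * h ≤ 1 / 2 := by
    calc Λ * h ≤ Λ * (1 / (2 * Λ)) := by gcongr
      _ = _ := by field_simp
  have hdet' : ∀ᵐ y, 1 - Λ * h ≤ |(1 + fderiv ℝ (fun y => (σ * h) • H y) y).det| := by
    filter_upwards [htrH, hHl.ae_differentiableAt] with y hy hd
    have e : fderiv ℝ (fun y => (σ * h) • H y) y = (σ * h) • fderiv ℝ H y :=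
      (hd.hasFDerivAt.const_smul (σ * h)).fderiv
    rw [e]
    set DH := fderiv ℝ H y
    have hDHn : ‖DH‖ ≤ 2 * ℓ := by
      have := norm_fderiv_le_of_lipschitz ℝ hHl (x₀ := y)
      simpa using this
    have hn : ‖(σ * h) • DH‖ ≤ 2 * (h * ℓ) := by
      rw [norm_smul, Real.norm_eq_abs, abs_of_nonneg (by positivity)]
      calc σ * h * ‖DH‖ ≤ 1 * h * (2 * ℓ) := by gcongr
        _ = _ := by ring
    have h1 := hdet ((σ * h) • DH) (by linarith)
    have h2 : traceDiv ((σ * h) • DH) = (σ * h) * traceDiv DH := by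
      rw [← traceCLM_apply, map_smul, smul_eq_mul, traceCLM_apply]
    have h3 : |(σ * h) * traceDiv DH| ≤ h * (C₂ + 2 * c * C₁ ^ 2) := by
      rw [abs_mul, abs_of_nonneg (by positivity)]
      calc σ * h * |traceDiv DH| ≤ 1 * h * (C₂ + 2 * c * C₁ ^ 2) := by gcongr
        _ = _ := by ring
    have h4 : K * ‖(σ * h) • DH‖ ^ 2 ≤ h * (4 * K * C₁ ^ 2) := by
      calc K * ‖(σ * h) • DH‖ ^ 2 ≤ K * (2 * (h * ℓ)) ^ 2 := by gcongr
        _ = h * (4 * K * (h * ℓ ^ 2)) := by ring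
        _ = _ := by rw [hhℓ2]
    rw [h2] at h1
    have h5 := abs_le.1 h1
    have h6 := abs_le.1 h3
    refine le_trans ?_ (le_abs_self _)
    rw [hΛ]
    nlinarith [h5.1, h6.1]
  refine (volume_preimage_id_add_le (lip σ hσ) half (by linarith) hdet' hA).trans ?_
  gcongr
  have hx : 0 ≤ Λ * h := by positivity
  -- With `x = Λh ≤ 1/2` one has `(1 + 2x)(1 - x) = 1 + 2x(1/2 - x) ≥ 1`.
  have hexp := Real.add_one_le_exp (2 * Λ * h)
  rw [inv_le_iff_one_le_mul₀ (by linarith)]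
  nlinarith [mul_nonneg hx (by linarith : 0 ≤ 1 / 2 - Λ * h)]

/-! ### Maps that compress Lebesgue measure. -/

/-- The map `f` compresses Lebesgue measure at most by the factor `L`. -/
structure Compresses {d : ℕ} (L : ℝ≥0) (f : Sp d → Sp d) : Prop where
  measurable : Measurable f
  preimage_le : ∀ A : Set (Sp d), MeasurableSet A → volume (f ⁻¹' A) ≤ L * volume A

namespace Compresses

variable {d : ℕ} {L L' : ℝ≥0} {f g : Sp d → Sp d}

theorem id : Compresses 1 (fun x : Sp d => x) := ⟨measurable_id, fun A _ => by simp⟩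

theorem mono (hf : Compresses L f) (h : L ≤ L') : Compresses L' f :=
  ⟨hf.measurable, fun A hA => (hf.preimage_le A hA).trans (by gcongr)⟩

theorem comp (hf : Compresses L f) (hg : Compresses L' g) :
    Compresses (L * L') (fun x => f (g x)) := by
  refine ⟨hf.measurable.comp hg.measurable, fun A hA => ?_⟩
  calc volume ((fun x => f (g x)) ⁻¹' A) = volume (g ⁻¹' (f ⁻¹' A)) := rfl
    _ ≤ L' * volume (f ⁻¹' A) := hg.preimage_le _ (hf.measurable hA)
    _ ≤ L' * (L * volume A) := by gcongr; exact hf.preimage_le A hA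
    _ = _ := by push_cast; ring

theorem map_le (hf : Compresses L f) : Measure.map f volume ≤ L • (volume : Measure (Sp d)) := by
  refine Measure.le_iff.2 fun A hA => ?_
  rw [Measure.map_apply hf.measurable hA]
  exact hf.preimage_le A hA

theorem quasiMeasurePreserving (hf : Compresses L f) :
    Measure.QuasiMeasurePreserving f volume volume :=
  ⟨hf.measurable, (Measure.absolutelyContinuous_of_le hf.map_le).trans
    (Measure.smul_absolutelyContinuous)⟩

theorem lintegral_comp_le (hf : Compresses L f) {φ : Sp d → ℝ≥0∞} (hφ : AEMeasurable φ volume) :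
    ∫⁻ x, φ (f x) ≤ L * ∫⁻ x, φ x := by
  have h1 : AEMeasurable φ (Measure.map f volume) :=
    hφ.mono_ac hf.quasiMeasurePreserving.absolutelyContinuous
  rw [← lintegral_map' h1 hf.measurable.aemeasurable]
  refine (lintegral_mono' hf.map_le le_rfl).trans (le_of_eq ?_)
  rw [lintegral_smul_measure]
  rfl

theorem integrable_comp (hf : Compresses L f) {u : Sp d → ℝ} (hu : Integrable u) :
    Integrable fun x => u (f x) := by
  refine ⟨hu.1.comp_quasiMeasurePreserving hf.quasiMeasurePreserving, ?_⟩
  refine (hf.lintegral_comp_le (φ := fun x => ‖u x‖ₑ) hu.1.enorm).trans_lt ?_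
  exact ENNReal.mul_lt_top (by simp) hu.2

end Compresses

/-! ### Divergence bounds for time averages. -/

theorem traceDiv_eq_sum {d : ℕ} (A : Sp d →L[ℝ] Sp d) :
    traceDiv A = ∑ j, (A (EuclideanSpace.single j 1)) j := by
  rw [traceDiv, LinearMap.trace_eq_matrix_trace ℝ (EuclideanSpace.basisFun (Fin d) ℝ).toBasis,
    Matrix.trace]
  refine Finset.sum_congr rfl fun j _ => ?_
  simp [LinearMap.toMatrix_apply]

/-- Integration by parts for the divergence of a Lipschitz vector field. -/
theorem integral_traceDiv_mul_eq {d : ℕ} {f : Sp d → Sp d} {ℓ : ℝ≥0} (hf : LipschitzWith ℓ f)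
    {φ : Sp d → ℝ} (hφ : ContDiff ℝ ∞ φ) (hφs : HasCompactSupport φ) :
    ∫ x, traceDiv (fderiv ℝ f x) * φ x = - ∫ x, fderiv ℝ φ x (f x) := by
  obtain ⟨D, hD⟩ := hφ.lipschitzWith_of_hasCompactSupport hφs (by simp)
  set e : Fin d → Sp d := fun j => EuclideanSpace.single j 1 with he
  have hfj : ∀ j, LipschitzWith ℓ fun x => f x j := by
    intro j
    refine LipschitzWith.of_dist_le_mul fun x y => ?_
    refine le_trans ?_ (hf.dist_le_mul x y)
    rw [Real.dist_eq, dist_eq_norm, ← Real.norm_eq_abs]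
    exact PiLp.norm_apply_le (f x - f y) j
  have hparts : ∀ j, ∫ x, lineDeriv ℝ (fun x => f x j) x (e j) * φ x =
      ∫ x, lineDeriv ℝ φ x (-(e j)) * f x j := fun j => by
    rw [(hfj j).integral_lineDeriv_mul_eq hD hφs]
  have hline : ∀ᵐ x, traceDiv (fderiv ℝ f x) * φ x =
      ∑ j, lineDeriv ℝ (fun x => f x j) x (e j) * φ x := by
    filter_upwards [hf.ae_differentiableAt] with x hx
    rw [traceDiv_eq_sum, Finset.sum_mul]
    refine Finset.sum_congr rfl fun j _ => ?_
    let pr : Sp d →L[ℝ] ℝ := EuclideanSpace.proj j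
    have h1 : HasFDerivAt (fun x => f x j) (pr.comp (fderiv ℝ f x)) x :=
      pr.hasFDerivAt.comp x hx.hasFDerivAt
    rw [h1.differentiableAt.lineDeriv_eq_fderiv, h1.fderiv]
    rfl
  have hφd : ∀ x, DifferentiableAt ℝ φ x := hφ.differentiable (by simp)
  have hrhs : ∀ x, fderiv ℝ φ x (f x) = - ∑ j, lineDeriv ℝ φ x (-(e j)) * f x j := by
    intro x
    have h1 : f x = ∑ j, f x j • e j := by
      have := (EuclideanSpace.basisFun (Fin d) ℝ).sum_repr (f x)
      simpa [he] using this.symm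
    conv_lhs => rw [h1]
    rw [map_sum, ← Finset.sum_neg_distrib]
    refine Finset.sum_congr rfl fun j _ => ?_
    rw [map_smul, (hφd x).lineDeriv_eq_fderiv, map_neg, smul_eq_mul]
    ring
  rw [integral_congr_ae hline, integral_finsetSum, Finset.sum_congr rfl fun j _ => hparts j]
  · simp_rw [hrhs, integral_neg, neg_neg]
    rw [integral_finsetSum]
    intro j _
    have h1 : ∀ x, lineDeriv ℝ φ x (-(e j)) = -fderiv ℝ φ x (e j) := fun x => by
      rw [(hφd x).lineDeriv_eq_fderiv, map_neg]
    simp_rw [h1]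
    refine Continuous.integrable_of_hasCompactSupport ?_ ?_
    · exact (((hφ.continuous_fderiv (by simp)).clm_apply continuous_const).neg).mul
        (hfj j).continuous
    · have h2 : HasCompactSupport fun x => -fderiv ℝ φ x (e j) :=
        (hφs.fderiv_apply (𝕜 := ℝ) (e j)).neg
      exact h2.mul_right
  · intro j _
    have h1 := ((hfj j).locallyIntegrable_lineDeriv (μ := volume) (e j))
    have h2 := h1.integrable_smul_left_of_hasCompactSupport hφ.continuous hφs
    refine h2.congr (.of_forall fun x => ?_)
    simp only [smul_eq_mul]; ring

/-- Testing with normalised bumps about `x` bounds the mollifications of `g` by `C`, and these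
converge to `g` a.e. This recovers a pointwise bound from a weak one. -/
theorem ae_abs_le_of_forall_mollifier {d : ℕ} {g : Sp d → ℝ} (hg : LocallyIntegrable g) {C : ℝ}
    (h : ∀ φ : Sp d → ℝ, ContDiff ℝ ∞ φ → HasCompactSupport φ → (∀ x, 0 ≤ φ x) →
      |∫ x, g x * φ x| ≤ C * ∫ x, φ x) : ∀ᵐ x, |g x| ≤ C := by
  set φ : ℕ → ContDiffBump (0 : Sp d) := fun n =>
    ⟨1 / ((n : ℝ) + 1) / 2, 1 / ((n : ℝ) + 1), by positivity, half_lt_self (by positivity)⟩ with hφ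
  have hlim : Tendsto (fun n => (φ n).rOut) atTop (𝓝 0) := tendsto_one_div_add_atTop_nhds_zero_nat
  have h2 : ∀ n, (φ n).rOut ≤ 2 * (φ n).rIn := fun n => by
    simp only [hφ]; linarith
  filter_upwards [ContDiffBump.ae_convolution_tendsto_right_of_locallyIntegrable
    (μ := (volume : Measure (Sp d))) hlim (K := 2) (.of_forall h2) hg] with x hx
  refine le_of_tendsto hx.abs (.of_forall fun n => ?_)
  rw [convolution_eq_swap]
  have h3 := h (fun y => (φ n).normed volume (x - y))
    ((φ n).contDiff_normed.comp (contDiff_const.sub contDiff_id))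
    ((φ n).hasCompactSupport_normed.comp_homeomorph (Homeomorph.subLeft x))
    (fun y => (φ n).nonneg_normed _)
  rw [integral_sub_left_eq_self (fun y => (φ n).normed volume y) volume x, (φ n).integral_normed,
    mul_one] at h3
  simpa [mul_comm] using h3

section TimeAverage

variable {d : ℕ} {P : Measure ℝ} {B : ℝ → Sp d → Sp d} {ℓ : ℝ≥0} {C₂ C₃ : ℝ}

/-- Joint measurability yields measurable slices only for a.e. `x`; these `x` are dense, and spatial
continuity reaches the others. The scheme evaluates its field at specific points, so every `x` is
needed. -/
theorem aestronglyMeasurable_slice [SFinite P]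
    (hm : AEStronglyMeasurable (Function.uncurry B) (P.prod volume))
    (hl : ∀ᵐ s ∂P, LipschitzWith ℓ (B s)) (x : Sp d) :
    AEStronglyMeasurable (fun s => B s x) P := by
  have h1 : ∀ᵐ y : Sp d, AEStronglyMeasurable (fun s => B s y) P := by
    have := hm.prod_swap.prodMk_left
    simpa [Function.uncurry] using this
  obtain ⟨u, hu, hux⟩ := mem_closure_iff_seq_limit.1 ((Measure.dense_of_ae h1) x)
  refine aestronglyMeasurable_of_tendsto_ae atTop (f := fun n s => B s (u n)) (fun n => hu n) ?_
  filter_upwards [hl] with s hs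
  exact (hs.continuous.tendsto x).comp hux

theorem integrable_slice [IsFiniteMeasure P]
    (hm : AEStronglyMeasurable (Function.uncurry B) (P.prod volume))
    (hl : ∀ᵐ s ∂P, LipschitzWith ℓ (B s)) (hb : ∀ᵐ s ∂P, ∀ x, ‖B s x‖ ≤ C₃) (x : Sp d) :
    Integrable (fun s => B s x) P :=
  Integrable.of_bound (aestronglyMeasurable_slice hm hl x) C₃ (hb.mono fun _ h => h x)

theorem lipschitzWith_integral [IsProbabilityMeasure P]
    (hm : AEStronglyMeasurable (Function.uncurry B) (P.prod volume))
    (hl : ∀ᵐ s ∂P, LipschitzWith ℓ (B s)) (hb : ∀ᵐ s ∂P, ∀ x, ‖B s x‖ ≤ C₃) :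
    LipschitzWith ℓ fun x => ∫ s, B s x ∂P := by
  refine LipschitzWith.of_dist_le_mul fun x y => ?_
  rw [dist_eq_norm, ← integral_sub (integrable_slice hm hl hb x) (integrable_slice hm hl hb y)]
  have := norm_integral_le_of_norm_le_const (μ := P) (C := ℓ * dist x y)
    (f := fun s => B s x - B s y) (hl.mono fun s hs => by
      rw [← dist_eq_norm]; exact hs.dist_le_mul x y)
  simpa using this

/-- The divergence bound is inherited by time averages. -/
theorem ae_abs_traceDiv_integral_le [IsProbabilityMeasure P]
    (hm : AEStronglyMeasurable (Function.uncurry B) (P.prod volume))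
    (hl : ∀ᵐ s ∂P, LipschitzWith ℓ (B s)) (hb : ∀ᵐ s ∂P, ∀ x, ‖B s x‖ ≤ C₃)
    (hd : ∀ᵐ s ∂P, ∀ᵐ x : Sp d, |traceDiv (fderiv ℝ (B s) x)| ≤ C₂) :
    ∀ᵐ x, |traceDiv (fderiv ℝ (fun x => ∫ s, B s x ∂P) x)| ≤ C₂ := by
  set F := fun x => ∫ s, B s x ∂P with hF
  have hFl : LipschitzWith ℓ F := lipschitzWith_integral hm hl hb
  have hgm : Measurable fun x => traceDiv (fderiv ℝ F x) := by
    simp_rw [← traceCLM_apply]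
    exact (traceCLM d).continuous.measurable.comp (measurable_fderiv ℝ F)
  have hgb : ∀ x, ‖traceDiv (fderiv ℝ F x)‖ ≤ ‖traceCLM d‖ * ℓ := by
    intro x
    rw [← traceCLM_apply]
    refine ((traceCLM d).le_opNorm _).trans ?_
    gcongr
    exact norm_fderiv_le_of_lipschitz ℝ hFl
  -- The weak form of the divergence is linear in the field, so Fubini averages it over `s` and
  -- nothing has to be differentiated under the integral.
  refine ae_abs_le_of_forall_mollifier ?_ fun φ hφ hφs hφ0 => ?_
  · exact (memLp_top_of_bound hgm.aestronglyMeasurable _ (.of_forall hgb)).locallyIntegrable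
      (by simp)
  have hφi : Integrable φ := hφ.continuous.integrable_of_hasCompactSupport hφs
  have hdφ : Continuous (fderiv ℝ φ) := hφ.continuous_fderiv (by simp)
  have hdφi : Integrable (fderiv ℝ φ) :=
    hdφ.integrable_of_hasCompactSupport (hφs.fderiv (𝕜 := ℝ))
  have hint : Integrable (Function.uncurry fun (x : Sp d) (s : ℝ) => fderiv ℝ φ x (B s x))
      (volume.prod P) := by
    have h1 : Integrable (fun z : Sp d × ℝ => C₃ * ‖fderiv ℝ φ z.1‖) (volume.prod P) :=
      (hdφi.norm.const_mul C₃).comp_fst P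
    refine h1.mono ?_ ?_
    · have h2 : AEStronglyMeasurable (fun z : Sp d × ℝ => B z.2 z.1) (volume.prod P) :=
        hm.prod_swap
      exact (ContinuousLinearMap.id ℝ (Sp d →L[ℝ] ℝ)).aestronglyMeasurable_comp₂
        (hdφ.comp continuous_fst).aestronglyMeasurable h2
    · have h3 : ∀ᵐ z : Sp d × ℝ ∂volume.prod P, ∀ x, ‖B z.2 x‖ ≤ C₃ :=
        Measure.quasiMeasurePreserving_snd.ae hb
      filter_upwards [h3] with z hz
      have hC : 0 ≤ C₃ := (norm_nonneg _).trans (hz 0)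
      rw [Real.norm_of_nonneg (mul_nonneg hC (norm_nonneg _)), mul_comm]
      exact ((fderiv ℝ φ z.1).le_opNorm _).trans
        (mul_le_mul_of_nonneg_left (hz _) (norm_nonneg _))
  have e1 : ∫ x, fderiv ℝ φ x (F x) = ∫ s, ∫ x, fderiv ℝ φ x (B s x) ∂volume ∂P := by
    rw [← integral_integral_swap hint]
    refine integral_congr_ae (.of_forall fun x => ?_)
    exact ((fderiv ℝ φ x).integral_comp_comm (integrable_slice hm hl hb x)).symm
  rw [integral_traceDiv_mul_eq hFl hφ hφs, abs_neg, e1, ← Real.norm_eq_abs]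
  have := norm_integral_le_of_norm_le_const (μ := P) (C := C₂ * ∫ x, φ x)
    (f := fun s => ∫ x, fderiv ℝ φ x (B s x)) ?_
  · simpa using this
  filter_upwards [hl, hd] with s hs hds
  have h1 := integral_traceDiv_mul_eq hs hφ hφs
  rw [← neg_eq_iff_eq_neg] at h1
  rw [← h1, norm_neg, ← integral_const_mul]
  refine norm_integral_le_of_norm_le (hφi.const_mul C₂) ?_
  filter_upwards [hds] with x hx
  rw [norm_mul, Real.norm_eq_abs, Real.norm_of_nonneg (hφ0 x)]
  gcongr
  exact hφ0 x

end TimeAverage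

/-! ### Uniform compression by the iterates of the scheme. -/

theorem restrict_absolutelyContinuous_timeMeasure {T a b : ℝ} (ha : 0 ≤ a) (hb : b ≤ T) :
    (volume.restrict (Set.Ioc a b)) ≪ timeMeasure T := by
  rw [timeMeasure, Measure.restrict_congr_set Ioo_ae_eq_Ioc]
  exact Measure.absolutelyContinuous_of_le
    (Measure.restrict_mono (Set.Ioc_subset_Ioc ha hb) le_rfl)

/-- The uniform probability measure on an interval. -/
def uniformMeasure (a b : ℝ) : Measure ℝ :=
  (volume.restrict (Set.Ioc a b) Set.univ)⁻¹ • volume.restrict (Set.Ioc a b)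

theorem isProbabilityMeasure_uniformMeasure {a b : ℝ} (hab : a < b) :
    IsProbabilityMeasure (uniformMeasure a b) := by
  have : NeZero (volume.restrict (Set.Ioc a b)) := ⟨by
    rw [Ne, Measure.restrict_eq_zero, Real.volume_Ioc]
    simpa using hab⟩
  exact isProbabilityMeasureSMul

theorem uniformMeasure_absolutelyContinuous {T a b : ℝ} (ha : 0 ≤ a) (hb : b ≤ T) :
    uniformMeasure a b ≪ timeMeasure T :=
  Measure.smul_absolutelyContinuous.trans (restrict_absolutelyContinuous_timeMeasure ha hb)

theorem intervalAverage_eq_integral_uniformMeasure {d : ℕ} {a b : ℝ} (hab : a ≤ b)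
    (f : ℝ → Sp d) : ⨍ τ in a..b, f τ = ∫ τ, f τ ∂uniformMeasure a b := by
  rw [Set.uIoc_of_le hab]
  rfl

theorem thetaScheme_node_le {T : ℝ} (hT : 0 < T) {N i : ℕ} (hi : i < N) :
    0 ≤ (i : ℝ) * (T / N) ∧ (i : ℝ) * (T / N) < ((i : ℝ) + 1) * (T / N) ∧
      ((i : ℝ) + 1) * (T / N) ≤ T := by
  have hN : 0 < (N : ℝ) := by exact_mod_cast (Nat.zero_le i).trans_lt hi
  refine ⟨by positivity, by gcongr; linarith, ?_⟩
  have h1 : (i : ℝ) + 1 ≤ N := by exact_mod_cast hi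
  calc ((i : ℝ) + 1) * (T / N) ≤ N * (T / N) := by gcongr
    _ = T := by field_simp

theorem IsThetaScheme.step_eq {d : ℕ} {T : ℝ} (hT : 0 < T) {N : ℕ} {θ : ℝ} {B : ℝ → Sp d → Sp d}
    {Y : ℕ → Sp d → Sp d} (hY : IsThetaScheme T N θ B Y) {i : ℕ} (hi : i < N) (x : Sp d) :
    Y (i + 1) x = Y i x + (T / N) •
      ((1 - θ) • (∫ τ, B τ (Y i x) ∂uniformMeasure (i * (T / N)) ((i + 1) * (T / N))) +
        θ • ∫ τ, B τ (Y (i + 1) x) ∂uniformMeasure (i * (T / N)) ((i + 1) * (T / N))) := by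
  have h1 := hY.2 i hi x
  have hn := thetaScheme_node_le hT hi
  have hN : 0 < (N : ℝ) := by exact_mod_cast (Nat.zero_le i).trans_lt hi
  rw [intervalAverage_eq_integral_uniformMeasure hn.2.1.le,
    intervalAverage_eq_integral_uniformMeasure hn.2.1.le] at h1
  rw [← h1, smul_smul, mul_inv_cancel₀ (by positivity), one_smul, add_sub_cancel]

/-- The iterates of the `θ`-method and their linear interpolations compress Lebesgue measure by a
factor that only depends on `d`, `T` and the constants `C₁`, `C₂` in the Lipschitz and divergence
bounds. -/
theorem exists_thetaScheme_compression (d : ℕ) (T C₁ C₂ : ℝ) (hT : 0 < T) (hC₁ : 0 < C₁)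
    (hC₂ : 0 < C₂) :
    ∃ (L₀ : ℝ≥0) (h₀ : ℝ), 0 < h₀ ∧ h₀ < 1 ∧ ∀ N : ℕ, 0 < N → T / N ≤ h₀ →
      ∀ θ ∈ Set.Icc (0 : ℝ) 1, ∀ (C₃ : ℝ) (B : ℝ → Sp d → Sp d) (Y : ℕ → Sp d → Sp d),
      AEStronglyMeasurable (Function.uncurry B) ((timeMeasure T).prod volume) →
      (∀ᵐ s ∂timeMeasure T, LipschitzWith (Real.toNNReal (C₁ / √(T / N))) (B s)) →
      (∀ᵐ s ∂timeMeasure T, ∀ᵐ x : Sp d, |traceDiv (fderiv ℝ (B s) x)| ≤ C₂) →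
      (∀ᵐ s ∂timeMeasure T, ∀ x, ‖B s x‖ ≤ C₃) →
      IsThetaScheme T N θ B Y →
      (∀ i ≤ N, Compresses L₀ (Y i)) ∧
      ∀ i < N, ∀ σ ∈ Set.Icc (0 : ℝ) 1,
        Compresses L₀ fun x => Y i x + σ • (Y (i + 1) x - Y i x) := by
  obtain ⟨Λ, h₀, hΛ, hh₀, hh₁, hstep⟩ := exists_thetaStep_compression d C₁ C₂ hC₁ hC₂
  refine ⟨Real.toNNReal (Real.exp (Λ * T)), h₀, hh₀, hh₁, ?_⟩
  intro N hN hNh θ hθ C₃ B Y hm hl hd hb hY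
  have hNr : 0 < (N : ℝ) := by exact_mod_cast hN
  set h := T / N with hh
  have hh0 : 0 < h := by positivity
  have hNh' : N * h = T := by rw [hh]; field_simp
  -- `σ = 1` gives the next node, the other `σ` the linear interpolant; each costs a single factor
  -- `exp (Λh)` over `Y i`.
  have one_step : ∀ i < N, ∀ σ ∈ Set.Icc (0 : ℝ) 1, ∃ R : Sp d → Sp d,
      Compresses (Real.toNNReal (Real.exp (Λ * h))) R ∧
        ∀ x, Y i x + σ • (Y (i + 1) x - Y i x) = R (Y i x) := by
    intro i hi σ hσ
    obtain ⟨hn0, hn1, hn2⟩ := thetaScheme_node_le hT hi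
    have hP := isProbabilityMeasure_uniformMeasure hn1
    have hac := uniformMeasure_absolutelyContinuous hn0 hn2
    set P := uniformMeasure (i * (T / N)) ((i + 1) * (T / N)) with hPdef
    have hm' := hm.mono_ac (hac.prod (Measure.AbsolutelyContinuous.refl volume))
    obtain ⟨H, hHc, -, hHu, hHv⟩ := hstep h hh0 hNh θ hθ (fun x => ∫ s, B s x ∂P)
      (lipschitzWith_integral hm' (hac.ae_le hl) (hac.ae_le hb))
      (ae_abs_traceDiv_integral_le hm' (hac.ae_le hl) (hac.ae_le hb) (hac.ae_le hd))
    refine ⟨fun y => y + (σ * h) • H y, ⟨?_, fun A hA => ?_⟩, fun x => ?_⟩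
    · exact (continuous_id.add (hHc.const_smul (σ * h))).measurable
    · exact hHv σ hσ A hA
    · rw [hHu (Y i x) (Y (i + 1) x) (hY.step_eq hT hi x), add_sub_cancel_left, smul_smul]
  have nodes : ∀ i ≤ N, Compresses (Real.toNNReal (Real.exp (Λ * (i * h)))) (Y i) := by
    intro i
    induction i with
    | zero =>
      intro _
      have : Y 0 = fun x => x := funext hY.1
      rw [this]
      simpa using Compresses.id
    | succ i ih =>
      intro hi
      obtain ⟨R, hR, hRe⟩ := one_step i hi 1 (by simp)
      have e : Y (i + 1) = fun x => R (Y i x) := by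
        funext x
        rw [← hRe x, one_smul, add_sub_cancel]
      rw [e]
      refine (hR.comp (ih (by omega))).mono (le_of_eq ?_)
      rw [← Real.toNNReal_mul (Real.exp_pos _).le, ← Real.exp_add]
      push_cast
      ring_nf
  have bound : ∀ i ≤ N, Real.toNNReal (Real.exp (Λ * (i * h))) ≤
      Real.toNNReal (Real.exp (Λ * T)) := by
    intro i hi
    have : (i : ℝ) ≤ N := by exact_mod_cast hi
    rw [← hNh']
    gcongr
  refine ⟨fun i hi => (nodes i hi).mono (bound i hi), fun i hi σ hσ => ?_⟩
  obtain ⟨R, hR, hRe⟩ := one_step i hi σ hσ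
  simp_rw [hRe]
  refine (hR.comp (nodes i hi.le)).mono (le_trans (le_of_eq ?_) (bound (i + 1) hi))
  rw [← Real.toNNReal_mul (Real.exp_pos _).le, ← Real.exp_add]
  push_cast
  ring_nf

/-! ### Measurable versions of regular Lagrangian flows. -/

/-- Outer regularity. The case `L = 0` is separate because multiplication by `0` need not commute
with an infimum. -/
theorem volume_preimage_le_of_isOpen {d : ℕ} {f : Sp d → Sp d} {L : ℝ≥0}
    (h : ∀ A : Set (Sp d), IsOpen A → volume (f ⁻¹' A) ≤ L * volume A) (A : Set (Sp d)) :
    volume (f ⁻¹' A) ≤ L * volume A := by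
  rcases eq_or_ne L 0 with rfl | hL
  · have := h Set.univ isOpen_univ
    simp only [ENNReal.coe_zero, zero_mul, nonpos_iff_eq_zero] at this ⊢
    exact measure_mono_null (Set.subset_univ _) this
  rw [A.measure_eq_iInf_isOpen volume, ENNReal.mul_iInf_of_ne (by simpa using hL) (by simp)]
  refine le_iInf fun U => ?_
  rw [ENNReal.mul_iInf_of_ne (by simpa using hL) (by simp)]
  refine le_iInf fun hAU => ?_
  rw [ENNReal.mul_iInf_of_ne (by simpa using hL) (by simp)]
  exact le_iInf fun hU => (measure_mono (Set.preimage_mono hAU)).trans (h U hU)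

/-- A regular Lagrangian flow has a jointly measurable version that compresses measure at all
times. -/
theorem IsRegularLagrangianFlow.exists_measurable_version {d : ℕ} {T : ℝ} (hT : 0 ≤ T)
    {b : ℝ → Sp d → Sp d} {X : ℝ → Sp d → Sp d} (hX : IsRegularLagrangianFlow T b X) :
    ∃ (X' : ℝ → Sp d → Sp d) (L : ℝ≥0), Measurable (Function.uncurry X') ∧
      (∀ t, Compresses L (X' t)) ∧ ∀ᵐ x, ∀ t ∈ Set.Icc 0 T, X' t x = X t x := by
  obtain ⟨L, hL⟩ := hX.compress
  -- Times are clamped to `[0,T]`, so that the version is continuous in time and compressing for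
  -- every real `t`.
  set cl : ℝ → ℝ := fun t => (Set.projIcc 0 T hT t : ℝ) with hcl
  have hclm : ∀ t, cl t ∈ Set.Icc 0 T := fun t => (Set.projIcc 0 T hT t).2
  have hclc : Continuous cl := continuous_subtype_val.comp continuous_projIcc
  have hcle : ∀ t ∈ Set.Icc 0 T, cl t = t := fun t ht => by
    simp only [hcl, Set.projIcc_of_mem hT ht]
  -- Measurable representatives are taken at the countably many rational times only, at the cost of
  -- one null set; continuity of the paths gives the other times.
  have hq : ∀ᵐ x : Sp d, ∀ q : ℚ, X (cl q) x = (hX.meas _ (hclm q)).mk (X (cl q)) x :=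
    ae_all_iff.2 fun q => (hX.meas _ (hclm q)).ae_eq_mk
  have hgood := hX.ode.and hq
  obtain ⟨N, hNsub, hNm, hN0⟩ := exists_measurable_superset_of_null (ae_iff.1 hgood)
  have hNgood : ∀ x ∉ N, (IntervalIntegrable (fun τ => b τ (X τ x)) volume 0 T ∧
      ∀ t ∈ Set.Icc 0 T, X t x = x + ∫ τ in (0 : ℝ)..t, b τ (X τ x)) ∧
      ∀ q : ℚ, X (cl q) x = (hX.meas _ (hclm q)).mk (X (cl q)) x := by
    intro x hx
    by_contra hcon
    exact hx (hNsub hcon)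
  set X' : ℝ → Sp d → Sp d := fun t => Nᶜ.indicator (X (cl t)) with hX'
  have hcont : ∀ x, Continuous fun t => X' t x := by
    intro x
    by_cases hx : x ∈ N
    · have : (fun t => X' t x) = fun _ => 0 := by
        funext t; simp [hX', hx]
      rw [this]; exact continuous_const
    · obtain ⟨⟨hi, he⟩, -⟩ := hNgood x hx
      have h1 : (fun t => X' t x) = fun t => x + ∫ τ in (0 : ℝ)..cl t, b τ (X τ x) := by
        funext t
        simp only [hX']
        rw [Set.indicator_of_mem (by exact hx), he _ (hclm t)]
      rw [h1]
      have h2 := intervalIntegral.continuousOn_primitive_interval' hi Set.left_mem_uIcc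
      rw [Set.uIcc_of_le hT] at h2
      exact continuous_const.add (h2.comp_continuous hclc hclm)
  have hmeasq : ∀ q : ℚ, Measurable (X' q) := by
    intro q
    have : X' q = Nᶜ.indicator ((hX.meas _ (hclm q)).mk (X (cl q))) := by
      funext x
      by_cases hx : x ∈ N
      · simp [hX', hx]
      · simp only [hX']
        rw [Set.indicator_of_mem (by exact hx), Set.indicator_of_mem (by exact hx),
          (hNgood x hx).2 q]
    rw [this]
    exact (hX.meas _ (hclm q)).measurable_mk.indicator hNm.compl
  have hmeas : ∀ t, Measurable (X' t) := by
    intro t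
    have hd : t ∈ closure (Set.range ((↑) : ℚ → ℝ)) := Rat.denseRange_cast t
    obtain ⟨u, hu, hut⟩ := mem_closure_iff_seq_limit.1 hd
    choose q hqu using hu
    refine measurable_of_tendsto_metrizable (f := fun n => X' (q n)) (fun n => hmeasq (q n)) ?_
    rw [tendsto_pi_nhds]
    intro x
    simp_rw [hqu]
    exact ((hcont x).tendsto t).comp hut
  refine ⟨X', L, measurable_uncurry_of_continuous_of_measurable hcont hmeas, fun t =>
    ⟨hmeas t, fun A _ => ?_⟩, ?_⟩
  · have hsub : X' t ⁻¹' A ⊆ X (cl t) ⁻¹' A ∪ N := by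
      intro x hx
      by_cases hxN : x ∈ N
      · exact Or.inr hxN
      · left
        simp only [hX', Set.mem_preimage] at hx
        rwa [Set.indicator_of_mem (by exact hxN)] at hx
    calc volume (X' t ⁻¹' A) ≤ volume (X (cl t) ⁻¹' A) + volume N :=
          (measure_mono hsub).trans (measure_union_le _ _)
      _ = volume (X (cl t) ⁻¹' A) := by rw [hN0, add_zero]
      _ ≤ _ := volume_preimage_le_of_isOpen (hL _ (hclm t)) A
  · have : ∀ᵐ x : Sp d, x ∉ N := measure_eq_zero_iff_ae_notMem.1 hN0
    filter_upwards [this] with x hx t ht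
    simp only [hX']
    rw [Set.indicator_of_mem (by exact hx), hcle t ht]

/-- A space-time null set has null slices for a.e. time, and `F τ` pulls null sets back to null
sets. Hence `b τ (F τ x)` is a.e. measurable for a field `b` that is only a.e. measurable. -/
theorem quasiMeasurePreserving_graph {d : ℕ} {ν : Measure ℝ} [SFinite ν] {F : ℝ → Sp d → Sp d}
    {L : ℝ≥0} (hF : Measurable (Function.uncurry F)) (hc : ∀ᵐ τ ∂ν, Compresses L (F τ)) :
    Measure.QuasiMeasurePreserving (fun z : ℝ × Sp d => (z.1, F z.1 z.2))
      (ν.prod volume) (ν.prod volume) := by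
  have hm : Measurable fun z : ℝ × Sp d => (z.1, F z.1 z.2) := measurable_fst.prodMk hF
  refine ⟨hm, Measure.AbsolutelyContinuous.mk fun A hA h0 => ?_⟩
  rw [Measure.map_apply hm hA, Measure.measure_prod_null (hm hA)]
  rw [Measure.measure_prod_null hA] at h0
  filter_upwards [hc, h0] with τ hτ h1
  have : volume (F τ ⁻¹' (Prod.mk τ ⁻¹' A)) ≤ L * volume (Prod.mk τ ⁻¹' A) :=
    hτ.preimage_le _ (measurable_prodMk_left hA)
  rw [h1, Pi.zero_apply, mul_zero] at this
  exact le_antisymm this bot_le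

/-! ### The logarithmic stability estimate. -/

/-- A logarithmic Gronwall inequality for integral curves. -/
theorem ofReal_log_le_lintegral {E : Type*} [NormedAddCommGroup E] [NormedSpace ℝ E]
    {S : ℝ} {w D : ℝ → E} (hw : IntervalIntegrable w volume 0 S)
    (hD : ∀ t ∈ Set.Icc 0 S, D t = ∫ τ in (0 : ℝ)..t, w τ) {δ : ℝ} (hδ : 0 < δ) {t : ℝ}
    (ht : t ∈ Set.Icc 0 S) :
    ENNReal.ofReal (Real.log (1 + ‖D t‖ / δ)) ≤
      ∫⁻ τ, ‖w τ‖ₑ / ENNReal.ofReal (δ + ‖D τ‖) ∂timeMeasure S := by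
  have hS : 0 ≤ S := ht.1.trans ht.2
  set φ : ℝ → ℝ := fun τ => δ + ‖D τ‖ with hφ
  have hφδ : ∀ τ, δ ≤ φ τ := fun τ => le_add_of_nonneg_right (norm_nonneg _)
  have hφ0 : ∀ τ, 0 < φ τ := fun τ => hδ.trans_le (hφδ τ)
  have hDc : ContinuousOn D (Set.Icc 0 S) := by
    have h2 := intervalIntegral.continuousOn_primitive_interval' hw Set.left_mem_uIcc
    rw [Set.uIcc_of_le hS] at h2
    exact h2.congr hD
  have hφc : ContinuousOn φ (Set.Icc 0 S) := continuousOn_const.add hDc.norm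
  have hsub : ∀ s ∈ Set.Icc 0 S, ∀ s' ∈ Set.Icc 0 S, IntervalIntegrable w volume s s' := by
    intro s hs s' hs'
    refine hw.mono_set ?_
    rw [Set.uIcc_of_le hS]
    exact (Set.ordConnected_Icc.uIcc_subset hs hs')
  set m : ℝ → ℝ := fun τ => ‖w τ‖ / φ τ with hm
  have hmi : ∀ s ∈ Set.Icc 0 S, ∀ s' ∈ Set.Icc 0 S, IntervalIntegrable m volume s s' := by
    intro s hs s' hs'
    have h1 : Set.uIcc s s' ⊆ Set.Icc 0 S := Set.ordConnected_Icc.uIcc_subset hs hs'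
    exact (hsub s hs s' hs').norm.mul_continuousOn
      ((hφc.mono h1).inv₀ fun τ _ => (hφ0 τ).ne')
  have h0 : (0 : ℝ) ∈ Set.Icc 0 S := ⟨le_rfl, hS⟩
  have hm0 : ∀ τ, 0 ≤ m τ := fun τ => div_nonneg (norm_nonneg _) (hφ0 τ).le
  -- No chain rule for `log φ` is used. On a fine partition `log φ(s') - log φ(s) ≤ (φ(s') -
  -- φ(s))/φ(s)`, and uniform continuity with `φ ≥ δ` gives `φ τ ≤ (1 + η) φ s` on each interval.
  -- The increments telescope, and `η → 0` afterwards.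
  have main : ∀ η : ℝ, 0 < η →
      Real.log (φ t) - Real.log (φ 0) ≤ (1 + η) * ∫ τ in (0 : ℝ)..t, m τ := by
    intro η hη
    have huc := isCompact_Icc.uniformContinuousOn_of_continuous hφc
    obtain ⟨ρ, hρ, hρ'⟩ := Metric.uniformContinuousOn_iff.1 huc (η * δ) (by positivity)
    have local_est : ∀ s ∈ Set.Icc 0 S, ∀ s' ∈ Set.Icc 0 S, s ≤ s' → s' - s < ρ →
        Real.log (φ s') - Real.log (φ s) ≤ (1 + η) * ∫ τ in s..s', m τ := by
      intro s hs s' hs' hss hlt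
      have e1 : φ s' - φ s ≤ ∫ τ in s..s', ‖w τ‖ := by
        have h3 : D s' - D s = ∫ τ in s..s', w τ := by
          rw [hD _ hs', hD _ hs]
          exact intervalIntegral.integral_interval_sub_left (hsub _ h0 _ hs') (hsub _ h0 _ hs)
        calc φ s' - φ s = ‖D s'‖ - ‖D s‖ := by simp [hφ]
          _ ≤ ‖D s' - D s‖ := norm_sub_norm_le _ _
          _ ≤ _ := by rw [h3]; exact intervalIntegral.norm_integral_le_integral_norm hss
      have e2 : (∫ τ in s..s', ‖w τ‖) ≤ ∫ τ in s..s', ((1 + η) * φ s) * m τ := by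
        refine intervalIntegral.integral_mono_on hss (hsub _ hs _ hs').norm
          ((hmi _ hs _ hs').const_mul _) fun τ hτ => ?_
        have hτS : τ ∈ Set.Icc 0 S := ⟨hs.1.trans hτ.1, hτ.2.trans hs'.2⟩
        have h4 := hρ' τ hτS s hs (by
          rw [Real.dist_eq, abs_of_nonneg (by linarith [hτ.1])]; linarith [hτ.2])
        rw [Real.dist_eq] at h4
        have h5 : φ τ ≤ (1 + η) * φ s := by
          have h6 := (abs_lt.1 h4).2
          have h7 := hφδ s
          nlinarith
        calc ‖w τ‖ = φ τ * m τ := by simp only [hm]; rw [mul_div_cancel₀ _ (hφ0 τ).ne']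
          _ ≤ _ := mul_le_mul_of_nonneg_right h5 (hm0 τ)
      rw [intervalIntegral.integral_const_mul] at e2
      rw [← Real.log_div (hφ0 _).ne' (hφ0 _).ne']
      refine (Real.log_le_sub_one_of_pos (div_pos (hφ0 _) (hφ0 _))).trans ?_
      rw [div_sub_one (hφ0 s).ne', div_le_iff₀ (hφ0 s)]
      linarith
    obtain ⟨n, hn⟩ := exists_nat_gt (t / ρ)
    have hn0 : (0 : ℝ) < n := (div_nonneg ht.1 hρ.le).trans_lt hn
    set τs : ℕ → ℝ := fun k => k * (t / n) with hτs
    have hmem : ∀ k ≤ n, τs k ∈ Set.Icc 0 S := by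
      intro k hk
      have hk' : (k : ℝ) ≤ n := by exact_mod_cast hk
      have ht0 := ht.1
      refine ⟨by positivity, le_trans ?_ ht.2⟩
      calc (k : ℝ) * (t / n) ≤ n * (t / n) := by gcongr
        _ = t := by field_simp
    have ind : ∀ k ≤ n, Real.log (φ (τs k)) - Real.log (φ 0) ≤
        (1 + η) * ∫ τ in (0 : ℝ)..τs k, m τ := by
      intro k
      induction k with
      | zero => intro _; simp [hτs]
      | succ k ih =>
        intro hk
        have i1 := ih (by omega)
        have hstep : τs (k + 1) - τs k = t / n := by simp only [hτs]; push_cast; ring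
        have htn : 0 ≤ t / n := div_nonneg ht.1 hn0.le
        have i2 := local_est _ (hmem k (by omega)) _ (hmem (k + 1) hk) (by linarith) (by
          rw [hstep, div_lt_iff₀ hn0, mul_comm]
          rwa [div_lt_iff₀ hρ] at hn)
        have i3 := intervalIntegral.integral_add_adjacent_intervals
          (hmi _ h0 _ (hmem k (by omega))) (hmi _ (hmem k (by omega)) _ (hmem (k + 1) hk))
        rw [← i3]
        linarith
    have hfin := ind n le_rfl
    have : τs n = t := by simp only [hτs]; field_simp
    rwa [this] at hfin
  have main2 : Real.log (φ t) - Real.log (φ 0) ≤ ∫ τ in (0 : ℝ)..t, m τ := by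
    have hI : 0 ≤ ∫ τ in (0 : ℝ)..t, m τ :=
      intervalIntegral.integral_nonneg ht.1 fun τ _ => hm0 τ
    refine le_of_forall_pos_le_add fun ε hε => ?_
    have h8 := main (ε / (1 + ∫ τ in (0 : ℝ)..t, m τ)) (by positivity)
    have h9 : ε / (1 + ∫ τ in (0 : ℝ)..t, m τ) * (∫ τ in (0 : ℝ)..t, m τ) ≤ ε := by
      rw [div_mul_eq_mul_div, div_le_iff₀ (by positivity)]
      nlinarith
    linarith
  have hφ00 : φ 0 = δ := by simp [hφ, hD 0 h0]
  have hlog : Real.log (1 + ‖D t‖ / δ) = Real.log (φ t) - Real.log (φ 0) := by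
    rw [hφ00, ← Real.log_div (hφ0 _).ne' hδ.ne']
    congr 1
    simp only [hφ]; field_simp
  rw [hlog]
  refine (ENNReal.ofReal_le_ofReal main2).trans ?_
  rw [intervalIntegral.integral_of_le ht.1, ofReal_integral_eq_lintegral_ofReal
    ((intervalIntegrable_iff_integrableOn_Ioc_of_le ht.1).1 (hmi 0 h0 t ht)) (.of_forall hm0)]
  rw [timeMeasure, Measure.restrict_congr_set Ioo_ae_eq_Ioc]
  refine (lintegral_mono_set (Set.Ioc_subset_Ioc_right ht.2)).trans (lintegral_mono fun τ => ?_)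
  simp only [hm]
  rw [ENNReal.ofReal_div_of_pos (hφ0 τ), ofReal_norm]

/-- Hölder on `U` yields the power of `volume U`; compression removes `F` inside the `L^p` norm at
the cost `L^(1/p)`; the strong type bound finishes. -/
theorem exists_setLIntegral_hlMax_comp_le (d : ℕ) (p : ℝ≥0∞) (hp : 1 < p) (hp' : p < ⊤) :
    ∃ C : ℝ≥0, ∀ (g : Sp d → ℝ≥0∞), AEMeasurable g volume → ∀ (L : ℝ≥0) (F : Sp d → Sp d),
      Compresses L F → ∀ U : Set (Sp d),
      ∫⁻ x in U, hlMax g (F x) ≤ C * (L : ℝ≥0∞) ^ (1 / p.toReal) *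
        volume U ^ (1 - 1 / p.toReal) * (∫⁻ x, g x ^ p.toReal) ^ (1 / p.toReal) := by
  have hpr : 1 < p.toReal := by
    have := (ENNReal.toReal_lt_toReal ENNReal.one_ne_top hp'.ne).2 hp
    simpa using this
  obtain ⟨C, hC⟩ := exists_hlMax_strong_type d p.toReal hpr
  set q := p.toReal with hq
  have hq0 : 0 < q := by linarith
  refine ⟨C ^ (1 / q), fun g hg L F hF U => ?_⟩
  have hgm : ∫⁻ x, hlMax g x ^ q ≤ C * ∫⁻ x, g x ^ q := by
    rw [hlMax_congr_ae hg.ae_eq_mk]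
    refine (hC _ hg.measurable_mk).trans (le_of_eq ?_)
    congr 1
    refine lintegral_congr_ae ?_
    filter_upwards [hg.ae_eq_mk] with x hx
    rw [hx]
  have hmm : Measurable fun x => hlMax g x ^ q := (measurable_hlMax g).pow_const q
  have hol := ENNReal.lintegral_mul_le_Lp_mul_Lq (volume.restrict U)
    (Real.HolderConjugate.conjExponent hpr) (f := fun x => hlMax g (F x)) (g := fun _ => 1)
    ((measurable_hlMax g).comp hF.measurable).aemeasurable aemeasurable_const
  have hqq : 1 / q.conjExponent = 1 - 1 / q := by
    have := (Real.HolderConjugate.conjExponent hpr).inv_add_inv_eq_one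
    rw [one_div, one_div]; linarith
  simp only [Pi.mul_apply, mul_one, ENNReal.one_rpow, lintegral_const,
    Measure.restrict_apply_univ, one_mul, hqq] at hol
  have hin : ∫⁻ x in U, hlMax g (F x) ^ q ≤ L * (C * ∫⁻ x, g x ^ q) := by
    refine (setLIntegral_le_lintegral _ _).trans ?_
    refine (hF.lintegral_comp_le hmm.aemeasurable).trans ?_
    gcongr
  calc ∫⁻ x in U, hlMax g (F x)
      ≤ (∫⁻ x in U, hlMax g (F x) ^ q) ^ (1 / q) * volume U ^ (1 - 1 / q) := hol
    _ ≤ (L * (C * ∫⁻ x, g x ^ q)) ^ (1 / q) * volume U ^ (1 - 1 / q) := by gcongr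
    _ = _ := by
        have h1 : 0 ≤ 1 / q := by positivity
        rw [ENNReal.mul_rpow_of_nonneg _ _ h1, ENNReal.mul_rpow_of_nonneg _ _ h1,
          ENNReal.coe_rpow_of_nonneg _ h1]
        ring

/-- Integrated difference quotients of a Sobolev field along two compressing maps. -/
theorem exists_setLIntegral_diffQuotient_le (d : ℕ) (p : ℝ≥0∞) (hp : 1 < p) (hp' : p < ⊤) :
    ∃ C : ℝ≥0, ∀ (f : Sp d → Sp d) (Df : Sp d → (Sp d →L[ℝ] Sp d)), MemLp f p volume →
      MemLp Df p volume → HasWeakGradient f Df → ∀ (L : ℝ≥0) (F G : Sp d → Sp d),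
      Compresses L F → Compresses L G → ∀ U : Set (Sp d),
      ∫⁻ x in U, ‖f (F x) - f (G x)‖ₑ / ‖F x - G x‖ₑ ≤ C * (L : ℝ≥0∞) ^ (1 / p.toReal) *
        volume U ^ (1 - 1 / p.toReal) * eLpNorm Df p volume := by
  obtain ⟨C, hC⟩ := exists_setLIntegral_hlMax_comp_le d p hp hp'
  refine ⟨8 ^ d * 2 * C, fun f Df hf hDf hw L F G hF hG U => ?_⟩
  obtain ⟨s, hs, hsb⟩ := hw.ae_enorm_sub_le (hf.locallyIntegrable hp.le)
    (hDf.locallyIntegrable hp.le)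
  set g : Sp d → ℝ≥0∞ := fun z => ‖Df z‖ₑ with hg
  have hgm : AEMeasurable g volume := hDf.1.enorm
  have hpt : ∀ᵐ x ∂volume.restrict U, ‖f (F x) - f (G x)‖ₑ / ‖F x - G x‖ₑ ≤
      8 ^ d * (hlMax g (F x) + hlMax g (G x)) := by
    refine ae_restrict_of_ae ?_
    -- Compressing maps pull the exceptional null set of the Lusin–Lipschitz inequality back to a
    -- null set.
    filter_upwards [hF.quasiMeasurePreserving.ae hs, hG.quasiMeasurePreserving.ae hs] with x h1 h2
    refine ENNReal.div_le_of_le_mul ?_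
    refine (hsb _ h1 _ h2).trans (le_of_eq ?_)
    ring
  have hnorm : eLpNorm Df p volume = (∫⁻ x, g x ^ p.toReal) ^ (1 / p.toReal) :=
    eLpNorm_eq_lintegral_rpow_enorm_toReal (zero_lt_one.trans hp).ne' hp'.ne
  rw [hnorm]
  calc ∫⁻ x in U, ‖f (F x) - f (G x)‖ₑ / ‖F x - G x‖ₑ
      ≤ ∫⁻ x in U, 8 ^ d * (hlMax g (F x) + hlMax g (G x)) := lintegral_mono_ae hpt
    _ = 8 ^ d * ((∫⁻ x in U, hlMax g (F x)) + ∫⁻ x in U, hlMax g (G x)) := by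
        rw [lintegral_const_mul' _ _ (by finiteness),
          lintegral_add_left (show Measurable fun x => hlMax g (F x) from
            (measurable_hlMax g).comp hF.measurable)]
    _ ≤ _ := by
        have h1 := hC g hgm L F hF U
        have h2 := hC g hgm L G hG U
        refine (mul_le_mul_right (add_le_add h1 h2) _).trans (le_of_eq ?_)
        push_cast
        ring

/-- The quantitative stability estimate for perturbed flows of a Sobolev field: `D = ∫ w` is a
difference of two curves whose velocities differ by `e` plus the difference of `b` along `F`
and `G`. -/
theorem exists_log_estimate (d : ℕ) (p : ℝ≥0∞) (hp : 1 < p) (hp' : p < ⊤) :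
    ∃ C : ℝ≥0, ∀ (S : ℝ) (b : ℝ → Sp d → Sp d) (Db : ℝ → Sp d → (Sp d →L[ℝ] Sp d)),
      AEStronglyMeasurable (Function.uncurry b) ((timeMeasure S).prod volume) →
      (∀ᵐ t ∂timeMeasure S, MemLp (b t) p volume ∧ MemLp (Db t) p volume ∧
        HasWeakGradient (b t) (Db t)) →
      ∀ (L : ℝ≥0) (F G : ℝ → Sp d → Sp d), Measurable (Function.uncurry F) →
      Measurable (Function.uncurry G) →
      (∀ᵐ τ ∂timeMeasure S, Compresses L (F τ)) → (∀ᵐ τ ∂timeMeasure S, Compresses L (G τ)) →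
      ∀ e : ℝ → Sp d → ℝ≥0∞, AEMeasurable (Function.uncurry e) ((timeMeasure S).prod volume) →
      ∀ (δ : ℝ) (lam : ℝ≥0), 0 < δ → ∀ D w : ℝ → Sp d → Sp d,
      (∀ᵐ x, IntervalIntegrable (fun τ => w τ x) volume 0 S ∧
        ∀ t ∈ Set.Icc 0 S, D t x = ∫ τ in (0 : ℝ)..t, w τ x) →
      (∀ᵐ x, ∀ᵐ τ ∂timeMeasure S,
        ‖w τ x‖ₑ ≤ e τ x + ‖b τ (F τ x) - b τ (G τ x)‖ₑ) →
      (∀ᵐ x, ∀ᵐ τ ∂timeMeasure S, ‖F τ x - G τ x‖ ≤ lam * (δ + ‖D τ x‖)) →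
      ∀ (U : Set (Sp d)), volume U ≠ ⊤ → ∀ t ∈ Set.Icc 0 S,
      ∫⁻ x in U, ENNReal.ofReal (Real.log (1 + ‖D t x‖ / δ)) ≤
        (∫⁻ τ, ∫⁻ x in U, e τ x ∂volume ∂timeMeasure S) / ENNReal.ofReal δ +
        C * lam * (L : ℝ≥0∞) ^ (1 / p.toReal) * volume U ^ (1 - 1 / p.toReal) *
          ∫⁻ τ, eLpNorm (Db τ) p volume ∂timeMeasure S := by
  obtain ⟨C, hC⟩ := exists_setLIntegral_diffQuotient_le d p hp hp'
  refine ⟨C, ?_⟩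
  intro S b Db hbm hb L F G hF hG hFc hGc e he δ lam hδ D w hDw hw hFG U hU t ht
  have : SFinite (timeMeasure S) := by unfold timeMeasure; infer_instance
  set qt : ℝ → Sp d → ℝ≥0∞ := fun τ x =>
    ‖b τ (F τ x) - b τ (G τ x)‖ₑ / ‖F τ x - G τ x‖ₑ with hqt
  -- `H` dominates the integrand of the logarithmic Gronwall inequality: its denominator is at least
  -- `δ`, and at least `‖F - G‖ / lam`. The slack `lam` allows `F - G` to differ from `D`, as for a
  -- scheme frozen between its nodes.
  set H : ℝ → Sp d → ℝ≥0∞ := fun τ x => e τ x / ENNReal.ofReal δ + lam * qt τ x with hH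
  have hδ0 : ENNReal.ofReal δ ≠ 0 := by simpa using hδ
  have hqtm : AEMeasurable (Function.uncurry qt) ((timeMeasure S).prod volume) := by
    have h1 := hbm.comp_quasiMeasurePreserving (quasiMeasurePreserving_graph hF hFc)
    have h2 := hbm.comp_quasiMeasurePreserving (quasiMeasurePreserving_graph hG hGc)
    exact (h1.sub h2).enorm.div (hF.sub hG).enorm.aemeasurable
  have hres : (timeMeasure S).prod (volume.restrict U) ≪
      (timeMeasure S).prod (volume : Measure (Sp d)) :=
    (Measure.AbsolutelyContinuous.refl _).prod Measure.absolutelyContinuous_restrict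
  have hem' := he.mono_ac hres
  have hqm' := hqtm.mono_ac hres
  have hHm : AEMeasurable (Function.uncurry H) ((timeMeasure S).prod (volume.restrict U)) :=
    (hem'.div_const _).add (hqm'.const_mul _)
  have hpt : ∀ᵐ x, ENNReal.ofReal (Real.log (1 + ‖D t x‖ / δ)) ≤
      ∫⁻ τ, H τ x ∂timeMeasure S := by
    filter_upwards [hDw, hw, hFG] with x h1 h2 h3
    refine (ofReal_log_le_lintegral h1.1 h1.2 hδ ht).trans (lintegral_mono_ae ?_)
    filter_upwards [h2, h3] with τ h4 h5
    have hφ : 0 < δ + ‖D τ x‖ := by positivity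
    have hφ0 : ENNReal.ofReal (δ + ‖D τ x‖) ≠ 0 := by simpa using hφ
    refine (ENNReal.div_le_div_right h4 _).trans ?_
    rw [ENNReal.add_div]
    refine add_le_add ?_ ?_
    · gcongr
      linarith [norm_nonneg (D τ x)]
    · rcases eq_or_ne (F τ x) (G τ x) with heq | hne
      · simp [heq]
      have h6 : ‖F τ x - G τ x‖ₑ ≤ lam * ENNReal.ofReal (δ + ‖D τ x‖) := by
        rw [← ofReal_norm, ← ENNReal.ofReal_coe_nnreal, ← ENNReal.ofReal_mul (NNReal.coe_nonneg lam)]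
        exact ENNReal.ofReal_le_ofReal h5
      have h7 : ‖F τ x - G τ x‖ₑ ≠ 0 := by simpa [sub_eq_zero] using hne
      have h8 : ‖F τ x - G τ x‖ₑ ≠ ⊤ := enorm_ne_top
      rw [ENNReal.div_le_iff hφ0 ENNReal.ofReal_ne_top]
      calc ‖b τ (F τ x) - b τ (G τ x)‖ₑ = qt τ x * ‖F τ x - G τ x‖ₑ :=
            (ENNReal.div_mul_cancel h7 h8).symm
        _ ≤ qt τ x * (lam * ENNReal.ofReal (δ + ‖D τ x‖)) := by gcongr
        _ = _ := by ring
  calc ∫⁻ x in U, ENNReal.ofReal (Real.log (1 + ‖D t x‖ / δ))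
      ≤ ∫⁻ x in U, ∫⁻ τ, H τ x ∂timeMeasure S := lintegral_mono_ae (ae_restrict_of_ae hpt)
    _ = ∫⁻ τ, ∫⁻ x in U, H τ x ∂volume ∂timeMeasure S :=
        (lintegral_lintegral_swap hHm).symm
    _ = (∫⁻ τ, ∫⁻ x in U, e τ x / ENNReal.ofReal δ ∂volume ∂timeMeasure S) +
        ∫⁻ τ, ∫⁻ x in U, lam * qt τ x ∂volume ∂timeMeasure S := by
        rw [lintegral_lintegral hHm, lintegral_lintegral (f := fun τ x => e τ x / ENNReal.ofReal δ)
          (hem'.div_const _), lintegral_lintegral (f := fun τ x => lam * qt τ x)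
          (hqm'.const_mul _)]
        exact lintegral_add_left' (hem'.div_const _) _
    _ ≤ _ := by
        refine add_le_add (le_of_eq ?_) ?_
        · have hi : (ENNReal.ofReal δ)⁻¹ ≠ ⊤ := ENNReal.inv_ne_top.2 hδ0
          simp_rw [div_eq_mul_inv, lintegral_mul_const' _ _ hi]
        · have hpr : 1 ≤ p.toReal := by
            have := (ENNReal.toReal_le_toReal ENNReal.one_ne_top hp'.ne).2 hp.le
            simpa using this
          have hpi : 1 / p.toReal ≤ 1 := by
            rw [div_le_one (by linarith)]; exact hpr
          have hUf : volume U ^ (1 - 1 / p.toReal) ≠ ⊤ :=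
            ENNReal.rpow_ne_top_of_nonneg (by linarith) hU
          have hLf : (L : ℝ≥0∞) ^ (1 / p.toReal) ≠ ⊤ :=
            ENNReal.rpow_ne_top_of_nonneg (by positivity) ENNReal.coe_ne_top
          rw [← lintegral_const_mul' _ _ (ENNReal.mul_ne_top (ENNReal.mul_ne_top (by finiteness) hLf)
            hUf)]
          refine lintegral_mono_ae ?_
          filter_upwards [hb, hFc, hGc] with τ h1 h2 h3
          rw [lintegral_const_mul' _ _ (by simp)]
          have := hC (b τ) (Db τ) h1.1 h1.2.1 h1.2.2 L (F τ) (G τ) h2 h3 U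
          refine (mul_le_mul_right this _).trans (le_of_eq ?_)
          ring

/-! ### Time reversal, and inversion of the flow by the backward flow. -/

instance (T : ℝ) : IsFiniteMeasure (timeMeasure T) := by unfold timeMeasure; infer_instance

theorem timeMeasure_mono {t T : ℝ} (h : t ≤ T) : timeMeasure t ≤ timeMeasure T :=
  Measure.restrict_mono (Set.Ioo_subset_Ioo_right h) le_rfl

theorem measurePreserving_sub_timeMeasure (t : ℝ) :
    MeasurePreserving (fun s : ℝ => t - s) (timeMeasure t) (timeMeasure t) := by
  have h := (Measure.measurePreserving_sub_left (volume : Measure ℝ) t).restrict_preimage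
    (measurableSet_Ioo (a := 0) (b := t))
  simpa [timeMeasure] using h

theorem ae_timeMeasure_mem (t : ℝ) : ∀ᵐ s ∂timeMeasure t, s ∈ Set.Ioo 0 t :=
  ae_restrict_mem measurableSet_Ioo

section BackwardField

variable {d : ℕ} {T t : ℝ} {p : ℝ≥0∞} {b : ℝ → Sp d → Sp d} {Db : ℝ → Sp d → (Sp d →L[ℝ] Sp d)}

theorem backwardField_of_le {s : ℝ} (h : s ≤ t) (x : Sp d) :
    backwardField b t s x = -b (t - s) x := if_pos h

theorem aestronglyMeasurable_mono_time {F : Type*} [TopologicalSpace F] {f : ℝ × Sp d → F}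
    (h : AEStronglyMeasurable f ((timeMeasure T).prod volume)) (htT : t ≤ T) :
    AEStronglyMeasurable f ((timeMeasure t).prod volume) :=
  h.mono_ac ((Measure.absolutelyContinuous_of_le (timeMeasure_mono htT)).prod
    (Measure.AbsolutelyContinuous.refl _))

theorem aestronglyMeasurable_backwardField
    (h : AEStronglyMeasurable (Function.uncurry b) ((timeMeasure t).prod volume)) :
    AEStronglyMeasurable (Function.uncurry (backwardField b t)) ((timeMeasure t).prod volume) := by
  have h1 := h.comp_quasiMeasurePreserving ((measurePreserving_sub_timeMeasure t).prod
    (MeasurePreserving.id (volume : Measure (Sp d)))).quasiMeasurePreserving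
  refine h1.neg.congr ?_
  have h2 : ∀ᵐ z : ℝ × Sp d ∂(timeMeasure t).prod volume, z.1 ∈ Set.Ioo 0 t :=
    Measure.quasiMeasurePreserving_fst.ae (ae_timeMeasure_mem t)
  filter_upwards [h2] with z hz
  exact (backwardField_of_le hz.2.le z.2).symm

theorem MemL1W1p.ae_weakGradient (h : MemL1W1p T p b Db) :
    ∀ᵐ s ∂timeMeasure T, MemLp (b s) p volume ∧ MemLp (Db s) p volume ∧
      HasWeakGradient (b s) (Db s) := by
  filter_upwards [h.memLp, h.memLp_grad, h.weakGrad] with s h1 h2 h3 using ⟨h1, h2, h3⟩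

theorem MemL1W1p.ae_weakGradient_backwardField (h : MemL1W1p T p b Db) (htT : t ≤ T) :
    ∀ᵐ s ∂timeMeasure t, MemLp (backwardField b t s) p volume ∧
      MemLp (fun x => -Db (t - s) x) p volume ∧
      HasWeakGradient (backwardField b t s) (fun x => -Db (t - s) x) := by
  have h1 := (Measure.absolutelyContinuous_of_le (timeMeasure_mono htT)).ae_le h.ae_weakGradient
  have h2 := (measurePreserving_sub_timeMeasure t).quasiMeasurePreserving.ae h1
  filter_upwards [h2, ae_timeMeasure_mem t] with s ⟨h3, h4, h5⟩ hs
  have e : backwardField b t s = fun x => -b (t - s) x :=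
    funext fun x => backwardField_of_le hs.2.le x
  rw [e]
  refine ⟨h3.neg, h4.neg, fun φ hφ hφs v => ?_⟩
  have := h5 φ hφ hφs v
  simp only [smul_neg, neg_apply, integral_neg, this]

theorem lintegral_eLpNorm_backward_le (htT : t ≤ T) :
    ∫⁻ s, eLpNorm (fun x => -Db (t - s) x) p volume ∂timeMeasure t ≤
      ∫⁻ s, eLpNorm (Db s) p volume ∂timeMeasure T := by
  have e : ∀ s, eLpNorm (fun x => -Db (t - s) x) p volume = eLpNorm (Db (t - s)) p volume :=
    fun s => eLpNorm_neg (Db (t - s)) p volume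
  simp_rw [e]
  have hemb : MeasurableEmbedding fun s : ℝ => t - s :=
    (Homeomorph.subLeft t).measurableEmbedding
  have := (measurePreserving_sub_timeMeasure t).lintegral_comp_emb hemb
    (fun s => eLpNorm (Db s) p volume)
  rw [this]
  exact lintegral_mono' (timeMeasure_mono htT) le_rfl

end BackwardField

/-- Chebyshev's inequality for the increasing function `log (1 + ·/δ)`. -/
theorem ofReal_log_mul_measure_le {d : ℕ} {D : Sp d → ℝ} (hD : AEMeasurable D volume)
    {U : Set (Sp d)} {c δ : ℝ} (hc : 0 ≤ c) (hδ : 0 < δ) :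
    ENNReal.ofReal (Real.log (1 + c / δ)) * volume (U ∩ {x | c ≤ D x}) ≤
      ∫⁻ x in U, ENNReal.ofReal (Real.log (1 + D x / δ)) := by
  have hm : AEMeasurable (fun x => ENNReal.ofReal (Real.log (1 + D x / δ))) (volume.restrict U) :=
    (Real.measurable_log.comp_aemeasurable
      (((hD.mono_measure Measure.restrict_le_self).div_const δ).const_add 1)).ennreal_ofReal
  have h : volume (U ∩ {x | c ≤ D x}) ≤ volume.restrict U {x | ENNReal.ofReal
      (Real.log (1 + c / δ)) ≤ ENNReal.ofReal (Real.log (1 + D x / δ))} := by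
    rw [Set.inter_comm]
    refine (Measure.le_restrict_apply _ _).trans (measure_mono fun x hx => ?_)
    have hx' : c ≤ D x := hx
    show ENNReal.ofReal (Real.log (1 + c / δ)) ≤ ENNReal.ofReal (Real.log (1 + D x / δ))
    gcongr
  exact (mul_le_mul_right h _).trans (mul_meas_ge_le_lintegral₀ hm _)

/-- Uniqueness: a regular Lagrangian flow is inverted by the backward regular Lagrangian flow. -/
theorem IsRegularLagrangianFlow.ae_comp_backward_eq {d : ℕ} {p : ℝ≥0∞} (hp : 1 < p) (hp' : p < ⊤)
    {T t : ℝ} (ht : t ∈ Set.Icc 0 T) {b : ℝ → Sp d → Sp d} {Db : ℝ → Sp d → (Sp d →L[ℝ] Sp d)}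
    (hb : MemL1W1p T p b Db) {X Y : ℝ → Sp d → Sp d} (hX : IsRegularLagrangianFlow T b X)
    (hY : IsRegularLagrangianFlow t (backwardField b t) Y) :
    ∀ᵐ y, X t (Y t y) = y := by
  obtain ⟨ht0, htT⟩ := ht
  obtain ⟨X', LX, hX'm, hX'c, hX'e⟩ := hX.exists_measurable_version (ht0.trans htT)
  obtain ⟨Y', LY, hY'm, hY'c, hY'e⟩ := hY.exists_measurable_version ht0
  obtain ⟨C, hC⟩ := exists_log_estimate d p hp hp'
  -- With `x = Y(t,y)`, the curve `F` runs the backward trajectory in reverse from `x` to `y`, and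
  -- `G` is the forward trajectory from `x`. Both solve the equation for `b`, so `D` vanishes at
  -- time `0` and the forcing term is zero.
  set F : ℝ → Sp d → Sp d := fun τ y => Y' (t - τ) y with hF
  set G : ℝ → Sp d → Sp d := fun τ y => X' τ (Y' t y) with hG
  set L := max LY (LX * LY) with hL
  have hFm : Measurable (Function.uncurry F) :=
    hY'm.comp ((measurable_const.sub measurable_fst).prodMk measurable_snd)
  have hGm : Measurable (Function.uncurry G) :=
    hX'm.comp (measurable_fst.prodMk ((hY'c t).measurable.comp measurable_snd))
  have hFc : ∀ τ, Compresses L (F τ) := fun τ => (hY'c _).mono (le_max_left _ _)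
  have hGc : ∀ τ, Compresses L (G τ) := fun τ => ((hX'c τ).comp (hY'c t)).mono (le_max_right _ _)
  set D : ℝ → Sp d → Sp d := fun τ y => F τ y - G τ y with hD
  set w : ℝ → Sp d → Sp d := fun τ y => b τ (F τ y) - b τ (G τ y) with hw
  have hDw : ∀ᵐ y, IntervalIntegrable (fun τ => w τ y) volume 0 t ∧
      ∀ s ∈ Set.Icc 0 t, D s y = ∫ τ in (0 : ℝ)..s, w τ y := by
    filter_upwards [hY'e, hY.ode, (hY'c t).quasiMeasurePreserving.ae hX'e,
      (hY'c t).quasiMeasurePreserving.ae hX.ode] with y h1 ⟨h2, h3⟩ h4 ⟨h5, h6⟩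
    set x := Y' t y with hx
    have hFi : IntervalIntegrable (fun τ => b τ (F τ y)) volume 0 t := by
      have h7 := (h2.comp_sub_left t).symm.neg
      simp only [sub_self, sub_zero] at h7
      refine h7.congr fun τ hτ => ?_
      rw [Set.uIoc_of_le ht0] at hτ
      have h8 : t - τ ∈ Set.Icc 0 t := ⟨by linarith [hτ.2], by linarith [hτ.1]⟩
      show -backwardField b t (t - τ) (Y (t - τ) y) = b τ (Y' (t - τ) y)
      rw [backwardField_of_le h8.2, h1 _ h8, neg_neg, sub_sub_cancel]
    have hGi : IntervalIntegrable (fun τ => b τ (G τ y)) volume 0 t := by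
      refine (h5.mono_set (Set.uIcc_subset_uIcc_left ?_)).congr fun τ hτ => ?_
      · rw [Set.uIcc_of_le (ht0.trans htT)]; exact ⟨ht0, htT⟩
      · rw [Set.uIoc_of_le ht0] at hτ
        simp only [hG]
        rw [h4 τ ⟨hτ.1.le, hτ.2.trans htT⟩]
    refine ⟨hFi.sub hGi, fun s hs => ?_⟩
    have hsub : Set.uIcc 0 s ⊆ Set.uIcc 0 t := by
      rw [Set.uIcc_of_le hs.1, Set.uIcc_of_le ht0]; exact Set.Icc_subset_Icc_right hs.2
    have hF0 : F s y - F 0 y = ∫ τ in (0 : ℝ)..s, b τ (F τ y) := by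
      have hts : t - s ∈ Set.Icc 0 t := ⟨by linarith [hs.2], by linarith [hs.1]⟩
      have htt : t ∈ Set.Icc 0 t := ⟨ht0, le_rfl⟩
      simp only [hF, sub_zero]
      rw [h1 _ hts, h1 _ htt, h3 _ hts, h3 _ htt, add_sub_add_left_eq_sub,
        intervalIntegral.integral_interval_sub_left (h2.mono_set (by
          rw [Set.uIcc_of_le hts.1, Set.uIcc_of_le ht0]; exact Set.Icc_subset_Icc_right hts.2)) h2,
        intervalIntegral.integral_symm, ← intervalIntegral.integral_neg]
      have e := intervalIntegral.integral_comp_sub_left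
        (fun r => -backwardField b t r (Y r y)) t (a := 0) (b := s)
      rw [sub_zero] at e
      rw [← e]
      refine intervalIntegral.integral_congr fun τ hτ => ?_
      rw [Set.uIcc_of_le hs.1] at hτ
      have h8 : t - τ ∈ Set.Icc 0 t := ⟨by linarith [hτ.2, hs.2], by linarith [hτ.1]⟩
      show -backwardField b t (t - τ) (Y (t - τ) y) = b τ (Y' (t - τ) y)
      rw [backwardField_of_le h8.2, h1 _ h8, neg_neg, sub_sub_cancel]
    have hG0 : G s y - x = ∫ τ in (0 : ℝ)..s, b τ (G τ y) := by
      have hsT : s ∈ Set.Icc 0 T := ⟨hs.1, hs.2.trans htT⟩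
      simp only [hG]
      rw [← hx, h4 _ hsT, h6 _ hsT, add_sub_cancel_left]
      refine intervalIntegral.integral_congr fun τ hτ => ?_
      rw [Set.uIcc_of_le hs.1] at hτ
      rw [h4 τ ⟨hτ.1, hτ.2.trans hsT.2⟩]
    have hF00 : F 0 y = x := by simp only [hF, sub_zero, hx]
    simp only [hD, hw]
    rw [intervalIntegral.integral_sub (hFi.mono_set hsub) (hGi.mono_set hsub), ← hF0, ← hG0, hF00]
    abel
  -- Without forcing, the logarithmic bound does not depend on `δ`.
  have hfin : ∀ R : ℝ, ∃ K : ℝ≥0∞, K ≠ ⊤ ∧ ∀ δ : ℝ, 0 < δ →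
      ∫⁻ x in Metric.ball 0 R, ENNReal.ofReal (Real.log (1 + ‖D t x‖ / δ)) ≤ K := by
    intro R
    have hpr : 1 ≤ p.toReal := by
      have := (ENNReal.toReal_le_toReal ENNReal.one_ne_top hp'.ne).2 hp.le
      simpa using this
    have hpi : 1 / p.toReal ≤ 1 := by
      rw [div_le_one (by linarith)]; exact hpr
    refine ⟨_, ?_, fun δ hδ => (hC t b Db (aestronglyMeasurable_mono_time hb.meas htT)
      ((Measure.absolutelyContinuous_of_le (timeMeasure_mono htT)).ae_le hb.ae_weakGradient)
      L F G hFm hGm (.of_forall hFc) (.of_forall hGc) (fun _ _ => 0) aemeasurable_const δ 1 hδ D w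
      hDw (.of_forall fun x => .of_forall fun τ => by simp [hw])
      (.of_forall fun x => .of_forall fun τ => by simp [hD, hδ.le])
      (Metric.ball 0 R) (volume_ball_ne_top 0 R) t ⟨ht0, le_rfl⟩).trans
        (le_of_eq (by rw [lintegral_congr fun _ => lintegral_zero, lintegral_zero,
          ENNReal.zero_div, zero_add]))⟩
    refine ENNReal.mul_ne_top (ENNReal.mul_ne_top (ENNReal.mul_ne_top (by simp) ?_) ?_) ?_
    · exact ENNReal.rpow_ne_top_of_nonneg (by positivity) ENNReal.coe_ne_top
    · exact ENNReal.rpow_ne_top_of_nonneg (by linarith) (volume_ball_ne_top 0 R)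
    · exact ((lintegral_mono' (timeMeasure_mono htT) le_rfl).trans_lt hb.norm_grad_lt_top).ne
  have hDm : Measurable fun x => ‖D t x‖ := ((hFc t).measurable.sub (hGc t).measurable).norm
  have hzero : ∀ n : ℕ, volume (Metric.ball (0 : Sp d) n ∩ {x | 1 / ((n : ℝ) + 1) ≤ ‖D t x‖}) = 0 := by
    intro n
    obtain ⟨K, hK, hKb⟩ := hfin n
    set c := 1 / ((n : ℝ) + 1) with hc
    have hc0 : 0 < c := by positivity
    set V := volume (Metric.ball (0 : Sp d) n ∩ {x | c ≤ ‖D t x‖}) with hV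
    by_contra hV0
    -- For `δ = c / (e^m - 1)` the logarithm at height `c` equals `m`, which is arbitrary; so `V`
    -- must be `0`.
    have h1 : ∀ m : ℝ, 0 < m → ENNReal.ofReal m * V ≤ K := by
      intro m hm
      have he : 0 < Real.exp m - 1 := by linarith [Real.add_one_lt_exp hm.ne']
      have h2 := (ofReal_log_mul_measure_le hDm.aemeasurable (U := Metric.ball (0 : Sp d) n)
        hc0.le (δ := c / (Real.exp m - 1)) (by positivity)).trans (hKb _ (by positivity))
      have h3 : 1 + c / (c / (Real.exp m - 1)) = Real.exp m := by field_simp; ring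
      rwa [h3, Real.log_exp] at h2
    have hVt : V ≠ ⊤ :=
      ((measure_mono Set.inter_subset_left).trans_lt measure_ball_lt_top).ne
    have hVr : 0 < V.toReal := ENNReal.toReal_pos hV0 hVt
    have h4 : ENNReal.ofReal ((K.toReal + 1) / V.toReal) * ENNReal.ofReal V.toReal ≤
        ENNReal.ofReal K.toReal := by
      rw [ENNReal.ofReal_toReal hVt, ENNReal.ofReal_toReal hK]
      exact h1 _ (by positivity)
    rw [← ENNReal.ofReal_mul (by positivity), div_mul_cancel₀ _ hVr.ne',
      ENNReal.ofReal_le_ofReal_iff (by positivity)] at h4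
    linarith
  have hall : ∀ᵐ x, ∀ n : ℕ, x ∉ Metric.ball (0 : Sp d) n ∩ {x | 1 / ((n : ℝ) + 1) ≤ ‖D t x‖} :=
    ae_all_iff.2 fun n => measure_eq_zero_iff_ae_notMem.1 (hzero n)
  filter_upwards [hall, hY'e, hY.ode, (hY'c t).quasiMeasurePreserving.ae hX'e] with y h1 h2 h3 h4
  have hD0 : D t y = 0 := by
    by_contra hne
    have hpos : 0 < ‖D t y‖ := norm_pos_iff.2 hne
    obtain ⟨n1, hn1⟩ := exists_nat_gt ‖y‖
    obtain ⟨n2, hn2⟩ := exists_nat_one_div_lt hpos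
    refine h1 (max n1 n2) ⟨?_, ?_⟩
    · rw [mem_ball_zero_iff]
      exact hn1.trans_le (by exact_mod_cast le_max_left n1 n2)
    · show 1 / (((max n1 n2 : ℕ) : ℝ) + 1) ≤ ‖D t y‖
      have : 1 / (((max n1 n2 : ℕ) : ℝ) + 1) ≤ 1 / ((n2 : ℝ) + 1) := by
        gcongr
        exact le_max_right n1 n2
      linarith
  have h5 : Y' 0 y = y := by
    rw [h2 0 ⟨le_rfl, ht0⟩, h3.2 0 ⟨le_rfl, ht0⟩]; simp
  have h6 : Y' t y = Y t y := h2 t ⟨ht0, le_rfl⟩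
  have h7 : D t y = Y' 0 y - X' t (Y' t y) := by simp only [hD, hF, hG, sub_self]
  rw [h7, h5, h4 t ⟨ht0, htT⟩, h6] at hD0
  exact (sub_eq_zero.1 hD0).symm

/-- The Lagrangian solution is transported by the backward flow. -/
theorem IsLagrangianSolution.ae_eq_comp_backward {d : ℕ} {p : ℝ≥0∞} (hp : 1 < p) (hp' : p < ⊤)
    {T t : ℝ} (ht : t ∈ Set.Icc 0 T) {b : ℝ → Sp d → Sp d} {Db : ℝ → Sp d → (Sp d →L[ℝ] Sp d)}
    (hb : MemL1W1p T p b Db) {u₀ : Sp d → ℝ} {u : ℝ → Sp d → ℝ}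
    (hu : IsLagrangianSolution T b u₀ u) {Y : ℝ → Sp d → Sp d}
    (hY : IsRegularLagrangianFlow t (backwardField b t) Y) :
    ∀ᵐ x, u t x = u₀ (Y t x) := by
  obtain ⟨X, Z, hX, hZ⟩ := hu
  obtain ⟨h1, -, h3⟩ := hZ t ht
  obtain ⟨Y', LY, -, hY'c, hY'e⟩ := hY.exists_measurable_version ht.1
  -- Evaluating `Z(X(·)) = id` at `Y(t,y)`, where `X(t, Y(t,y)) = y`, gives `Z(t,y) = Y(t,y)`.
  filter_upwards [h3, hX.ae_comp_backward_eq hp hp' ht hb hY, hY'e,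
    (hY'c t).quasiMeasurePreserving.ae h1] with y e1 e2 e3 e4
  rw [e3 t ⟨ht.1, le_rfl⟩, e2] at e4
  rw [e1, e4]

/-! ### The time grid and the continuous interpolation of the scheme. -/

/-- The index `i < N` of the interval `[t_i, t_{i+1}]` of the time grid used at time `s`. -/
def gridIndex (T : ℝ) (N : ℕ) (s : ℝ) : ℕ := min ⌊s / (T / N)⌋₊ (N - 1)

theorem gridIndex_spec {T : ℝ} (hT : 0 < T) {N : ℕ} (hN : 0 < N) {s : ℝ} (hs : s ∈ Set.Icc 0 T) :
    gridIndex T N s < N ∧ (gridIndex T N s : ℝ) * (T / N) ≤ s ∧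
      s ≤ ((gridIndex T N s : ℝ) + 1) * (T / N) := by
  have hNr : (0 : ℝ) < N := by exact_mod_cast hN
  have hh : 0 < T / N := by positivity
  refine ⟨(min_le_right _ _).trans_lt (by omega), ?_, ?_⟩
  · have h1 : (gridIndex T N s : ℝ) ≤ ⌊s / (T / N)⌋₊ := by exact_mod_cast min_le_left _ _
    have h2 := Nat.floor_le (div_nonneg hs.1 hh.le)
    rw [← le_div_iff₀ hh]
    exact h1.trans h2
  · rcases le_total ⌊s / (T / N)⌋₊ (N - 1) with h | h
    · rw [gridIndex, min_eq_left h, ← div_le_iff₀ hh]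
      exact (Nat.lt_floor_add_one _).le
    -- This branch contains `s = T`, where the floor is `N` and the minimum selects the last
    -- interval.
    · rw [gridIndex, min_eq_right h]
      have : ((N - 1 : ℕ) : ℝ) + 1 = N := by
        rw [Nat.cast_sub hN]; simp
      rw [this, mul_div_cancel₀ _ hNr.ne']
      exact hs.2

theorem gridIndex_eq {T : ℝ} (hT : 0 < T) {N i : ℕ} (hi : i < N) {s : ℝ}
    (hs : s ∈ Set.Ioo ((i : ℝ) * (T / N)) (((i : ℝ) + 1) * (T / N))) : gridIndex T N s = i := by
  have hNr : (0 : ℝ) < N := by exact_mod_cast (Nat.zero_le i).trans_lt hi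
  have hh : 0 < T / N := by positivity
  have h0 : 0 ≤ s / (T / N) :=
    div_nonneg ((mul_nonneg (Nat.cast_nonneg i) hh.le).trans hs.1.le) hh.le
  have : ⌊s / (T / N)⌋₊ = i := by
    rw [Nat.floor_eq_iff h0, le_div_iff₀ hh, div_lt_iff₀ hh]
    exact ⟨hs.1.le, hs.2⟩
  rw [gridIndex, this]
  omega

theorem measurable_gridIndex (T : ℝ) (N : ℕ) : Measurable (gridIndex T N) :=
  (Nat.measurable_floor.comp (measurable_id.div_const _)).min measurable_const

theorem measurable_comp_gridIndex {d : ℕ} {T : ℝ} {N : ℕ} {Y : ℕ → Sp d → Sp d}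
    (hY : ∀ i ≤ N, Measurable (Y i)) :
    Measurable (Function.uncurry fun τ x => Y (gridIndex T N τ) x) := by
  have h1 : Measurable fun q : ℕ × Sp d => Y (min q.1 (N - 1)) q.2 :=
    measurable_from_prod_countable_right fun n =>
      hY (min n (N - 1)) ((min_le_right _ _).trans (Nat.sub_le _ _))
  have h2 : Measurable fun z : ℝ × Sp d => (gridIndex T N z.1, z.2) :=
    ((measurable_gridIndex T N).comp measurable_fst).prodMk measurable_snd
  have e : (Function.uncurry fun τ x => Y (gridIndex T N τ) x) =
      (fun q : ℕ × Sp d => Y (min q.1 (N - 1)) q.2) ∘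
        fun z : ℝ × Sp d => (gridIndex T N z.1, z.2) := by
    funext z
    simp [Function.uncurry, gridIndex]
  rw [e]
  exact h1.comp h2

theorem thetaInterp_eq {d : ℕ} (T : ℝ) (N : ℕ) (Y : ℕ → Sp d → Sp d) (s : ℝ) (x : Sp d) :
    thetaInterp T N Y s x = Y (gridIndex T N s) x +
      ((s - gridIndex T N s * (T / N)) / (T / N)) •
        (Y (gridIndex T N s + 1) x - Y (gridIndex T N s) x) := rfl

/-- The velocity of the continuous-in-time interpolation of the `θ`-method that uses the exact
field in place of its time averages. -/
def thetaVelocity {d : ℕ} (T : ℝ) (N : ℕ) (θ : ℝ) (B : ℝ → Sp d → Sp d) (Y : ℕ → Sp d → Sp d)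
    (τ : ℝ) (x : Sp d) : Sp d :=
  (1 - θ) • B τ (Y (gridIndex T N τ) x) + θ • B τ (Y (gridIndex T N τ + 1) x)

section Scheme

variable {d : ℕ} {T : ℝ} {N : ℕ} {θ : ℝ} {B : ℝ → Sp d → Sp d} {Y : ℕ → Sp d → Sp d} {ℓ : ℝ≥0}
  {C₃ : ℝ}

theorem norm_convexCombination_le (hθ : θ ∈ Set.Icc (0 : ℝ) 1) {u v : Sp d} (hu : ‖u‖ ≤ C₃)
    (hv : ‖v‖ ≤ C₃) : ‖(1 - θ) • u + θ • v‖ ≤ C₃ := by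
  have h := convex_closedBall (0 : Sp d) C₃ (by simpa using hu) (by simpa using hv)
    (sub_nonneg.2 hθ.2) hθ.1 (by ring)
  simpa using h

theorem IsThetaScheme.norm_step_le (hT : 0 < T) (hθ : θ ∈ Set.Icc (0 : ℝ) 1)
    (hb : ∀ᵐ s ∂timeMeasure T, ∀ x, ‖B s x‖ ≤ C₃) (hY : IsThetaScheme T N θ B Y) {i : ℕ}
    (hi : i < N) (x : Sp d) : ‖Y (i + 1) x - Y i x‖ ≤ C₃ * (T / N) := by
  obtain ⟨hn0, hn1, hn2⟩ := thetaScheme_node_le hT hi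
  have hNr : (0 : ℝ) < N := by exact_mod_cast (Nat.zero_le i).trans_lt hi
  have hP := isProbabilityMeasure_uniformMeasure hn1
  have hac := uniformMeasure_absolutelyContinuous hn0 hn2
  have hint : ∀ y, ‖∫ τ, B τ y ∂uniformMeasure (i * (T / N)) ((i + 1) * (T / N))‖ ≤ C₃ := by
    intro y
    have := norm_integral_le_of_norm_le_const (μ := uniformMeasure (i * (T / N)) ((i + 1) * (T / N)))
      (f := fun τ => B τ y) 
      ((show ∀ᵐ s ∂uniformMeasure (i * (T / N)) ((i + 1) * (T / N)), ∀ y, ‖B s y‖ ≤ C₃ from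
        hac.ae_le hb).mono fun s h => h y)
    simpa using this
  rw [hY.step_eq hT hi x, add_sub_cancel_left, norm_smul, Real.norm_of_nonneg (by positivity),
    mul_comm]
  gcongr
  exact norm_convexCombination_le hθ (hint _) (hint _)

/-- Over a full grid interval the field and its time average have the same integral, so the curve
with velocity `thetaVelocity` passes through all nodes. It is used instead of the linear interpolant
because its velocity involves the field at the current time; no regularity of the field in time is
then needed. -/
theorem IsThetaScheme.integral_velocity_step (hT : 0 < T)
    (hm : AEStronglyMeasurable (Function.uncurry B) ((timeMeasure T).prod volume))
    (hl : ∀ᵐ s ∂timeMeasure T, LipschitzWith ℓ (B s))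
    (hb : ∀ᵐ s ∂timeMeasure T, ∀ x, ‖B s x‖ ≤ C₃) (hY : IsThetaScheme T N θ B Y) {i : ℕ}
    (hi : i < N) (x : Sp d) :
    IntervalIntegrable (fun τ => thetaVelocity T N θ B Y τ x) volume (i * (T / N))
      ((i + 1) * (T / N)) ∧
    ∫ τ in (i * (T / N))..((i + 1) * (T / N)), thetaVelocity T N θ B Y τ x =
      Y (i + 1) x - Y i x := by
  obtain ⟨hn0, hn1, hn2⟩ := thetaScheme_node_le hT hi
  have hNr : (0 : ℝ) < N := by exact_mod_cast (Nat.zero_le i).trans_lt hi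
  have hac := restrict_absolutelyContinuous_timeMeasure hn0 hn2
  set a := (i : ℝ) * (T / N) with ha
  set c := ((i : ℝ) + 1) * (T / N) with hc
  have hm' := hm.mono_ac (hac.prod (Measure.AbsolutelyContinuous.refl volume))
  have hi1 : ∀ y, IntervalIntegrable (fun τ => B τ y) volume a c := by
    intro y
    rw [intervalIntegrable_iff_integrableOn_Ioc_of_le hn1.le]
    exact integrable_slice hm' (hac.ae_le hl) (hac.ae_le hb) y
  have hcongr : ∀ᵐ τ ∂volume.restrict (Set.Ioc a c),
      (1 - θ) • B τ (Y i x) + θ • B τ (Y (i + 1) x) = thetaVelocity T N θ B Y τ x := by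
    rw [← Measure.restrict_congr_set Ioo_ae_eq_Ioc]
    filter_upwards [ae_restrict_mem measurableSet_Ioo] with τ hτ
    rw [thetaVelocity, gridIndex_eq hT hi hτ]
  have hs1 : IntervalIntegrable (fun τ => (1 - θ) • B τ (Y i x)) volume a c :=
    (hi1 (Y i x)).smul (1 - θ)
  have hs2 : IntervalIntegrable (fun τ => θ • B τ (Y (i + 1) x)) volume a c :=
    (hi1 (Y (i + 1) x)).smul θ
  have hsum := hs1.add hs2
  have hca : c - a = T / N := by rw [hc, ha]; ring
  constructor
  · rw [intervalIntegrable_iff_integrableOn_Ioc_of_le hn1.le] at hsum ⊢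
    exact hsum.congr hcongr
  · have e1 : ∫ τ in a..c, thetaVelocity T N θ B Y τ x =
        ∫ τ in a..c, ((1 - θ) • B τ (Y i x) + θ • B τ (Y (i + 1) x)) := by
      rw [intervalIntegral.integral_of_le hn1.le, intervalIntegral.integral_of_le hn1.le]
      exact (integral_congr_ae hcongr).symm
    have h1 := hY.2 i hi x
    rw [interval_average_eq, interval_average_eq] at h1
    rw [e1, intervalIntegral.integral_add hs1 hs2,
      intervalIntegral.integral_smul, intervalIntegral.integral_smul]
    have h2 : (T / N) • ((T / N)⁻¹ • (Y (i + 1) x - Y i x)) = Y (i + 1) x - Y i x := by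
      rw [smul_smul, mul_inv_cancel₀ (by positivity), one_smul]
    rw [← h2, h1, ← ha, ← hc, hca, smul_comm (1 - θ), smul_comm θ, ← smul_add, smul_smul,
      mul_inv_cancel₀ (by positivity), one_smul]

theorem IsThetaScheme.intervalIntegrable_velocity (hT : 0 < T) (hN : 0 < N)
    (hm : AEStronglyMeasurable (Function.uncurry B) ((timeMeasure T).prod volume))
    (hl : ∀ᵐ s ∂timeMeasure T, LipschitzWith ℓ (B s))
    (hb : ∀ᵐ s ∂timeMeasure T, ∀ x, ‖B s x‖ ≤ C₃) (hY : IsThetaScheme T N θ B Y) (x : Sp d) :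
    IntervalIntegrable (fun τ => thetaVelocity T N θ B Y τ x) volume 0 T := by
  have hNr : (0 : ℝ) < N := by exact_mod_cast hN
  have h := IntervalIntegrable.trans_iterate (a := fun k : ℕ => (k : ℝ) * (T / N)) (n := N)
    (f := fun τ => thetaVelocity T N θ B Y τ x) (μ := volume) fun k hk => by
      have := (hY.integral_velocity_step hT hm hl hb hk x).1
      push_cast
      exact this
  simpa [mul_div_cancel₀ T hNr.ne'] using h

theorem IsThetaScheme.integral_velocity_node (hT : 0 < T)
    (hm : AEStronglyMeasurable (Function.uncurry B) ((timeMeasure T).prod volume))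
    (hl : ∀ᵐ s ∂timeMeasure T, LipschitzWith ℓ (B s))
    (hb : ∀ᵐ s ∂timeMeasure T, ∀ x, ‖B s x‖ ≤ C₃) (hY : IsThetaScheme T N θ B Y) (x : Sp d)
    {k : ℕ} (hk : k ≤ N) :
    x + ∫ τ in (0 : ℝ)..k * (T / N), thetaVelocity T N θ B Y τ x = Y k x := by
  have h := intervalIntegral.sum_integral_adjacent_intervals
    (a := fun k : ℕ => (k : ℝ) * (T / N)) (n := k)
    (f := fun τ => thetaVelocity T N θ B Y τ x) (μ := volume) fun j hj => by
      have := (hY.integral_velocity_step hT hm hl hb (hj.trans_le hk) x).1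
      push_cast
      exact this
  have e : ∑ j ∈ Finset.range k, ∫ τ in ((j : ℕ) : ℝ) * (T / N)..((j + 1 : ℕ) : ℝ) * (T / N),
      thetaVelocity T N θ B Y τ x = ∑ j ∈ Finset.range k, (Y (j + 1) x - Y j x) := by
    refine Finset.sum_congr rfl fun j hj => ?_
    have := (hY.integral_velocity_step hT hm hl hb ((Finset.mem_range.1 hj).trans_le hk) x).2
    push_cast
    exact this
  rw [e, Finset.sum_range_sub (fun j => Y j x), hY.1] at h
  simp only [Nat.cast_zero, zero_mul] at h
  rw [← h, add_sub_cancel]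

theorem norm_thetaVelocity_le (hθ : θ ∈ Set.Icc (0 : ℝ) 1)
    (hb : ∀ᵐ s ∂timeMeasure T, ∀ x, ‖B s x‖ ≤ C₃) :
    ∀ᵐ τ ∂timeMeasure T, ∀ x, ‖thetaVelocity T N θ B Y τ x‖ ≤ C₃ := by
  filter_upwards [hb] with τ h x using norm_convexCombination_le hθ (h _) (h _)

theorem IsThetaScheme.norm_continuousInterp_sub_le (hT : 0 < T) (hN : 0 < N)
    (hθ : θ ∈ Set.Icc (0 : ℝ) 1)
    (hm : AEStronglyMeasurable (Function.uncurry B) ((timeMeasure T).prod volume))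
    (hl : ∀ᵐ s ∂timeMeasure T, LipschitzWith ℓ (B s))
    (hb : ∀ᵐ s ∂timeMeasure T, ∀ x, ‖B s x‖ ≤ C₃) (hC₃ : 0 ≤ C₃) (hY : IsThetaScheme T N θ B Y)
    {s : ℝ} (hs : s ∈ Set.Icc 0 T) (x : Sp d) :
    ‖(x + ∫ τ in (0 : ℝ)..s, thetaVelocity T N θ B Y τ x) - Y (gridIndex T N s) x‖ ≤
      C₃ * (T / N) := by
  obtain ⟨h1, h2, h3⟩ := gridIndex_spec hT hN hs
  set i := gridIndex T N s
  obtain ⟨hn0, hn1, hn2⟩ := thetaScheme_node_le hT h1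
  have hii := hY.intervalIntegrable_velocity hT hN hm hl hb x
  have hsub : ∀ r ∈ Set.Icc 0 T, IntervalIntegrable (fun τ => thetaVelocity T N θ B Y τ x)
      volume 0 r := fun r hr => hii.mono_set (by
    rw [Set.uIcc_of_le hT.le, Set.uIcc_of_le hr.1]; exact Set.Icc_subset_Icc_right hr.2)
  rw [← hY.integral_velocity_node hT hm hl hb x h1.le, add_sub_add_left_eq_sub,
    intervalIntegral.integral_interval_sub_left (hsub s hs) (hsub _ ⟨hn0, h2.trans hs.2⟩)]
  refine (intervalIntegral.norm_integral_le_of_norm_le_const_ae (C := C₃) ?_).trans ?_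
  · have h4 : ∀ᵐ τ ∂volume.restrict (Set.Ioc (i * (T / N)) s), ∀ x,
        ‖thetaVelocity T N θ B Y τ x‖ ≤ C₃ :=
      (restrict_absolutelyContinuous_timeMeasure (T := T) hn0 hs.2).ae_le
      (norm_thetaVelocity_le (N := N) (Y := Y) hθ hb)
    rw [ae_restrict_iff' measurableSet_Ioc] at h4
    filter_upwards [h4] with τ hτ hτ'
    rw [Set.uIoc_of_le h2] at hτ'
    exact hτ hτ' x
  · rw [abs_of_nonneg (by linarith)]
    gcongr
    linarith

/-- Freezing the position at the left node costs `θ (B(Y_{i+1}) - B(Y_i))`, at most the Lipschitz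
constant times one step. For `ℓ = C₁ h^(-1/2)` this truncation error is of order `√h`. -/
theorem IsThetaScheme.norm_velocity_sub_le (hT : 0 < T) (hN : 0 < N)
    (hθ : θ ∈ Set.Icc (0 : ℝ) 1) (hl : ∀ᵐ s ∂timeMeasure T, LipschitzWith ℓ (B s))
    (hb : ∀ᵐ s ∂timeMeasure T, ∀ x, ‖B s x‖ ≤ C₃) (hY : IsThetaScheme T N θ B Y) :
    ∀ᵐ τ ∂timeMeasure T, ∀ x,
      ‖thetaVelocity T N θ B Y τ x - B τ (Y (gridIndex T N τ) x)‖ ≤ ℓ * (C₃ * (T / N)) := by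
  filter_upwards [hl, ae_timeMeasure_mem T] with τ hτ hmem x
  have h1 := (gridIndex_spec hT hN ⟨hmem.1.le, hmem.2.le⟩).1
  set i := gridIndex T N τ with hi
  have e : thetaVelocity T N θ B Y τ x - B τ (Y i x) =
      θ • (B τ (Y (i + 1) x) - B τ (Y i x)) := by
    rw [thetaVelocity, ← hi, smul_sub, sub_smul, one_smul]; abel
  rw [e, norm_smul, Real.norm_of_nonneg hθ.1]
  have h2 : ‖B τ (Y (i + 1) x) - B τ (Y i x)‖ ≤ ℓ * (C₃ * (T / N)) := by
    rw [← dist_eq_norm]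
    refine (hτ.dist_le_mul _ _).trans ?_
    rw [dist_eq_norm]
    gcongr
    exact hY.norm_step_le hT hθ hb h1 x
  calc θ * ‖B τ (Y (i + 1) x) - B τ (Y i x)‖ ≤ 1 * (ℓ * (C₃ * (T / N))) := by
        gcongr
        exact hθ.2
    _ = _ := one_mul _

theorem gridIndex_fraction_mem (hT : 0 < T) (hN : 0 < N) {s : ℝ} (hs : s ∈ Set.Icc 0 T) :
    (s - gridIndex T N s * (T / N)) / (T / N) ∈ Set.Icc (0 : ℝ) 1 := by
  have hNr : (0 : ℝ) < N := by exact_mod_cast hN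
  have hh : 0 < T / N := by positivity
  obtain ⟨-, h2, h3⟩ := gridIndex_spec hT hN hs
  refine ⟨div_nonneg (by linarith) hh.le, ?_⟩
  rw [div_le_one hh]
  linarith

theorem IsThetaScheme.norm_thetaInterp_sub_le (hT : 0 < T) (hN : 0 < N)
    (hθ : θ ∈ Set.Icc (0 : ℝ) 1) (hb : ∀ᵐ s ∂timeMeasure T, ∀ x, ‖B s x‖ ≤ C₃)
    (hY : IsThetaScheme T N θ B Y) {s : ℝ} (hs : s ∈ Set.Icc 0 T) (x : Sp d) :
    ‖thetaInterp T N Y s x - Y (gridIndex T N s) x‖ ≤ C₃ * (T / N) := by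
  have h1 := gridIndex_fraction_mem hT hN hs
  rw [thetaInterp_eq, add_sub_cancel_left, norm_smul, Real.norm_of_nonneg h1.1]
  have h2 := hY.norm_step_le hT hθ hb (gridIndex_spec hT hN hs).1 x
  calc _ ≤ 1 * (C₃ * (T / N)) := by
        gcongr
        exact h1.2
    _ = _ := one_mul _

end Scheme

/-! ### Deviation of the scheme from the flow. -/

/-- Comparison of the `θ`-method for a field `B` with a regular Lagrangian flow of a Sobolev field:
the logarithmic functional of the distance is controlled by the truncation error, by the distance
of the two fields, and by the gradient of the Sobolev field. -/
theorem exists_log_deviation_estimate (d : ℕ) (p : ℝ≥0∞) (hp : 1 < p) (hp' : p < ⊤) :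
    ∃ C : ℝ≥0, ∀ {T : ℝ}, 0 < T → ∀ {N : ℕ}, 0 < N → ∀ θ ∈ Set.Icc (0 : ℝ) 1,
      ∀ {ℓ : ℝ≥0} {C₃ : ℝ}, 0 ≤ C₃ → ∀ {B : ℝ → Sp d → Sp d} {Y : ℕ → Sp d → Sp d},
      AEStronglyMeasurable (Function.uncurry B) ((timeMeasure T).prod volume) →
      (∀ᵐ s ∂timeMeasure T, LipschitzWith ℓ (B s)) →
      (∀ᵐ s ∂timeMeasure T, ∀ x, ‖B s x‖ ≤ C₃) →
      IsThetaScheme T N θ B Y → ∀ {L : ℝ≥0}, (∀ i ≤ N, Compresses L (Y i)) →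
      ∀ {t : ℝ}, t ≤ T → ∀ {c : ℝ → Sp d → Sp d} {Dc : ℝ → Sp d → (Sp d →L[ℝ] Sp d)},
      AEStronglyMeasurable (Function.uncurry c) ((timeMeasure t).prod volume) →
      (∀ᵐ s ∂timeMeasure t, MemLp (c s) p volume ∧ MemLp (Dc s) p volume ∧
        HasWeakGradient (c s) (Dc s)) →
      ∀ {Z Z' : ℝ → Sp d → Sp d}, IsRegularLagrangianFlow t c Z →
      Measurable (Function.uncurry Z') → (∀ᵐ τ ∂timeMeasure t, Compresses L (Z' τ)) →
      (∀ᵐ x, ∀ s ∈ Set.Icc 0 t, Z' s x = Z s x) →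
      ∀ {δ : ℝ}, T / N ≤ δ → ∀ {U : Set (Sp d)}, volume U ≠ ⊤ → ∀ s ∈ Set.Icc 0 t,
      ∫⁻ x in U, ENNReal.ofReal (Real.log (1 +
          max (‖Y (gridIndex T N s) x - Z' s x‖ - C₃ * (T / N)) 0 / δ)) ≤
        (ENNReal.ofReal (ℓ * (C₃ * (T / N))) * volume U * ENNReal.ofReal T +
          L * ∫⁻ τ, (∫⁻ x, ‖B τ x - c τ x‖ₑ) ∂timeMeasure t) / ENNReal.ofReal δ +
        C * (1 + C₃.toNNReal : ℝ≥0) * (L : ℝ≥0∞) ^ (1 / p.toReal) *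
          volume U ^ (1 - 1 / p.toReal) * ∫⁻ τ, eLpNorm (Dc τ) p volume ∂timeMeasure t := by
  obtain ⟨C, hC⟩ := exists_log_estimate d p hp hp'
  refine ⟨C, fun {T} hT {N} hN θ hθ {ℓ} {C₃} hC₃ {B} {Y} hm hl hb hY {L} hYL {t} htT {c} {Dc} hcm hcg
    {Z} {Z'} hZ hZm hZL hZZ {δ} hδ {U} hU s hs => ?_⟩
  have hNr : (0 : ℝ) < N := by exact_mod_cast hN
  have hh : 0 < T / N := by positivity
  have hδ0 : 0 < δ := hh.trans_le hδ
  have hle := timeMeasure_mono htT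
  have hIcc : ∀ {r}, r ∈ Set.Icc 0 t → r ∈ Set.Icc 0 T := fun hr => ⟨hr.1, hr.2.trans htT⟩
  have ht0 : 0 ≤ t := hs.1.trans hs.2
  set J : ℝ → Sp d → Sp d := fun τ x => Y (gridIndex T N τ) x with hJ
  have hJm : Measurable (Function.uncurry J) :=
    measurable_comp_gridIndex fun i hi => (hYL i hi).measurable
  have hJL : ∀ᵐ τ ∂timeMeasure t, Compresses L (J τ) := by
    filter_upwards [ae_timeMeasure_mem t] with τ hτ
    exact hYL _ (gridIndex_spec hT hN (hIcc ⟨hτ.1.le, hτ.2.le⟩)).1.le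
  set w : ℝ → Sp d → Sp d := fun τ x => thetaVelocity T N θ B Y τ x - c τ (Z τ x) with hw
  set D : ℝ → Sp d → Sp d := fun r x => ∫ τ in (0 : ℝ)..r, w τ x with hD
  set e : ℝ → Sp d → ℝ≥0∞ := fun τ x =>
    ENNReal.ofReal (ℓ * (C₃ * (T / N))) + ‖B τ (J τ x) - c τ (J τ x)‖ₑ with he
  have hvel : ∀ x, ∀ r ∈ Set.Icc 0 t,
      IntervalIntegrable (fun τ => thetaVelocity T N θ B Y τ x) volume 0 r := fun x r hr =>
    (hY.intervalIntegrable_velocity hT hN hm hl hb x).mono_set (by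
      rw [Set.uIcc_of_le hT.le, Set.uIcc_of_le hr.1]
      exact Set.Icc_subset_Icc_right (hr.2.trans htT))
  have hdiff : AEStronglyMeasurable (fun z : ℝ × Sp d => B z.1 z.2 - c z.1 z.2)
      ((timeMeasure t).prod volume) := (aestronglyMeasurable_mono_time hm htT).sub hcm
  have hem : AEMeasurable (Function.uncurry e) ((timeMeasure t).prod volume) :=
    ((hdiff.comp_quasiMeasurePreserving (quasiMeasurePreserving_graph hJm hJL)).enorm).const_add _
  -- the error between the continuous interpolation and the flow
  have hDeq : ∀ᵐ x, ∀ r ∈ Set.Icc 0 t, ‖J r x - Z' r x‖ ≤ C₃ * (T / N) + ‖D r x‖ := by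
    filter_upwards [hZ.ode, hZZ] with x hx hx' r hr
    have hcr : IntervalIntegrable (fun τ => c τ (Z τ x)) volume 0 r := hx.1.mono_set (by
      rw [Set.uIcc_of_le ht0, Set.uIcc_of_le hr.1]; exact Set.Icc_subset_Icc_right hr.2)
    have e1 : D r x = (x + ∫ τ in (0 : ℝ)..r, thetaVelocity T N θ B Y τ x) - Z' r x := by
      rw [hx' r hr, hx.2 r hr, add_sub_add_left_eq_sub]
      exact intervalIntegral.integral_sub (hvel x r hr) hcr
    have h1 := hY.norm_continuousInterp_sub_le hT hN hθ hm hl hb hC₃ (hIcc hr) x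
    rw [norm_sub_rev] at h1
    have e2 : J r x - Z' r x = (J r x - (x + ∫ τ in (0 : ℝ)..r, thetaVelocity T N θ B Y τ x)) +
        D r x := by rw [e1]; abel
    rw [e2]
    exact (norm_add_le _ _).trans (by gcongr)
  -- The slack `1 + C₃` comes from `‖J - Z'‖ ≤ C₃ h + ‖D‖` together with `h ≤ δ`.
  have hmain := hC t c Dc hcm hcg L J Z' hJm hZm hJL hZL e hem δ (1 + C₃.toNNReal) hδ0 D w
    (by
      filter_upwards [hZ.ode] with x hx
      exact ⟨(hvel x t ⟨ht0, le_rfl⟩).sub hx.1, fun _ _ => rfl⟩)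
    (by
      filter_upwards [hZZ] with x hx
      filter_upwards [ae_timeMeasure_mem t,
        ae_mono hle (hY.norm_velocity_sub_le hT hN hθ hl hb)] with τ hτ h1
      have e1 : w τ x = (thetaVelocity T N θ B Y τ x - B τ (J τ x)) +
          (B τ (J τ x) - c τ (J τ x)) + (c τ (J τ x) - c τ (Z' τ x)) := by
        rw [hx τ ⟨hτ.1.le, hτ.2.le⟩]
        simp only [hw]
        abel
      rw [e1]
      refine (enorm_add_le _ _).trans ?_
      gcongr
      refine (enorm_add_le _ _).trans ?_
      simp only [he]
      gcongr
      rw [← ofReal_norm]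
      exact ENNReal.ofReal_le_ofReal (h1 x))
    (by
      filter_upwards [hDeq] with x hx
      filter_upwards [ae_timeMeasure_mem t] with τ hτ
      refine (hx τ ⟨hτ.1.le, hτ.2.le⟩).trans ?_
      push_cast
      rw [Real.coe_toNNReal _ hC₃]
      nlinarith [norm_nonneg (D τ x), mul_le_mul_of_nonneg_left hδ hC₃,
        mul_nonneg hC₃ (norm_nonneg (D τ x))])
    U hU s hs
  calc _ ≤ ∫⁻ x in U, ENNReal.ofReal (Real.log (1 + ‖D s x‖ / δ)) := by
        refine lintegral_mono_ae (ae_restrict_of_ae ?_)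
        filter_upwards [hDeq] with x hx
        have h1 : max (‖Y (gridIndex T N s) x - Z' s x‖ - C₃ * (T / N)) 0 ≤ ‖D s x‖ :=
          max_le (by linarith [hx s hs]) (norm_nonneg _)
        have h0 : 0 ≤ max (‖Y (gridIndex T N s) x - Z' s x‖ - C₃ * (T / N)) 0 := le_max_right _ _
        refine ENNReal.ofReal_le_ofReal (Real.log_le_log (by positivity) ?_)
        gcongr
    _ ≤ _ := hmain
    _ ≤ _ := by
        gcongr
        calc ∫⁻ τ, ∫⁻ x in U, e τ x ∂volume ∂timeMeasure t
            ≤ ∫⁻ τ, (ENNReal.ofReal (ℓ * (C₃ * (T / N))) * volume U +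
                L * ∫⁻ x, ‖B τ x - c τ x‖ₑ) ∂timeMeasure t := by
              refine lintegral_mono_ae ?_
              filter_upwards [hJL, hdiff.prodMk_left] with τ h1 h2
              rw [he, lintegral_add_left measurable_const, setLIntegral_const]
              gcongr
              exact (setLIntegral_le_lintegral _ _).trans (h1.lintegral_comp_le h2.enorm)
          _ ≤ _ := by
              rw [lintegral_add_left measurable_const, lintegral_const,
                lintegral_const_mul' _ _ ENNReal.coe_ne_top]
              gcongr
              refine (hle _).trans ?_
              simp [timeMeasure]

/-- The logarithm gained from the choice `δ = h ^ γ` for deviations of size `h ^ (γ / 2)`. -/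
theorem mul_abs_log_le_log_one_add {h γ : ℝ} (h0 : 0 < h) (h1 : h ≤ 1) :
    γ / 2 * |Real.log h| ≤ Real.log (1 + h ^ (γ / 2) / h ^ γ) := by
  have e : h ^ (γ / 2) / h ^ γ = h ^ (-(γ / 2)) := by
    rw [← Real.rpow_sub h0]; congr 1; ring
  rw [e, abs_of_nonpos (Real.log_nonpos h0.le h1)]
  have h2 : Real.log (h ^ (-(γ / 2))) = γ / 2 * -Real.log h := by rw [Real.log_rpow h0]; ring
  rw [← h2]
  exact Real.log_le_log (Real.rpow_pos_of_pos h0 _) (by linarith)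

/-- A `θ`-method with step `h` and a regular Lagrangian flow deviate by more than a power of `h`
only on a set of measure `O(1 / |log h|)`. -/
theorem exists_measure_deviation_le (d : ℕ) (p : ℝ≥0∞) (hp : 1 < p) (hp' : p < ⊤) {T : ℝ}
    (hT : 0 < T) {G C₀ C₁ C₃ κ γ : ℝ} (hC₁ : 0 < C₁) (hC₃ : 0 < C₃)
    (hγ : 0 < γ) (hγ' : γ ≤ 1 / 2) (hκ : γ ≤ κ) (L : ℝ≥0) {V : ℝ≥0∞} (hV : V ≠ ⊤) :
    ∃ K : ℝ, 0 ≤ K ∧ ∀ {N : ℕ}, 0 < N → T / N < 1 → ∀ θ ∈ Set.Icc (0 : ℝ) 1,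
      ∀ {B : ℝ → Sp d → Sp d} {Y : ℕ → Sp d → Sp d},
      AEStronglyMeasurable (Function.uncurry B) ((timeMeasure T).prod volume) →
      (∀ᵐ s ∂timeMeasure T, LipschitzWith (Real.toNNReal (C₁ / √(T / N))) (B s)) →
      (∀ᵐ s ∂timeMeasure T, ∀ x, ‖B s x‖ ≤ C₃) →
      IsThetaScheme T N θ B Y → (∀ i ≤ N, Compresses L (Y i)) →
      ∀ {t : ℝ}, t ≤ T → ∀ {c : ℝ → Sp d → Sp d} {Dc : ℝ → Sp d → (Sp d →L[ℝ] Sp d)},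
      AEStronglyMeasurable (Function.uncurry c) ((timeMeasure t).prod volume) →
      (∀ᵐ s ∂timeMeasure t, MemLp (c s) p volume ∧ MemLp (Dc s) p volume ∧
        HasWeakGradient (c s) (Dc s)) →
      ∫⁻ τ, eLpNorm (Dc τ) p volume ∂timeMeasure t ≤ ENNReal.ofReal G →
      ∫⁻ τ, (∫⁻ x, ‖B τ x - c τ x‖ₑ) ∂timeMeasure t ≤ ENNReal.ofReal (C₀ * (T / N) ^ κ) →
      ∀ {Z Z' : ℝ → Sp d → Sp d}, IsRegularLagrangianFlow t c Z →
      Measurable (Function.uncurry Z') → (∀ᵐ τ ∂timeMeasure t, Compresses L (Z' τ)) →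
      (∀ᵐ x, ∀ s ∈ Set.Icc 0 t, Z' s x = Z s x) →
      ∀ {U : Set (Sp d)}, volume U ≤ V → ∀ s ∈ Set.Icc 0 t,
      volume (U ∩ {x | (T / N) ^ (γ / 2) + C₃ * (T / N) ≤
        ‖Y (gridIndex T N s) x - Z' s x‖}) ≤ ENNReal.ofReal (K / |Real.log (T / N)|) := by
  obtain ⟨C, hC⟩ := exists_log_deviation_estimate d p hp hp'
  have hp1 : 1 ≤ p.toReal := by
    rw [← ENNReal.toReal_one]
    exact (ENNReal.toReal_le_toReal ENNReal.one_ne_top hp'.ne).2 hp.le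
  have hp2 : 0 ≤ 1 - 1 / p.toReal := by
    rw [sub_nonneg, div_le_one (by linarith)]; exact hp1
  -- `A` bounds the logarithmic functional for `δ = h^γ` uniformly in `h`: the truncation error
  -- `C₁C₃√h` is absorbed since `γ ≤ 1/2`, the distance `C₀h^κ` of the fields since `γ ≤ κ`.
  set A : ℝ≥0∞ := (ENNReal.ofReal (C₁ * C₃) * V * ENNReal.ofReal T +
      L * ENNReal.ofReal C₀) + C * (1 + C₃.toNNReal : ℝ≥0) * (L : ℝ≥0∞) ^ (1 / p.toReal) *
        V ^ (1 - 1 / p.toReal) * ENNReal.ofReal G with hA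
  have hAt : A ≠ ⊤ := by
    have h1 : (L : ℝ≥0∞) ^ (1 / p.toReal) ≠ ⊤ :=
      ENNReal.rpow_ne_top_of_nonneg (by positivity) ENNReal.coe_ne_top
    have h2 : V ^ (1 - 1 / p.toReal) ≠ ⊤ := ENNReal.rpow_ne_top_of_nonneg hp2 hV
    finiteness
  refine ⟨2 * A.toReal / γ, by positivity, fun {N} hN hN1 θ hθ {B} {Y} hm hl hb hY hYL {t} htT
    {c} {Dc} hcm hcg hcG hcB {Z} {Z'} hZ hZm hZL hZZ {U} hUV s hs => ?_⟩
  have hNr : (0 : ℝ) < N := by exact_mod_cast hN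
  have hh : 0 < T / N := by positivity
  set h := T / N with hdef
  have hpow : ∀ r, γ ≤ r → h ^ r ≤ h ^ γ := fun r hr =>
    Real.rpow_le_rpow_of_exponent_ge hh hN1.le hr
  have hδ : h ≤ h ^ γ := by
    simpa using hpow 1 (by linarith)
  have hδ0 : 0 < h ^ γ := Real.rpow_pos_of_pos hh _
  have key := hC hT hN θ hθ hC₃.le hm hl hb hY hYL htT hcm hcg hZ hZm hZL hZZ hδ (ne_top_of_le_ne_top hV hUV) s hs
  have hA' : (ENNReal.ofReal ((C₁ / √h).toNNReal * (C₃ * h)) * volume U * ENNReal.ofReal T +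
          L * ∫⁻ τ, (∫⁻ x, ‖B τ x - c τ x‖ₑ) ∂timeMeasure t) / ENNReal.ofReal (h ^ γ) +
        C * (1 + C₃.toNNReal : ℝ≥0) * (L : ℝ≥0∞) ^ (1 / p.toReal) *
          volume U ^ (1 - 1 / p.toReal) * ∫⁻ τ, eLpNorm (Dc τ) p volume ∂timeMeasure t ≤ A := by
    rw [hA]
    gcongr ?_ + _ * ?_ * ?_
    · refine ENNReal.div_le_of_le_mul' ?_
      have e1 : ((C₁ / √h).toNNReal : ℝ) * (C₃ * h) ≤ h ^ γ * (C₁ * C₃) := by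
        rw [Real.coe_toNNReal _ (by positivity)]
        have e2 : C₁ / √h * (C₃ * h) = C₁ * C₃ * √h := by
          have := Real.mul_self_sqrt hh.le
          field_simp
          rw [sq, this]
        rw [e2, mul_comm, Real.sqrt_eq_rpow]
        exact mul_le_mul_of_nonneg_right (hpow _ hγ') (by positivity)
      have e3 := (ENNReal.ofReal_le_ofReal e1).trans_eq (ENNReal.ofReal_mul hδ0.le)
      have e4 : ENNReal.ofReal (C₀ * h ^ κ) ≤ ENNReal.ofReal (h ^ γ) * ENNReal.ofReal C₀ := by
        rw [ENNReal.ofReal_mul' (Real.rpow_nonneg hh.le _), mul_comm]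
        exact mul_le_mul_left (ENNReal.ofReal_le_ofReal (hpow _ hκ)) _
      calc _ ≤ ENNReal.ofReal (h ^ γ) * ENNReal.ofReal (C₁ * C₃) * V * ENNReal.ofReal T +
            L * (ENNReal.ofReal (h ^ γ) * ENNReal.ofReal C₀) := by
            gcongr
            exact hcB.trans e4
        _ = _ := by ring
    · exact ENNReal.rpow_le_rpow hUV hp2
  have hf : AEMeasurable (fun x => max (‖Y (gridIndex T N s) x - Z' s x‖ - C₃ * h) 0) volume := by
    have h1 : Measurable (Y (gridIndex T N s)) :=
      (hYL _ (gridIndex_spec hT hN ⟨hs.1, hs.2.trans htT⟩).1.le).measurable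
    have h2 : Measurable (Z' s) := hZm.comp measurable_prodMk_left
    exact (((h1.sub h2).norm.sub_const _).max measurable_const).aemeasurable
  have hmk := (ofReal_log_mul_measure_le hf (U := U) (Real.rpow_nonneg hh.le (γ / 2)) hδ0).trans
    (key.trans hA')
  have hlog : 0 < |Real.log h| := abs_pos.2 (Real.log_neg hh hN1).ne
  calc _ ≤ volume (U ∩ {x | h ^ (γ / 2) ≤
        max (‖Y (gridIndex T N s) x - Z' s x‖ - C₃ * h) 0}) := by
        refine measure_mono (Set.inter_subset_inter_right _ fun x hx => ?_)
        exact (le_sub_iff_add_le.2 (show _ ≤ ‖Y (gridIndex T N s) x - Z' s x‖ from hx)).trans (le_max_left _ _)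
    _ ≤ A / ENNReal.ofReal (γ / 2 * |Real.log h|) := by
        rw [ENNReal.le_div_iff_mul_le (Or.inl (by simpa using by positivity))
          (Or.inl ENNReal.ofReal_ne_top), mul_comm]
        refine le_trans ?_ hmk
        gcongr
        exact mul_abs_log_le_log_one_add hh hN1.le
    _ = ENNReal.ofReal (2 * A.toReal / γ / |Real.log h|) := by
        rw [← ENNReal.ofReal_toReal hAt, ← ENNReal.ofReal_div_of_pos (by positivity),
          ENNReal.toReal_ofReal ENNReal.toReal_nonneg]
        congr 1
        field_simp

/-! ### The flow inherits the compression constant of the scheme. -/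

/-- Compression bounds pass to local limits in measure. -/
theorem compresses_of_measure_deviation_le {d : ℕ} {f : Sp d → Sp d} {L : ℝ≥0} (hf : Measurable f)
    (h : ∀ R η ε : ℝ, 0 < η → 0 < ε → ∃ g : Sp d → Sp d, Compresses L g ∧
      volume (Metric.ball 0 R ∩ {x | η ≤ ‖g x - f x‖}) ≤ ENNReal.ofReal ε) :
    Compresses L f := by
  refine ⟨hf, fun A _ => volume_preimage_le_of_isOpen (fun O hO => ?_) A⟩
  obtain ⟨F, hFc, hFO, hFU, hFm⟩ := hO.exists_iUnion_isClosed
  -- A compact subset of `O` has a neighbourhood of some width `η` inside `O`; where `f` lies in it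
  -- and `g` is `η`-close to `f`, also `g` lies in `O`.
  set K : ℕ → Set (Sp d) := fun n => F n ∩ Metric.closedBall 0 n with hK
  have hKc : ∀ n, IsCompact (K n) := fun n =>
    (isCompact_closedBall (0 : Sp d) n).inter_left (hFc n)
  have hsub : f ⁻¹' O ⊆ ⋃ n : ℕ, Metric.ball 0 (n : ℝ) ∩ f ⁻¹' K n := by
    intro x hx
    have hx' : f x ∈ ⋃ n, F n := by rw [hFU]; exact hx
    obtain ⟨m, hm⟩ := Set.mem_iUnion.1 hx'
    obtain ⟨k, hk⟩ := exists_nat_gt (max ‖x‖ ‖f x‖)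
    refine Set.mem_iUnion.2 ⟨max m k, ?_, hFm (le_max_left m k) hm, ?_⟩
    · rw [mem_ball_zero_iff]
      exact ((le_max_left _ _).trans_lt hk).trans_le (by exact_mod_cast le_max_right m k)
    · rw [mem_closedBall_zero_iff]
      exact ((le_max_right _ _).trans hk.le).trans (by exact_mod_cast le_max_right m k)
  have hmono : Monotone fun n : ℕ => Metric.ball (0 : Sp d) (n : ℝ) ∩ f ⁻¹' K n := by
    intro m n hmn
    have hmn' : (m : ℝ) ≤ n := by exact_mod_cast hmn
    exact Set.inter_subset_inter (Metric.ball_subset_ball hmn') (Set.preimage_mono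
      (Set.inter_subset_inter (hFm hmn) (Metric.closedBall_subset_closedBall hmn')))
  refine (measure_mono hsub).trans ?_
  rw [hmono.measure_iUnion]
  refine iSup_le fun n => ?_
  obtain ⟨η, hη, hη'⟩ := (hKc n).exists_thickening_subset_open hO
    (Set.inter_subset_left.trans (hFO n))
  refine ENNReal.le_of_forall_pos_le_add fun ε hε _ => ?_
  obtain ⟨g, hg, hg'⟩ := h n η ε hη hε
  calc _ ≤ volume (g ⁻¹' O ∪ (Metric.ball 0 (n : ℝ) ∩ {x | η ≤ ‖g x - f x‖})) := by
        refine measure_mono fun x hx => ?_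
        rcases le_or_gt η ‖g x - f x‖ with h1 | h1
        · exact Or.inr ⟨hx.1, h1⟩
        · refine Or.inl (hη' (Metric.mem_thickening_iff.2 ⟨f x, hx.2, ?_⟩))
          rwa [dist_eq_norm]
    _ ≤ _ := by
        refine (measure_union_le _ _).trans (add_le_add (hg.preimage_le _ hO.measurableSet) ?_)
        rwa [ENNReal.ofReal_coe_nnreal] at hg'

/-- The step sizes along which a `θ`-method is run tend to `0`. -/
theorem tendsto_div_natCast_nhdsGT {T : ℝ} (hT : 0 < T) :
    Tendsto (fun N : ℕ => T / N) atTop (𝓝[>] 0) := by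
  refine tendsto_nhdsWithin_iff.2 ⟨tendsto_const_div_atTop_nhds_zero_nat T, ?_⟩
  filter_upwards [eventually_gt_atTop 0] with N hN
  have : (0 : ℝ) < N := by exact_mod_cast hN
  exact div_pos hT this

theorem tendsto_const_div_abs_log (K : ℝ) :
    Tendsto (fun h : ℝ => K / |Real.log h|) (𝓝[>] 0) (𝓝 0) :=
  (tendsto_abs_atBot_atTop.comp Real.tendsto_log_nhdsGT_zero).const_div_atTop K

/-- A regular Lagrangian flow that is approximated by uniformly compressing `θ`-methods compresses
Lebesgue measure by the same factor as they do. -/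
theorem IsRegularLagrangianFlow.compresses_of_thetaScheme {d : ℕ} {p : ℝ≥0∞} (hp : 1 < p)
    (hp' : p < ⊤) {T : ℝ} (hT : 0 < T) {C₀ C₁ C₃ κ : ℝ} (hC₁ : 0 < C₁)
    (hC₃ : 0 < C₃) (hκ : 0 < κ) {L₀ : ℝ≥0} {h₀ : ℝ} (hh₀ : 0 < h₀)
    {θ : ℝ} (hθ : θ ∈ Set.Icc (0 : ℝ) 1) {B : ℕ → ℝ → Sp d → Sp d} {Y : ℕ → ℕ → Sp d → Sp d}
    {t : ℝ} (htT : t ≤ T) {c : ℝ → Sp d → Sp d} {Dc : ℝ → Sp d → (Sp d →L[ℝ] Sp d)}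
    (hcm : AEStronglyMeasurable (Function.uncurry c) ((timeMeasure t).prod volume))
    (hcg : ∀ᵐ s ∂timeMeasure t, MemLp (c s) p volume ∧ MemLp (Dc s) p volume ∧
      HasWeakGradient (c s) (Dc s))
    (hcG : ∫⁻ τ, eLpNorm (Dc τ) p volume ∂timeMeasure t ≠ ⊤)
    (hB : ∀ N : ℕ, 0 < N → T / N ≤ h₀ →
      AEStronglyMeasurable (Function.uncurry (B N)) ((timeMeasure T).prod volume) ∧
      (∀ᵐ s ∂timeMeasure T, LipschitzWith (Real.toNNReal (C₁ / √(T / N))) (B N s)) ∧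
      (∀ᵐ s ∂timeMeasure T, ∀ x, ‖B N s x‖ ≤ C₃) ∧
      ∫⁻ τ, (∫⁻ x, ‖B N τ x - c τ x‖ₑ) ∂timeMeasure t ≤ ENNReal.ofReal (C₀ * (T / N) ^ κ))
    (hY : ∀ N : ℕ, 0 < N → T / N ≤ h₀ →
      IsThetaScheme T N θ (B N) (Y N) ∧ ∀ i ≤ N, Compresses L₀ (Y N i))
    {Z : ℝ → Sp d → Sp d} (hZ : IsRegularLagrangianFlow t c Z) {Z' : ℝ → Sp d → Sp d} {L : ℝ≥0}
    (hZm : Measurable (Function.uncurry Z')) (hZL : ∀ τ, Compresses L (Z' τ))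
    (hZZ : ∀ᵐ x, ∀ s ∈ Set.Icc 0 t, Z' s x = Z s x) :
    ∀ s ∈ Set.Icc 0 t, Compresses L₀ (Z' s) := by
  intro s hs
  refine compresses_of_measure_deviation_le (hZm.comp measurable_prodMk_left) fun R η ε hη hε => ?_
  set γ := min (1 / 2) κ with hγ
  have hγ0 : 0 < γ := lt_min (by norm_num) hκ
  -- The flow's own constant `L` enters only `K`, of which nothing but finiteness matters: as `N →
  -- ∞` the deviation tends to `0`, and the scheme's `L₀` survives.
  obtain ⟨K, hK, hdev⟩ := exists_measure_deviation_le d p hp hp' hT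
    (G := (∫⁻ τ, eLpNorm (Dc τ) p volume ∂timeMeasure t).toReal) (C₀ := C₀) hC₁ hC₃ hγ0
    (min_le_left _ _) (min_le_right _ _) (max L L₀)
    (V := volume (Metric.ball (0 : Sp d) R)) measure_ball_lt_top.ne
  have h1 : Tendsto (fun h : ℝ => h ^ (γ / 2) + C₃ * h) (𝓝[>] 0) (𝓝 0) := by
    have e1 : Tendsto (fun h : ℝ => h ^ (γ / 2)) (𝓝[>] 0) (𝓝 0) := by
      have := (Real.continuousAt_rpow_const 0 (γ / 2) (Or.inr (by positivity))).tendsto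
      rw [Real.zero_rpow (by positivity)] at this
      exact this.mono_left nhdsWithin_le_nhds
    have e2 : Tendsto (fun h : ℝ => C₃ * h) (𝓝[>] 0) (𝓝 0) := by
      have : Tendsto (fun h : ℝ => C₃ * h) (𝓝 0) (𝓝 (C₃ * 0)) := tendsto_id.const_mul C₃
      rw [mul_zero] at this
      exact this.mono_left nhdsWithin_le_nhds
    simpa using e1.add e2
  have hTN := tendsto_div_natCast_nhdsGT hT
  obtain ⟨N, hN, hN0, hN1, hNη, hNε⟩ := ((eventually_gt_atTop 0).and
    ((hTN.eventually (nhdsWithin_le_nhds (eventually_le_nhds hh₀))).and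
    ((hTN.eventually (nhdsWithin_le_nhds (eventually_lt_nhds one_pos))).and
    (((h1.comp hTN).eventually (eventually_le_nhds hη)).and
    (((tendsto_const_div_abs_log K).comp hTN).eventually (eventually_le_nhds hε)))))).exists
  obtain ⟨b1, b2, b3, b4⟩ := hB N hN hN0
  obtain ⟨y1, y2⟩ := hY N hN hN0
  refine ⟨Y N (gridIndex T N s), y2 _ (gridIndex_spec hT hN ⟨hs.1, hs.2.trans htT⟩).1.le, ?_⟩
  refine (measure_mono (Set.inter_subset_inter_right _ fun x hx => ?_)).trans
    ((hdev hN hN1 θ hθ b1 b2 b3 y1 (fun i hi => (y2 i hi).mono (le_max_right _ _)) htT hcm hcg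
      (ENNReal.ofReal_toReal hcG).ge b4 hZ hZm
      (ae_of_all _ fun τ => (hZL τ).mono (le_max_left _ _)) hZZ le_rfl s hs).trans
      (ENNReal.ofReal_le_ofReal hNε))
  exact hNη.trans hx

/-! ### The error in `L¹`. -/

/-- Two compressing maps that are close in measure transport a Lipschitz function of compact
support to functions that are close in `L¹`. -/
theorem lintegral_enorm_comp_sub_comp_le {d : ℕ} {L : ℝ≥0} {f g : Sp d → Sp d}
    (hf : Compresses L f) (hg : Compresses L g) {v : Sp d → ℝ} {Λ : ℝ≥0} (hv : LipschitzWith Λ v)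
    {S : ℝ} (hS : ∀ x, ‖v x‖ ≤ S) {r : ℝ} {E : ℝ≥0∞}
    (hE : volume ((f ⁻¹' tsupport v ∪ g ⁻¹' tsupport v) ∩ {x | r ≤ ‖f x - g x‖}) ≤ E) :
    ∫⁻ x, ‖v (f x) - v (g x)‖ₑ ≤
      ENNReal.ofReal (Λ * r) * (2 * L * volume (tsupport v)) + ENNReal.ofReal (2 * S) * E := by
  have hKm : MeasurableSet (tsupport v) := (isClosed_tsupport v).measurableSet
  set U := f ⁻¹' tsupport v ∪ g ⁻¹' tsupport v with hU
  have hUm : MeasurableSet U := (hf.measurable hKm).union (hg.measurable hKm)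
  set W := U ∩ {x | r ≤ ‖f x - g x‖} with hW
  have hWm : MeasurableSet W :=
    hUm.inter (measurableSet_le measurable_const (hf.measurable.sub hg.measurable).norm)
  have hUv : volume U ≤ 2 * L * volume (tsupport v) := by
    refine (measure_union_le _ _).trans ?_
    rw [mul_assoc, two_mul]
    exact add_le_add (hf.preimage_le _ hKm) (hg.preimage_le _ hKm)
  -- Off `U` both values vanish; on `U` the Lipschitz bound serves where the maps are close, the
  -- bound `2S` on `W`.
  have hpt : ∀ x, ‖v (f x) - v (g x)‖ₑ ≤ U.indicator (fun _ => ENNReal.ofReal (Λ * r)) x +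
      W.indicator (fun _ => ENNReal.ofReal (2 * S)) x := by
    intro x
    by_cases hx : x ∈ U
    · by_cases hx' : r ≤ ‖f x - g x‖
      · rw [Set.indicator_of_mem (show x ∈ W from ⟨hx, hx'⟩), ← ofReal_norm]
        refine le_trans (ENNReal.ofReal_le_ofReal ?_) le_add_self
        exact (norm_sub_le _ _).trans (by linarith [hS (f x), hS (g x)])
      · rw [Set.indicator_of_mem hx, ← ofReal_norm]
        refine le_trans (ENNReal.ofReal_le_ofReal ?_) le_self_add
        rw [← dist_eq_norm]
        refine (hv.dist_le_mul _ _).trans ?_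
        rw [dist_eq_norm]
        gcongr
        exact (not_le.1 hx').le
    · have h1 : v (f x) = 0 := image_eq_zero_of_notMem_tsupport fun h => hx (Or.inl h)
      have h2 : v (g x) = 0 := image_eq_zero_of_notMem_tsupport fun h => hx (Or.inr h)
      simp [h1, h2]
  calc _ ≤ ∫⁻ x, (U.indicator (fun _ => ENNReal.ofReal (Λ * r)) x +
        W.indicator (fun _ => ENNReal.ofReal (2 * S)) x) := lintegral_mono hpt
    _ = ENNReal.ofReal (Λ * r) * volume U + ENNReal.ofReal (2 * S) * volume W := by
        rw [lintegral_add_left (measurable_const.indicator hUm), lintegral_indicator_const hUm,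
          lintegral_indicator_const hWm]
    _ ≤ _ := by gcongr

/-- Error of the `θ`-method, measured by a smooth function of compact support. -/
theorem exists_lintegral_test_sub_le (d : ℕ) (p : ℝ≥0∞) (hp : 1 < p) (hp' : p < ⊤) {T : ℝ}
    (hT : 0 < T) (G C₀ : ℝ) {C₁ C₃ κ : ℝ} (hC₁ : 0 < C₁) (hC₃ : 0 < C₃) (hκ : 0 < κ)
    (L : ℝ≥0) {v : Sp d → ℝ} (hv : ContDiff ℝ ∞ v) (hvs : HasCompactSupport v) :
    ∃ K : ℝ, 0 ≤ K ∧ ∀ {N : ℕ}, 0 < N → T / N < 1 → ∀ θ ∈ Set.Icc (0 : ℝ) 1,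
      ∀ {B : ℝ → Sp d → Sp d} {Y : ℕ → Sp d → Sp d},
      AEStronglyMeasurable (Function.uncurry B) ((timeMeasure T).prod volume) →
      (∀ᵐ s ∂timeMeasure T, LipschitzWith (Real.toNNReal (C₁ / √(T / N))) (B s)) →
      (∀ᵐ s ∂timeMeasure T, ∀ x, ‖B s x‖ ≤ C₃) →
      IsThetaScheme T N θ B Y → (∀ i ≤ N, Compresses L (Y i)) →
      (∀ s ∈ Set.Icc 0 T, Compresses L (thetaInterp T N Y s)) →
      ∀ {t : ℝ}, t ≤ T → ∀ {c : ℝ → Sp d → Sp d} {Dc : ℝ → Sp d → (Sp d →L[ℝ] Sp d)},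
      AEStronglyMeasurable (Function.uncurry c) ((timeMeasure t).prod volume) →
      (∀ᵐ s ∂timeMeasure t, MemLp (c s) p volume ∧ MemLp (Dc s) p volume ∧
        HasWeakGradient (c s) (Dc s)) →
      ∫⁻ τ, eLpNorm (Dc τ) p volume ∂timeMeasure t ≤ ENNReal.ofReal G →
      ∫⁻ τ, (∫⁻ x, ‖B τ x - c τ x‖ₑ) ∂timeMeasure t ≤ ENNReal.ofReal (C₀ * (T / N) ^ κ) →
      ∀ {Z Z' : ℝ → Sp d → Sp d}, IsRegularLagrangianFlow t c Z →
      Measurable (Function.uncurry Z') → (∀ s ∈ Set.Icc 0 t, Compresses L (Z' s)) →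
      (∀ᵐ x, ∀ s ∈ Set.Icc 0 t, Z' s x = Z s x) → ∀ s ∈ Set.Icc 0 t,
      ∫⁻ x, ‖v (thetaInterp T N Y s x) - v (Z' s x)‖ₑ ≤
        ENNReal.ofReal (K / |Real.log (T / N)|) := by
  set γ := min (1 / 2) κ with hγ
  have hγ0 : 0 < γ := lt_min (by norm_num) hκ
  have hγ1 : γ ≤ 1 / 2 := min_le_left _ _
  set V : ℝ≥0∞ := 2 * L * volume (tsupport v) with hV
  have hVt : V ≠ ⊤ := by
    have : volume (tsupport v) ≠ ⊤ := hvs.isCompact.measure_lt_top.ne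
    finiteness
  obtain ⟨K, hK, hdev⟩ := exists_measure_deviation_le d p hp hp' hT (G := G) (C₀ := C₀) hC₁ hC₃ hγ0
    hγ1 (min_le_right _ _) L hVt
  obtain ⟨Λ, hΛ⟩ := ContDiff.lipschitzWith_of_hasCompactSupport hvs hv (by simp)
  obtain ⟨S, hS⟩ := hvs.exists_bound_of_continuous hv.continuous
  have hS0 : 0 ≤ S := (norm_nonneg _).trans (hS 0)
  refine ⟨Λ * ((1 + 2 * C₃) * (2 / γ)) * V.toReal + 2 * S * K, by positivity,
    fun {N} hN hN1 θ hθ {B} {Y} hm hl hb hY hYL hYI {t} htT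
    {c} {Dc} hcm hcg hcG hcB {Z} {Z'} hZ hZm hZL hZZ s hs => ?_⟩
  have hNr : (0 : ℝ) < N := by exact_mod_cast hN
  have hh : 0 < T / N := by positivity
  have hsT : s ∈ Set.Icc 0 T := ⟨hs.1, hs.2.trans htT⟩
  have hZL' : ∀ᵐ τ ∂timeMeasure t, Compresses L (Z' τ) := by
    filter_upwards [ae_timeMeasure_mem t] with τ hτ using hZL τ ⟨hτ.1.le, hτ.2.le⟩
  have hlog : 0 < |Real.log (T / N)| := abs_pos.2 (Real.log_neg hh hN1).ne
  have hKm : MeasurableSet (tsupport v) := (isClosed_tsupport v).measurableSet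
  have hUV : volume (thetaInterp T N Y s ⁻¹' tsupport v ∪ Z' s ⁻¹' tsupport v) ≤ V := by
    refine (measure_union_le _ _).trans ?_
    rw [hV, mul_assoc, two_mul]
    exact add_le_add ((hYI s hsT).preimage_le _ hKm) ((hZL s hs).preimage_le _ hKm)
  have h1 := hdev hN hN1 θ hθ hm hl hb hY hYL htT hcm hcg hcG hcB hZ hZm hZL' hZZ hUV s hs
  -- One `C₃ h` in `r` is for passing from the interpolant to the left node, the other for the
  -- threshold in the deviation estimate.
  have h2 := lintegral_enorm_comp_sub_comp_le (hYI s hsT) (hZL s hs) hΛ hS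
    (r := (T / N) ^ (γ / 2) + 2 * C₃ * (T / N)) ((measure_mono
      (Set.inter_subset_inter_right _ fun x hx => by
        have h3 := hY.norm_thetaInterp_sub_le hT hN hθ hb hsT x
        have h4 : (T / N) ^ (γ / 2) + 2 * C₃ * (T / N) ≤ ‖thetaInterp T N Y s x - Z' s x‖ := hx
        have h5 := norm_sub_le_norm_sub_add_norm_sub (thetaInterp T N Y s x)
          (Y (gridIndex T N s) x) (Z' s x)
        show (T / N) ^ (γ / 2) + C₃ * (T / N) ≤ ‖Y (gridIndex T N s) x - Z' s x‖
        linarith)).trans h1)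
  refine h2.trans ?_
  have hr : (T / N) ^ (γ / 2) + 2 * C₃ * (T / N) ≤
      (1 + 2 * C₃) * (2 / γ) / |Real.log (T / N)| := by
    have e1 : T / N ≤ (T / N) ^ (γ / 2) := by
      simpa using Real.rpow_le_rpow_of_exponent_ge hh hN1.le (show γ / 2 ≤ 1 by linarith)
    -- A power of `h` is dominated by `1/|log h|`, which is therefore the overall rate.
    have e2 := Real.abs_log_mul_self_rpow_lt (T / N) (γ / 2) hh hN1.le (by positivity)
    rw [abs_mul, abs_of_pos (Real.rpow_pos_of_pos hh _)] at e2
    rw [le_div_iff₀ hlog]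
    have e3 : 1 / (γ / 2) = 2 / γ := by field_simp
    rw [e3] at e2
    calc _ ≤ (1 + 2 * C₃) * (T / N) ^ (γ / 2) * |Real.log (T / N)| := by
          gcongr
          nlinarith
      _ = (1 + 2 * C₃) * (|Real.log (T / N)| * (T / N) ^ (γ / 2)) := by ring
      _ ≤ _ := by gcongr
  calc _ ≤ ENNReal.ofReal (Λ * ((1 + 2 * C₃) * (2 / γ) / |Real.log (T / N)|)) *
        ENNReal.ofReal V.toReal + ENNReal.ofReal (2 * S) *
        ENNReal.ofReal (K / |Real.log (T / N)|) := by
        rw [ENNReal.ofReal_toReal hVt]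
        gcongr
    _ = _ := by
        rw [← ENNReal.ofReal_mul (by positivity), ← ENNReal.ofReal_mul (by positivity),
          ← ENNReal.ofReal_add (by positivity) (by positivity)]
        congr 1
        field_simp

/-- Triangle inequality through `v`; compression lets `v - u` be composed with each of the two maps
at the cost of a factor `L`. -/
theorem lintegral_enorm_comp_sub_comp_le_of_approx {d : ℕ} {L : ℝ≥0} {f g : Sp d → Sp d}
    (hf : Compresses L f) (hg : Compresses L g) {u v : Sp d → ℝ} (hu : Integrable u)
    (hv : Integrable v) :
    ∫⁻ x, ‖u (f x) - u (g x)‖ₑ ≤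
      ENNReal.ofReal (2 * L * ∫ x, |v x - u x|) + ∫⁻ x, ‖v (f x) - v (g x)‖ₑ := by
  have hm : AEMeasurable (fun x => ‖v x - u x‖ₑ) volume :=
    (hv.sub hu).aestronglyMeasurable.enorm
  have hI : ENNReal.ofReal (2 * L * ∫ x, |v x - u x|) = L * (∫⁻ x, ‖v x - u x‖ₑ) +
      L * ∫⁻ x, ‖v x - u x‖ₑ := by
    have h1 := ofReal_integral_norm_eq_lintegral_enorm (hv.sub hu)
    simp only [Real.norm_eq_abs, Pi.sub_apply] at h1
    rw [← h1, mul_assoc, ENNReal.ofReal_mul (by norm_num), ENNReal.ofReal_mul L.coe_nonneg,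
      ENNReal.ofReal_coe_nnreal, ENNReal.ofReal_ofNat, two_mul]
  have hpt : ∀ x, ‖u (f x) - u (g x)‖ₑ ≤
      ‖v (f x) - u (f x)‖ₑ + (‖v (g x) - u (g x)‖ₑ + ‖v (f x) - v (g x)‖ₑ) := by
    intro x
    have e : u (f x) - u (g x) = -(v (f x) - u (f x)) +
        ((v (g x) - u (g x)) + (v (f x) - v (g x))) := by ring
    rw [e]
    refine (enorm_add_le _ _).trans ?_
    rw [enorm_neg]
    gcongr
    exact enorm_add_le _ _
  have hmf : AEMeasurable (fun x => ‖v (f x) - u (f x)‖ₑ) volume :=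
    hm.comp_quasiMeasurePreserving hf.quasiMeasurePreserving
  have hmg : AEMeasurable (fun x => ‖v (g x) - u (g x)‖ₑ) volume :=
    hm.comp_quasiMeasurePreserving hg.quasiMeasurePreserving
  refine (lintegral_mono hpt).trans ?_
  rw [lintegral_add_left' hmf, lintegral_add_left' hmg, hI, ← add_assoc]
  gcongr
  · exact hf.lintegral_comp_le hm
  · exact hg.lintegral_comp_le hm

/-- The properties of the member of an approximating sequence that a scheme with step `h` uses,
in terms of `h`. -/
theorem IsApproximatingSequence.of_step {d : ℕ} {T : ℝ} {b : ℝ → Sp d → Sp d}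
    {bε : ℝ → ℝ → Sp d → Sp d} {C₀ C₁ C₂ C₃ α β : ℝ}
    (H : IsApproximatingSequence T b bε C₀ C₁ C₂ C₃ α β) (hβ : 0 < β) {h : ℝ} (h0 : 0 < h)
    (h1 : h ≤ 1) :
    AEStronglyMeasurable (Function.uncurry (bε (h ^ (1 / (2 * β))))) ((timeMeasure T).prod volume) ∧
    (∀ᵐ s ∂timeMeasure T,
      LipschitzWith (Real.toNNReal (C₁ / √h)) (bε (h ^ (1 / (2 * β))) s)) ∧
    (∀ᵐ s ∂timeMeasure T, ∀ᵐ x : Sp d,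
      |traceDiv (fderiv ℝ (bε (h ^ (1 / (2 * β))) s) x)| ≤ C₂) ∧
    (∀ᵐ s ∂timeMeasure T, ∀ x, ‖bε (h ^ (1 / (2 * β))) s x‖ ≤ C₃) ∧
    ∫⁻ s, (∫⁻ x : Sp d, ‖bε (h ^ (1 / (2 * β))) s x - b s x‖ₑ) ∂timeMeasure T ≤
      ENNReal.ofReal (C₀ * h ^ (α / (2 * β))) := by
  have hε : h ^ (1 / (2 * β)) ∈ Set.Ioc (0 : ℝ) 1 :=
    ⟨Real.rpow_pos_of_pos h0 _, Real.rpow_le_one h0.le h1 (by positivity)⟩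
  -- This balance is the reason for `ε = h^(1/(2β))`: the Lipschitz constant becomes `C₁/√h`.
  have e1 : (h ^ (1 / (2 * β))) ^ β = √h := by
    rw [← Real.rpow_mul h0.le, Real.sqrt_eq_rpow]
    congr 1
    field_simp
  have e2 : (h ^ (1 / (2 * β))) ^ α = h ^ (α / (2 * β)) := by
    rw [← Real.rpow_mul h0.le]
    congr 1
    field_simp
  refine ⟨H.meas _ hε, ?_, H.div _ hε, H.bound _ hε, ?_⟩
  · have := H.grad _ hε
    rwa [e1] at this
  · have := H.approx _ hε
    rwa [e2] at this

/-- Convergence from error bounds that hold for all smooth approximations of the datum. -/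
theorem tendsto_zero_of_forall_test_le {d : ℕ} {T : ℝ} (hT : 0 < T) {C h₀ : ℝ} (hC : 0 < C)
    (hh₀ : 0 < h₀) {K : (Sp d → ℝ) → ℝ} {u : Sp d → ℝ} (hu : Integrable u) {E : ℕ → ℝ≥0∞}
    (hE : ∀ N : ℕ, 0 < N → T / N ≤ h₀ → ∀ v : Sp d → ℝ, ContDiff ℝ ∞ v → HasCompactSupport v →
      E N ≤ ENNReal.ofReal (C * ((∫ x, |v x - u x|) + K v / |Real.log (T / N)|))) :
    Tendsto E atTop (𝓝 0) := by
  rw [ENNReal.tendsto_nhds_zero]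
  intro ε hε
  obtain ⟨η, hη0, hηε⟩ := ENNReal.lt_iff_exists_nnreal_btwn.1 hε
  have hη : 0 < (η : ℝ) := by exact_mod_cast hη0
  -- The approximation `v` is fixed before `N` grows, because `K v` is not controlled as `v`
  -- approaches `u`.
  obtain ⟨v, hvs, hv, hvu⟩ := MemLp.exist_eLpNorm_sub_le ENNReal.one_ne_top le_rfl
    (memLp_one_iff_integrable.2 hu) (ε := η / (2 * C)) (by positivity)
  have hvi : Integrable v volume := hv.continuous.integrable_of_hasCompactSupport hvs
  have h1 : ∫ x, |v x - u x| ≤ η / (2 * C) := by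
    rw [eLpNorm_one_eq_lintegral_enorm, ← ofReal_integral_norm_eq_lintegral_enorm (hu.sub hvi),
      ENNReal.ofReal_le_ofReal_iff (by positivity)] at hvu
    refine le_trans (le_of_eq ?_) hvu
    refine integral_congr_ae (ae_of_all _ fun x => ?_)
    simp [abs_sub_comm]
  have hTN := tendsto_div_natCast_nhdsGT hT
  have h2 : (0 : ℝ) < η / (2 * C) := by positivity
  filter_upwards [eventually_gt_atTop 0,
    hTN.eventually (nhdsWithin_le_nhds (eventually_le_nhds hh₀)),
    ((tendsto_const_div_abs_log (K v)).comp hTN).eventually (eventually_le_nhds h2)]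
    with N hN hN0 hNK
  refine (hE N hN hN0 v hv hvs).trans (le_trans ?_ hηε.le)
  rw [← ENNReal.ofReal_coe_nnreal]
  refine ENNReal.ofReal_le_ofReal ?_
  have h3 : K v / |Real.log (T / N)| ≤ η / (2 * C) := hNK
  calc _ ≤ C * (η / (2 * C) + η / (2 * C)) := by gcongr
    _ = η := by field_simp; ring

end

/-! ### Assembly of the theorem. -/

theorem theoremB (d : ℕ) (p : ℝ≥0∞) (hp : 1 < p) (hp' : p < ⊤) (T : ℝ) (hT : 0 < T)
    (M G C₁ C₂ : ℝ) (hM : 0 ≤ M) (hG : 0 ≤ G) (hC₁ : 0 < C₁) (hC₂ : 0 < C₂) :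
    -- `C` and the threshold `h₀` depend only on `d, p, T, M, G, C₁, C₂`
    ∃ C h₀ : ℝ, 0 < C ∧ 0 < h₀ ∧ h₀ < 1 ∧
    ∀ C₀ C₃ α β : ℝ, 0 < C₀ → 0 < C₃ → 0 < α → 0 < β →
    -- `K v` is the constant `C_δ` belonging to the smooth approximation `v = u₀^δ`
    ∃ K : (Sp d → ℝ) → ℝ,
    ∀ (b : ℝ → Sp d → Sp d) (Db : ℝ → Sp d → (Sp d →L[ℝ] Sp d)),
      MemL1W1p T p b Db →
      (∀ᵐ t ∂timeMeasure T, ∀ᵐ x : Sp d, ‖b t x‖ ≤ M) →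
      ∫⁻ t, eLpNorm (Db t) p volume ∂timeMeasure T ≤ ENNReal.ofReal G →
      (∀ᵐ t ∂timeMeasure T, ∀ᵐ x : Sp d, traceDiv (Db t x) = 0) →
    -- the backward regular Lagrangian flow, and approximations `bε ε t` of the backward fields
    ∀ Y : ℝ → ℝ → Sp d → Sp d,
      (∀ t ∈ Set.Icc 0 T, IsRegularLagrangianFlow t (backwardField b t) (Y t)) →
    ∀ bε : ℝ → ℝ → ℝ → Sp d → Sp d,
      (∀ t ∈ Set.Icc 0 T, IsApproximatingSequence T (backwardField b t) (fun ε => bε ε t)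
        C₀ C₁ C₂ C₃ α β) →
    ∀ θ ∈ Set.Icc (0 : ℝ) 1,
    -- `Yθ N t i x` is the `i`-th iterate with step `h = T/N` and `ε = h^(1/(2β))`
    ∀ Yθ : ℕ → ℝ → ℕ → Sp d → Sp d,
      (∀ N : ℕ, 0 < N → T / N ≤ h₀ → ∀ t ∈ Set.Icc 0 T,
        IsThetaScheme T N θ (bε ((T / N) ^ (1 / (2 * β))) t) (Yθ N t)) →
    ∀ u₀ : Sp d → ℝ, Integrable u₀ volume →
    ∀ uL : ℝ → Sp d → ℝ, IsLagrangianSolution T b u₀ uL →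
      (∀ t ∈ Set.Icc 0 T, Integrable (uL t) volume ∧ ∀ᵐ x : Sp d, uL t x = u₀ (Y t t x)) ∧
      (∀ N : ℕ, 0 < N → T / N ≤ h₀ →
        (∀ t ∈ Set.Icc 0 T, Integrable (numericalSolution T N (Yθ N) u₀ t) volume) ∧
        ∀ v : Sp d → ℝ, ContDiff ℝ ∞ v → HasCompactSupport v →
          ⨆ t ∈ Set.Icc 0 T, eLpNorm (numericalSolution T N (Yθ N) u₀ t - uL t) 1 volume ≤
            ENNReal.ofReal
              (C * ((∫ x, |v x - u₀ x|) + K v / |Real.log (T / N)|))) ∧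
      Tendsto (fun N : ℕ => ⨆ t ∈ Set.Icc 0 T,
          eLpNorm (numericalSolution T N (Yθ N) u₀ t - uL t) 1 volume) atTop (𝓝 0) := by
  obtain ⟨L, h₀, hh₀, hh₁, hcomp⟩ := exists_thetaScheme_compression d T C₁ C₂ hT hC₁ hC₂
  -- `2L` pays for replacing `u₀` by `v` under both maps; the `1` ensures that `C` covers the `K v`
  -- term and is positive.
  refine ⟨2 * L + 1, h₀, by positivity, hh₀, hh₁, fun C₀ C₃ α β _ hC₃ hα hβ => ?_⟩
  have hκ : 0 < α / (2 * β) := by positivity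
  have htest := fun (v : Sp d → ℝ) (hv : ContDiff ℝ ∞ v ∧ HasCompactSupport v) =>
    exists_lintegral_test_sub_le d p hp hp' hT G C₀ hC₁ hC₃ hκ L hv.1 hv.2
  -- `K` is selected as a function of `v` before the field, the scheme and the datum are introduced,
  -- which is the required uniformity of `C_δ`.
  choose! K hK0 hK using htest
  refine ⟨K, fun b Db hb _ hbG _ Y hY bε hbε θ hθ Yθ hYθ u₀ hu₀ uL huL => ?_⟩
  have hstep : ∀ N : ℕ, 0 < N → 0 < T / N := fun N hN => by
    have : (0 : ℝ) < N := by exact_mod_cast hN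
    positivity
  have hB := fun (N : ℕ) (hN : 0 < N) (hN0 : T / N ≤ h₀) (t : ℝ) (ht : t ∈ Set.Icc 0 T) =>
    (hbε t ht).of_step hβ (hstep N hN) (hN0.trans hh₁.le)
  have hYc : ∀ N : ℕ, 0 < N → T / N ≤ h₀ → ∀ t ∈ Set.Icc 0 T,
      (∀ i ≤ N, Compresses L (Yθ N t i)) ∧
      ∀ s ∈ Set.Icc 0 T, Compresses L (thetaInterp T N (Yθ N t) s) := by
    intro N hN hN0 t ht
    obtain ⟨h1, h2, h3, h4, -⟩ := hB N hN hN0 t ht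
    obtain ⟨h5, h6⟩ := hcomp N hN hN0 θ hθ C₃ _ _ h1 h2 h3 h4 (hYθ N hN hN0 t ht)
    exact ⟨h5, fun s hs => h6 _ (gridIndex_spec hT hN hs).1 _ (gridIndex_fraction_mem hT hN hs)⟩
  have hBt : ∀ N : ℕ, 0 < N → T / N ≤ h₀ → ∀ t ∈ Set.Icc 0 T,
      ∫⁻ τ, (∫⁻ x, ‖bε ((T / N) ^ (1 / (2 * β))) t τ x - backwardField b t τ x‖ₑ) ∂timeMeasure t ≤
        ENNReal.ofReal (C₀ * (T / N) ^ (α / (2 * β))) := fun N hN hN0 t ht =>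
    (lintegral_mono' (timeMeasure_mono ht.2) le_rfl).trans (hB N hN hN0 t ht).2.2.2.2
  have hgrad : ∀ t ∈ Set.Icc 0 T,
      ∫⁻ s, eLpNorm (fun x => -Db (t - s) x) p volume ∂timeMeasure t ≤ ENNReal.ofReal G :=
    fun t ht => (lintegral_eLpNorm_backward_le ht.2).trans hbG
  have hcm : ∀ t ∈ Set.Icc 0 T, AEStronglyMeasurable (Function.uncurry (backwardField b t))
      ((timeMeasure t).prod volume) := fun t ht =>
    aestronglyMeasurable_backwardField (aestronglyMeasurable_mono_time hb.meas ht.2)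
  -- The compression constants that the flows `Y t` bring along may vary with `t` and `b`; they are
  -- replaced by the `L` of the scheme.
  have hflow : ∀ t ∈ Set.Icc 0 T, ∃ Z : ℝ → Sp d → Sp d, Measurable (Function.uncurry Z) ∧
      (∀ s ∈ Set.Icc 0 t, Compresses L (Z s)) ∧ ∀ᵐ x, ∀ s ∈ Set.Icc 0 t, Z s x = Y t s x := by
    intro t ht
    obtain ⟨Z, L', hZm, hZL, hZZ⟩ := (hY t ht).exists_measurable_version ht.1
    exact ⟨Z, hZm, (hY t ht).compresses_of_thetaScheme hp hp' hT hC₁ hC₃ hκ hh₀ hθ ht.2 (hcm t ht)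
      (hb.ae_weakGradient_backwardField ht.2) (ne_top_of_le_ne_top ENNReal.ofReal_ne_top
        (hgrad t ht))
      (fun N hN hN0 => ⟨(hB N hN hN0 t ht).1, (hB N hN hN0 t ht).2.1, (hB N hN hN0 t ht).2.2.2.1,
        hBt N hN hN0 t ht⟩)
      (fun N hN hN0 => ⟨hYθ N hN hN0 t ht, (hYc N hN hN0 t ht).1⟩) hZm hZL hZZ, hZZ⟩
  have huLY : ∀ t ∈ Set.Icc 0 T, ∀ᵐ x : Sp d, uL t x = u₀ (Y t t x) := fun t ht =>
    huL.ae_eq_comp_backward hp hp' ht hb (hY t ht)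
  have hest : ∀ N : ℕ, 0 < N → T / N ≤ h₀ → ∀ v : Sp d → ℝ, ContDiff ℝ ∞ v →
      HasCompactSupport v → ⨆ t ∈ Set.Icc 0 T,
        eLpNorm (numericalSolution T N (Yθ N) u₀ t - uL t) 1 volume ≤ ENNReal.ofReal
          ((2 * L + 1) * ((∫ x, |v x - u₀ x|) + K v / |Real.log (T / N)|)) := by
    intro N hN hN0 v hv hvs
    refine iSup₂_le fun t ht => ?_
    obtain ⟨Z, hZm, hZL, hZZ⟩ := hflow t ht
    have htt : t ∈ Set.Icc 0 t := ⟨ht.1, le_rfl⟩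
    obtain ⟨h1, h2, -, h4, -⟩ := hB N hN hN0 t ht
    have hI := hYc N hN hN0 t ht
    have h5 := hK v ⟨hv, hvs⟩ hN (hN0.trans_lt hh₁) θ hθ h1 h2 h4 (hYθ N hN hN0 t ht) hI.1 hI.2
      ht.2 (hcm t ht) (hb.ae_weakGradient_backwardField ht.2) (hgrad t ht) (hBt N hN hN0 t ht)
      (hY t ht) hZm hZL hZZ t htt
    have h6 := lintegral_enorm_comp_sub_comp_le_of_approx (hI.2 t ht) (hZL t htt) hu₀
      (hv.continuous.integrable_of_hasCompactSupport hvs)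
    have hq : 0 ≤ K v / |Real.log (T / N)| := div_nonneg (hK0 v ⟨hv, hvs⟩) (abs_nonneg _)
    have hi : 0 ≤ ∫ x, |v x - u₀ x| := integral_nonneg fun x => abs_nonneg _
    rw [eLpNorm_one_eq_lintegral_enorm]
    calc _ = ∫⁻ x, ‖u₀ (thetaInterp T N (Yθ N t) t x) - u₀ (Z t x)‖ₑ := by
          refine lintegral_congr_ae ?_
          filter_upwards [huLY t ht, hZZ] with x hx hx'
          rw [Pi.sub_apply, hx, ← hx' t htt, numericalSolution]
      _ ≤ ENNReal.ofReal (2 * L * ∫ x, |v x - u₀ x|) +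
          ENNReal.ofReal (K v / |Real.log (T / N)|) := h6.trans (by gcongr)
      _ ≤ _ := by
          rw [← ENNReal.ofReal_add (by positivity) hq]
          refine ENNReal.ofReal_le_ofReal ?_
          nlinarith [mul_nonneg L.coe_nonneg hq]
  refine ⟨fun t ht => ⟨?_, huLY t ht⟩, fun N hN hN0 => ⟨fun t ht => ?_, hest N hN hN0⟩,
    tendsto_zero_of_forall_test_le hT (by positivity) hh₀ hu₀ hest⟩
  · obtain ⟨Z, -, hZL, hZZ⟩ := hflow t ht
    have htt : t ∈ Set.Icc 0 t := ⟨ht.1, le_rfl⟩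
    refine ((hZL t htt).integrable_comp hu₀).congr ?_
    filter_upwards [huLY t ht, hZZ] with x hx hx'
    rw [hx, hx' t htt]
  · exact ((hYc N hN hN0 t ht).2 t ht).integrable_comp hu₀
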